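/- **Setting.** Let $V$ be a complex Hausdorff locally convex space that is *hilbertisable*: writing $\mathcal I_V$ for the set of continuous positive semi-definite Hermitian forms $\langle\cdot,\cdot\rangle_\alpha$ on $V$ (antilinear in the first, linear in the second argument) and $\|v\|_\alpha=\sqrt{\langle v,v\rangle_\alpha}$, every continuous seminorm on $V$ is dominated by some $\|\cdot\|_\alpha$. Let $v\mapsto\bar v$ be a continuous antilinear involution on $V$. *The algebra.* On the tensor algebra $\mathcal T^\bullet(V)=\bigoplus_{k\ge 0}V^{\otimes k}$ every $\alpha\in\mathcal I_V$ induces a positive Hermitian form, for which tensors of different degree are orthogonal and $\langle x_1\otimes\dots\otimes x_k,\,y_1\otimes\dots\otimes y_k\rangle^\bullet_\alpha=k!\prod_{m=1}^k\langle x_m,y_m\rangle_\alpha$. Give $\mathcal T^\bullet(V)$ the locally convex topology defined by all the seminorms $\|X\|_\alpha^\bullet=\sqrt{\langle X,X\rangle_\alpha^\bullet}$. Let $\mathscr S$ be the symmetrisation operator, $\mathscr S(x_1\otimes\dots\otimes x_k)=\frac1{k!}\sum_{\sigma\in\mathfrak S_k}x_{\sigma(1)}\otimes\dots\otimes x_{\sigma(k)}$,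 and let $\mathcal S^\bullet(V)=\mathscr S(\mathcal T^\bullet(V))$ carry the subspace topology, the commutative product $X\vee Y=\mathscr S(X\otimes Y)$ and the $*$-involution given by $(x_1\otimes\dots\otimes x_k)^*=\bar x_k\otimes\dots\otimes\bar x_1$. The product and the involution are continuous and extend to the completion $\mathcal S^\bullet(V)^{\mathrm{cpl}}$. *Evaluation.* Let $V'_h$ be the real vector space of all continuous linear functionals $\rho\colon V\to\mathbb C$ with $\overline{\rho(v)}=\rho(\bar v)$ for all $v\in V$. For $\rho\in V'_h$ let $D_\rho(x_1\otimes\dots\otimes x_k)=k\,\rho(x_k)\,x_1\otimes\dots\otimes x_{k-1}$ (and $D_\rho=0$ on scalars), $\tau^*_\rho=\sum_{t\ge 0}\frac1{t!}D_\rho^t$, and $\delta_\rho(X)=\langle\tau^*_\rho X\rangle_0$, the degree $0$ part. The restriction of $\delta_\rho$ to $\mathcal S^\bullet(V)$ is continuous and extends to $\mathcal S^\bullet(V)^{\mathrm{cpl}}$. The Gel'fand transform of $X\in\mathcal S^\bullet(V)^{\mathrm{cpl}}$ is the function $\widehat X\colon V'_h\to\mathbb C$, $\widehat X(\rho)=\delta_\rho(X)$.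 *Functions.* Let $\mathcal I_{V,h}$ be the set of all $\alpha\in\mathcal I_V$ with $\overline{\langle v,w\rangle_\alpha}=\langle\bar v,\bar w\rangle_\alpha$ for all $v,w\in V$. A set $B\subseteq V'_h$ is *bounded* if there is an $\alpha\in\mathcal I_{V,h}$ with $|\rho(v)|\le\|v\|_\alpha$ for all $\rho\in B$, $v\in V$; a multilinear form is bounded if it maps bounded sets to bounded sets. For $f\colon V'_h\to\mathbb C$ put $(\widehat D_\rho f)(\sigma)=\frac{d}{dt}\big|_{t=0}f(\sigma+t\rho)$ and $\widehat D^{(k)}_{(\rho_1,\dots,\rho_k)}f=\widehat D_{\rho_1}\cdots\widehat D_{\rho_k}f$. The function $f$ is *smooth* if all these iterated directional derivatives exist everywhere and, for all $k\ge 0$ and all $\sigma\in V'_h$, $(\rho_1,\dots,\rho_k)\mapsto(\widehat D^{(k)}_{(\rho_1,\dots,\rho_k)}f)(\sigma)$ is a bounded symmetric real-multilinear form. For $\alpha\in\mathcal I_{V,h}$ let $V_{h,\alpha}^{\mathrm{cpl}}$ be the real Hilbert space obtained from $V_h=\{v\in V:\bar v=v\}$ with $\langle\cdot,\cdot\rangle_\alpha$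 by dividing out the vectors of seminorm $0$ and completing; for $v\in V_{h,\alpha}^{\mathrm{cpl}}$ let $v^{\flat_\alpha}=\langle v,\cdot\rangle_\alpha\in V'_h$. The function $f$ is *analytic of Hilbert–Schmidt type* if it is smooth and for all $\sigma,\sigma'\in V'_h$ and $\alpha\in\mathcal I_{V,h}$ there are a constant $C_{\sigma,\sigma',\alpha}\in\mathbb R$ and a Hilbert basis $(e_i)_{i\in I}$ of $V_{h,\alpha}^{\mathrm{cpl}}$ such that $$\sum_{k=0}^\infty\frac1{k!}\sum_{i\in I^k}\Big|\big(\widehat D^{(k)}_{(e_{i_1}^{\flat_\alpha},\dots,e_{i_k}^{\flat_\alpha})}f\big)(\xi)\Big|^2\le C_{\sigma,\sigma',\alpha}$$ for every $\xi$ on the line segment between $\sigma$ and $\sigma'$. Let $\mathscr C^{\omega_{HS}}(V'_h)$ be the set of all such functions. **Theorem.** $\mathscr C^{\omega_{HS}}(V'_h)$ is a unital $*$-subalgebra of the algebra of all functions $V'_h\to\mathbb C$ (with pointwise operations and complex conjugation), and the Gel'fand transformation $X\mapsto\widehat X$ is an isomorphism of unital $*$-algebras from $\big(\mathcal S^\bullet(V)^{\mathrm{cpl}},\vee,{}^*\big)$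 onto $\mathscr C^{\omega_{HS}}(V'_h)$. -/

import Mathlib

open scoped TensorProduct ComplexConjugate ENNReal NNReal

noncomputable section

namespace HilbertTensor

/-! ### Continuous positive Hermitian forms -/

section Forms

variable (V : Type*) [AddCommGroup V] [Module ℂ V] [TopologicalSpace V]

/-- A continuous positive Hermitian form on `V`: sesquilinear (antilinear in the first, linear in
the second argument), Hermitian, positive semi-definite and (jointly) continuous. -/
structure HermForm where
  form : V →ₗ⋆[ℂ] V →ₗ[ℂ] ℂ
  conj_symm : ∀ v w, conj (form v w) = form w v
  nonneg : ∀ v, 0 ≤ (form v v).re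
  cont : Continuous fun p : V × V => form p.1 p.2

variable {V}

/-- The Hilbert seminorm of a positive Hermitian form. -/
def HermForm.nrm (α : HermForm V) (v : V) : ℝ := √(α.form v v).re

variable (V) in
/-- `V` is hilbertisable: it is locally convex and the continuous Hilbert seminorms are cofinal
among all continuous seminorms. -/
def Hilbertisable : Prop :=
  LocallyConvexSpace ℝ V ∧
    ∀ p : Seminorm ℂ V, Continuous p → ∃ α : HermForm V, ∀ v, p v ≤ α.nrm v

/-- Positive multiples of a form. -/
def HermForm.scale (c : ℝ≥0) (α : HermForm V) : HermForm V where
  form := ((c : ℝ) : ℂ) • α.form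
  conj_symm v w := by simp [α.conj_symm]
  nonneg v := by simpa using mul_nonneg c.2 (α.nonneg v)
  cont := continuous_const.mul α.cont

end Forms

/-! ### The tensor algebra -/

section Algebraic

variable (V : Type*) [AddCommGroup V] [Module ℂ V]

/-- The tensor algebra of `V`: the direct sum of the spaces of degree-`k` tensors. -/
def Tens := DirectSum ℕ fun k => ⨂[ℂ]^k V

instance : Ring (Tens V) :=
  { (inferInstance : AddCommGroup (DirectSum ℕ fun k => ⨂[ℂ]^k V)),
    (inferInstance : Semiring (DirectSum ℕ fun k => ⨂[ℂ]^k V)) with }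

instance : Algebra ℂ (Tens V) := inferInstanceAs (Algebra ℂ (DirectSum ℕ fun k => ⨂[ℂ]^k V))

variable {V}

/-- The inclusion of the tensors of degree `k`. -/
def ofDeg (k : ℕ) : (⨂[ℂ]^k V) →ₗ[ℂ] Tens V := DirectSum.lof ℂ ℕ (fun k => ⨂[ℂ]^k V) k

/-- The component of degree `k` of a tensor. -/
def deg (k : ℕ) : Tens V →ₗ[ℂ] ⨂[ℂ]^k V := DirectSum.component ℂ ℕ (fun k => ⨂[ℂ]^k V) k

/-- The linear map on the tensor algebra which is given by `f k` in degree `k`. -/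
def liftT {W : Type*} [AddCommGroup W] [Module ℂ W] (f : ∀ k, (⨂[ℂ]^k V) →ₗ[ℂ] W) :
    Tens V →ₗ[ℂ] W :=
  DirectSum.toModule ℂ ℕ W f

theorem liftT_ofDeg {W : Type*} [AddCommGroup W] [Module ℂ W] (f : ∀ k, (⨂[ℂ]^k V) →ₗ[ℂ] W)
    (k : ℕ) (t : ⨂[ℂ]^k V) : liftT f (ofDeg k t) = f k t :=
  DirectSum.toModule_lof (M := fun k => ⨂[ℂ]^k V) ℂ k t

theorem deg_ofDeg (k : ℕ) (t : ⨂[ℂ]^k V) : deg k (ofDeg k t) = t :=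
  DirectSum.component.lof_self (M := fun k => ⨂[ℂ]^k V) ℂ k t

theorem deg_ofDeg_of_ne {k l : ℕ} (h : k ≠ l) (t : ⨂[ℂ]^k V) : deg l (ofDeg k t) = 0 := by
  refine (DirectSum.component.of (M := fun k => ⨂[ℂ]^k V) ℂ l k t).trans ?_
  rw [dif_neg h]

/-- The simple tensor `x₁ ⊗ ⋯ ⊗ x_k`. -/
def simple {k : ℕ} (x : Fin k → V) : Tens V := ofDeg k (PiTensorProduct.tprod ℂ x)

theorem tens_induction {p : Tens V → Prop}
    (h0 : ∀ (c : ℂ) (k : ℕ) (x : Fin k → V), p (c • simple x))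
    (hadd : ∀ X Y, p X → p Y → p (X + Y)) (X : Tens V) : p X := by
  have hz : p 0 := by simpa using h0 0 0 (Fin.elim0)
  refine DirectSum.induction_on (motive := p) X hz (fun k t => ?_) hadd
  change p (ofDeg k t)
  induction t using PiTensorProduct.induction_on with
  | smul_tprod c x => rw [map_smul]; exact h0 c k x
  | add a b ha hb => rw [map_add]; exact hadd _ _ ha hb

theorem simple_mul {k l : ℕ} (x : Fin k → V) (y : Fin l → V) :
    simple x * simple y = simple (Fin.append x y) := by
  refine (DirectSum.of_mul_of (A := fun k => ⨂[ℂ]^k V) (PiTensorProduct.tprod ℂ x)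
    (PiTensorProduct.tprod ℂ y)).trans ?_
  rw [TensorPower.tprod_mul_tprod]
  rfl

theorem simple_elim0 (x : Fin 0 → V) : simple x = 1 := by
  rw [Subsingleton.elim x Fin.elim0]; rfl

theorem simple_cast {k l : ℕ} (h : k = l) (x : Fin l → V) :
    simple (fun i : Fin k => x (Fin.cast h i)) = simple x := by
  subst h; rfl

/-! Semilinear maps out of the tensor algebra -/

/-- The space `W` with the conjugate scalar multiplication; only used to construct antilinear
maps. -/
def ConjMod (W : Type*) := W

instance (W : Type*) [AddCommGroup W] : AddCommGroup (ConjMod W) := inferInstanceAs (AddCommGroup W)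

instance (W : Type*) [AddCommGroup W] [Module ℂ W] : Module ℂ (ConjMod W) :=
  Module.compHom W (starRingEnd ℂ)

/-- The antilinear map on the tensor algebra with prescribed values `f k x` on simple tensors. -/
def liftConj {W : Type*} [AddCommGroup W] [Module ℂ W]
    (f : ∀ k, MultilinearMap ℂ (fun _ : Fin k => V) (ConjMod W)) : Tens V →ₗ⋆[ℂ] W where
  toFun X := liftT (W := ConjMod W) (fun k => PiTensorProduct.lift (f k)) X
  map_add' X Y := map_add (liftT (W := ConjMod W) (fun k => PiTensorProduct.lift (f k))) X Y
  map_smul' c X := map_smul (liftT (W := ConjMod W) (fun k => PiTensorProduct.lift (f k))) c X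

theorem liftConj_simple {W : Type*} [AddCommGroup W] [Module ℂ W]
    (f : ∀ k, MultilinearMap ℂ (fun _ : Fin k => V) (ConjMod W)) {k : ℕ} (x : Fin k → V) :
    liftConj f (simple x) = f k x :=
  (liftT_ofDeg (W := ConjMod W) _ k _).trans (PiTensorProduct.lift.tprod x)

/-! Symmetrisation and the space of symmetric tensors -/

/-- The symmetrisation operator: on simple tensors of degree `k` it is
`x₁ ⊗ ⋯ ⊗ x_k ↦ (1 / k!) ∑ σ, x_{σ 1} ⊗ ⋯ ⊗ x_{σ k}`. -/
def symm : Tens V →ₗ[ℂ] Tens V :=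
  liftT fun k =>
    (k.factorial : ℂ)⁻¹ • ∑ σ : Equiv.Perm (Fin k),
      ofDeg k ∘ₗ PiTensorProduct.lift ((PiTensorProduct.tprod ℂ).domDomCongr σ)

theorem symm_simple {k : ℕ} (x : Fin k → V) :
    symm (simple x) = (k.factorial : ℂ)⁻¹ • ∑ σ : Equiv.Perm (Fin k), simple (x ∘ σ) := by
  simp only [symm, simple]
  rw [liftT_ofDeg]
  simp [LinearMap.sum_apply]
  rfl

theorem symm_simple_comp {k : ℕ} (x : Fin k → V) (σ : Equiv.Perm (Fin k)) :
    symm (simple (x ∘ σ)) = symm (simple x) := by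
  rw [symm_simple, symm_simple]
  congr 1
  exact Fintype.sum_equiv (Equiv.mulLeft σ) _ _ fun τ => rfl

theorem symm_simple_equiv {k l : ℕ} (x : Fin l → V) (e : Fin k ≃ Fin l) :
    symm (simple (x ∘ e)) = symm (simple x) := by
  obtain rfl : k = l := by simpa using Fintype.card_congr e
  exact symm_simple_comp x e

theorem avg_const {k : ℕ} {W : Type*} [AddCommGroup W] [Module ℂ W] (w : W) :
    (k.factorial : ℂ)⁻¹ • ∑ _σ : Equiv.Perm (Fin k), w = w := by
  rw [Finset.sum_const, Finset.card_univ, Fintype.card_perm, Fintype.card_fin,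
    ← Nat.cast_smul_eq_nsmul ℂ, smul_smul, inv_mul_cancel₀, one_smul]
  exact_mod_cast k.factorial_ne_zero

theorem symm_symm (X : Tens V) : symm (symm X) = symm X := by
  induction X using tens_induction with
  | h0 c k x =>
    rw [map_smul, map_smul]
    congr 1
    conv_lhs => rw [symm_simple, map_smul, map_sum]
    simp only [symm_simple_comp]
    exact avg_const _
  | hadd X Y hX hY => simp only [map_add, hX, hY]

theorem symm_mul_comm (X Y : Tens V) : symm (X * Y) = symm (Y * X) := by
  induction X using tens_induction with
  | hadd X X' hX hX' => simp only [map_add, add_mul, mul_add, hX, hX']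
  | h0 c k x =>
    induction Y using tens_induction with
    | hadd Y Y' hY hY' => simp only [map_add, add_mul, mul_add, hY, hY']
    | h0 d l y =>
      simp only [smul_mul_assoc, mul_smul_comm, map_smul, simple_mul]
      rw [smul_comm]
      congr 2
      rw [← symm_simple_equiv (Fin.append y x) finAddFlip]
      congr 2
      ext i
      refine Fin.addCases (fun i => ?_) (fun i => ?_) i <;> simp

theorem symm_symm_mul (X Y : Tens V) : symm (symm X * Y) = symm (X * Y) := by
  induction X using tens_induction with
  | hadd X X' hX hX' => simp only [map_add, add_mul, hX, hX']
  | h0 c k x =>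
    induction Y using tens_induction with
    | hadd Y Y' hY hY' => simp only [map_add, mul_add, hY, hY']
    | h0 d l y =>
      simp only [smul_mul_assoc, mul_smul_comm, map_smul]
      congr 2
      rw [symm_simple, smul_mul_assoc, map_smul, Finset.sum_mul, map_sum]
      have (σ : Equiv.Perm (Fin k)) :
          symm (simple (x ∘ σ) * simple y) = symm (simple x * simple y) := by
        rw [simple_mul, simple_mul, ← symm_simple_equiv (Fin.append x y)
          ((finSumFinEquiv.symm.trans (Equiv.sumCongr σ (Equiv.refl _))).trans finSumFinEquiv)]
        congr 2
        ext i
        refine Fin.addCases (fun i => ?_) (fun i => ?_) i <;> simp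
      simp only [this]
      exact avg_const _

theorem symm_mul_symm (X Y : Tens V) : symm (X * symm Y) = symm (X * Y) := by
  rw [symm_mul_comm, symm_symm_mul, symm_mul_comm]

theorem symm_one : symm (1 : Tens V) = 1 := by
  rw [← simple_elim0 (Fin.elim0 : Fin 0 → V), symm_simple]
  simp only [simple_elim0]
  exact avg_const _

variable (V) in
/-- The space of symmetric tensors: the range of the projector `symm`. -/
def symTens : Submodule ℂ (Tens V) := LinearMap.range symm

theorem symm_mem (X : Tens V) : symm X ∈ symTens V := ⟨X, rfl⟩

theorem symm_of_mem (X : symTens V) : symm (X : Tens V) = X := by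
  obtain ⟨_, Y, rfl⟩ := X
  exact symm_symm Y

/-- The symmetric tensor product `X ∨ Y = symm (X ⊗ Y)`. -/
instance : Mul (symTens V) := ⟨fun X Y => ⟨symm ((X : Tens V) * (Y : Tens V)), symm_mem _⟩⟩

instance : One (symTens V) := ⟨⟨1, 1, symm_one⟩⟩

theorem coe_vee (X Y : symTens V) : ((X * Y : symTens V) : Tens V) = symm ((X : Tens V) * (Y : Tens V)) := rfl

theorem coe_one : ((1 : symTens V) : Tens V) = 1 := rfl

/-- Symmetric tensors with the product `∨` form a commutative ring. -/
instance : CommRing (symTens V) :=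
  { (inferInstance : AddCommGroup (symTens V)) with
    mul := (· * ·)
    one := 1
    mul_assoc := fun X Y Z => Subtype.ext <| by
      simp only [coe_vee, symm_symm_mul, symm_mul_symm, mul_assoc]
    one_mul := fun X => Subtype.ext <| by simp [coe_vee, coe_one, symm_of_mem]
    mul_one := fun X => Subtype.ext <| by simp [coe_vee, coe_one, symm_of_mem]
    mul_comm := fun X Y => Subtype.ext <| by simp only [coe_vee]; exact symm_mul_comm _ _
    zero_mul := fun X => Subtype.ext <| by simp [coe_vee]
    mul_zero := fun X => Subtype.ext <| by simp [coe_vee]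
    left_distrib := fun X Y Z => Subtype.ext <| by simp [coe_vee, mul_add]
    right_distrib := fun X Y Z => Subtype.ext <| by simp [coe_vee, add_mul] }

instance : Algebra ℂ (symTens V) :=
  Algebra.ofModule
    (fun c X Y => Subtype.ext <| by simp [coe_vee])
    (fun c X Y => Subtype.ext <| by simp [coe_vee])

/-! The involution -/

section Involution

variable [StarAddMonoid V] [StarModule ℂ V]

theorem update_star_rev {W : Type*} [Star W] {k : ℕ} [DecidableEq (Fin k)] (x : Fin k → W)
    (j : Fin k) (v : W) :
    (fun i => star (Function.update x j v i.rev)) =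
      Function.update (fun i => star (x i.rev)) j.rev (star v) := by
  ext i
  by_cases h : i = j.rev
  · subst h; simp
  · have h' : i.rev ≠ j := fun e => h (by rw [← e, Fin.rev_rev])
    simp [Function.update_of_ne h, Function.update_of_ne h']

/-- The antilinear involution `(x₁ ⊗ ⋯ ⊗ x_k)* = x̄_k ⊗ ⋯ ⊗ x̄₁` on the tensor algebra. -/
def starT : Tens V →ₗ⋆[ℂ] Tens V :=
  liftConj fun k =>
    { toFun := fun x => simple fun i => star (x i.rev)
      map_update_add' := fun {_} x i a b => by
        simp only [update_star_rev, star_add, simple, MultilinearMap.map_update_add, map_add]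
        rfl
      map_update_smul' := fun {_} x i c a => by
        simp only [update_star_rev, star_smul, simple, MultilinearMap.map_update_smul, map_smul]
        rfl }

theorem starT_simple {k : ℕ} (x : Fin k → V) :
    starT (simple x) = simple fun i => star (x i.rev) := liftConj_simple _ x

theorem starT_starT (X : Tens V) : starT (starT X) = X := by
  induction X using tens_induction with
  | hadd X Y hX hY => simp only [map_add, hX, hY]
  | h0 c k x => simp [starT_simple, LinearMap.map_smulₛₗ]

theorem starT_mul (X Y : Tens V) : starT (X * Y) = starT Y * starT X := by
  induction X using tens_induction with
  | hadd X X' hX hX' => simp only [map_add, add_mul, mul_add, hX, hX']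
  | h0 c k x =>
    induction Y using tens_induction with
    | hadd Y Y' hY hY' => simp only [map_add, add_mul, mul_add, hY, hY']
    | h0 d l y =>
      simp only [smul_mul_assoc, mul_smul_comm, LinearMap.map_smulₛₗ, simple_mul, starT_simple]
      rw [smul_comm]
      congr 2
      rw [← simple_cast (add_comm k l)]
      congr 1
      ext i
      rw [Fin.append_rev]
      generalize Fin.cast (Nat.add_comm k l) i = j
      refine Fin.addCases (fun i => ?_) (fun i => ?_) j <;> simp

theorem starT_symm (X : Tens V) : starT (symm X) = symm (starT X) := by
  induction X using tens_induction with
  | hadd X Y hX hY => simp only [map_add, hX, hY]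
  | h0 c k x =>
    simp only [LinearMap.map_smulₛₗ, map_smul, starT_simple, symm_simple, map_sum]
    simp only [map_inv₀, map_natCast]
    congr 2
    refine Fintype.sum_equiv ((Equiv.mulLeft Fin.revPerm).trans (Equiv.mulRight Fin.revPerm)) _ _
      fun τ => ?_
    congr 1
    ext i
    simp

instance : Star (symTens V) :=
  ⟨fun X => ⟨starT (X : Tens V), by
    rw [← symm_of_mem X, starT_symm]; exact symm_mem _⟩⟩

theorem coe_star (X : symTens V) : ((star X : symTens V) : Tens V) = starT (X : Tens V) := rfl

instance : StarRing (symTens V) where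
  star_involutive X := Subtype.ext <| by simp [coe_star, starT_starT]
  star_mul X Y := Subtype.ext <| by simp [coe_star, coe_vee, starT_symm, starT_mul]
  star_add X Y := Subtype.ext <| by simp [coe_star]

instance : StarModule ℂ (symTens V) where
  star_smul c X := Subtype.ext <| by simp [coe_star, LinearMap.map_smulₛₗ]

end Involution

end Algebraic

/-! ### The topology on the tensor algebra -/

open scoped ComplexOrder

section Proj

variable {V : Type*} [AddCommGroup V] [Module ℂ V]

/-- The projection onto tensors of degree `k`. -/
def proj (k : ℕ) : Tens V →ₗ[ℂ] Tens V := ofDeg k ∘ₗ deg k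

theorem proj_simple {k : ℕ} (x : Fin k → V) : proj k (simple x) = simple x := by
  simp [proj, simple, deg_ofDeg]

theorem proj_simple_of_ne {k l : ℕ} (h : l ≠ k) (x : Fin k → V) : proj l (simple x) = 0 := by
  simp [proj, simple, deg_ofDeg_of_ne h.symm]

theorem exists_eq_sum_proj (X : Tens V) : ∃ s : Finset ℕ, X = ∑ k ∈ s, proj k X := by
  classical
  refine ⟨DFinsupp.support (β := fun k => ⨂[ℂ]^k V) X, ?_⟩
  exact (DirectSum.sum_support_of (β := fun k => ⨂[ℂ]^k V) X).symm

theorem lift_update_add {k : ℕ} [DecidableEq (Fin k)] (f : Fin k → V →ₗ[ℂ] ℂ) (j : Fin k)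
    (a b : V →ₗ[ℂ] ℂ) :
    PiTensorProduct.lift ((MultilinearMap.mkPiAlgebra ℂ (Fin k) ℂ).compLinearMap
        (Function.update f j (a + b))) =
      PiTensorProduct.lift ((MultilinearMap.mkPiAlgebra ℂ (Fin k) ℂ).compLinearMap
        (Function.update f j a)) +
      PiTensorProduct.lift ((MultilinearMap.mkPiAlgebra ℂ (Fin k) ℂ).compLinearMap
        (Function.update f j b)) := by
  rw [← map_add]
  congr 1
  exact (MultilinearMap.piLinearMap (MultilinearMap.mkPiAlgebra ℂ (Fin k) ℂ)).map_update_add f j a b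

theorem lift_update_smul {k : ℕ} [DecidableEq (Fin k)] (f : Fin k → V →ₗ[ℂ] ℂ) (j : Fin k)
    (c : ℂ) (a : V →ₗ[ℂ] ℂ) :
    PiTensorProduct.lift ((MultilinearMap.mkPiAlgebra ℂ (Fin k) ℂ).compLinearMap
        (Function.update f j (c • a))) =
      c • PiTensorProduct.lift ((MultilinearMap.mkPiAlgebra ℂ (Fin k) ℂ).compLinearMap
        (Function.update f j a)) := by
  rw [← map_smul]
  congr 1
  exact (MultilinearMap.piLinearMap (MultilinearMap.mkPiAlgebra ℂ (Fin k) ℂ)).map_update_smul f j c a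

end Proj

section Topology

variable {V : Type*} [AddCommGroup V] [Module ℂ V] [TopologicalSpace V]

theorem update_form {V W : Type*} {k : ℕ} [DecidableEq (Fin k)] (f : V → W) (x : Fin k → V)
    (j : Fin k) (v : V) :
    (fun m => f (Function.update x j v m)) = Function.update (fun m => f (x m)) j (f v) := by
  ext i
  exact Function.apply_update (fun _ => f) x j v i

/-- The extension of a form `α` to the tensor algebra: tensors of different degree are orthogonal,
and `⟨x₁ ⊗ ⋯ ⊗ x_k, y₁ ⊗ ⋯ ⊗ y_k⟩ = k! ∏ m, ⟨x_m, y_m⟩_α`. -/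
def HermForm.ext (α : HermForm V) : Tens V →ₗ⋆[ℂ] Tens V →ₗ[ℂ] ℂ :=
  liftConj fun k =>
    { toFun := fun x => (k.factorial : ℂ) •
        (PiTensorProduct.lift ((MultilinearMap.mkPiAlgebra ℂ (Fin k) ℂ).compLinearMap
          fun m => α.form (x m))) ∘ₗ deg k
      map_update_add' := fun {_} x i a b => by
        rw [update_form, update_form, update_form, map_add, lift_update_add, LinearMap.add_comp,
          smul_add]
        rfl
      map_update_smul' := fun {_} x i c a => by
        rw [update_form, update_form, LinearMap.map_smulₛₗ, lift_update_smul, LinearMap.smul_comp,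
          smul_comm]
        rfl }

theorem HermForm.ext_simple_left (α : HermForm V) {k : ℕ} (x : Fin k → V) :
    α.ext (simple x) = (k.factorial : ℂ) •
        (PiTensorProduct.lift ((MultilinearMap.mkPiAlgebra ℂ (Fin k) ℂ).compLinearMap
          fun m => α.form (x m))) ∘ₗ deg k :=
  liftConj_simple _ x

theorem HermForm.ext_simple (α : HermForm V) {k : ℕ} (x y : Fin k → V) :
    α.ext (simple x) (simple y) = k.factorial * ∏ m, α.form (x m) (y m) := by
  rw [ext_simple_left]
  simp [simple, deg_ofDeg]

theorem HermForm.ext_simple_of_ne (α : HermForm V) {k l : ℕ} (h : k ≠ l) (x : Fin k → V)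
    (y : Fin l → V) : α.ext (simple x) (simple y) = 0 := by
  rw [ext_simple_left]
  simp [simple, deg_ofDeg_of_ne h.symm]

theorem HermForm.ext_conj_symm (α : HermForm V) (X Y : Tens V) :
    conj (α.ext X Y) = α.ext Y X := by
  induction X using tens_induction with
  | hadd X X' hX hX' => simp only [map_add, LinearMap.add_apply, hX, hX']
  | h0 c k x =>
    induction Y using tens_induction with
    | hadd Y Y' hY hY' => simp only [map_add, LinearMap.add_apply, hY, hY']
    | h0 d l y =>
      simp only [LinearMap.map_smulₛₗ, LinearMap.smul_apply, map_smul, smul_eq_mul, map_mul,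
        Complex.conj_conj]
      by_cases h : k = l
      · subst h
        simp only [ext_simple, map_mul, map_prod, α.conj_symm, map_natCast]
        ring
      · simp [ext_simple_of_ne α h, ext_simple_of_ne α (Ne.symm h)]

theorem ext_proj (α : HermForm V) (k : ℕ) (X Y : Tens V) :
    α.ext (proj k X) (proj k Y) = α.ext X (proj k Y) := by
  induction X using tens_induction with
  | hadd X X' hX hX' => simp only [map_add, LinearMap.add_apply, hX, hX']
  | h0 c l x =>
    induction Y using tens_induction with
    | hadd Y Y' hY hY' => simp only [map_add, hY, hY']
    | h0 d m y =>
      simp only [LinearMap.map_smulₛₗ, LinearMap.smul_apply, map_smul, smul_eq_mul]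
      by_cases h : k = l
      · subst h; rw [proj_simple]
      · rw [proj_simple_of_ne h]
        by_cases h' : k = m
        · subst h'
          rw [proj_simple, α.ext_simple_of_ne (Ne.symm h)]
          simp
        · rw [proj_simple_of_ne h']
          simp

theorem posSemidef_gram (α : HermForm V) {ι : Type*} (x : ι → V) :
    (Matrix.of fun i j => α.form (x i) (x j)).PosSemidef := by
  refine ⟨?_, fun c => ?_⟩
  · ext i j
    simp only [Matrix.conjTranspose_apply, Matrix.of_apply]
    exact α.conj_symm _ _
  · have : (c.sum fun i ci => c.sum fun j cj =>
        star ci * (Matrix.of fun i j => α.form (x i) (x j)) i j * cj) =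
        α.form (c.sum fun i ci => ci • x i) (c.sum fun i ci => ci • x i) := by
      simp only [Finsupp.sum, map_sum, LinearMap.sum_apply, LinearMap.map_smulₛₗ,
        LinearMap.smul_apply, smul_eq_mul, Matrix.of_apply, Finset.mul_sum]
      rw [Finset.sum_comm]
      refine Finset.sum_congr rfl fun i _ => Finset.sum_congr rfl fun j _ => ?_
      simp
      ring
    rw [this, Complex.le_def]
    refine ⟨by simpa using α.nonneg _, ?_⟩
    exact (Complex.conj_eq_iff_im.1 (α.conj_symm _ _)).symm

theorem posSemidef_gram_prod (α : HermForm V) {ι κ : Type*} (x : ι → κ → V) (s : Finset κ) :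
    (Matrix.of fun i j => ∏ m ∈ s, α.form (x i m) (x j m)).PosSemidef := by
  classical
  induction s using Finset.induction_on with
  | empty =>
    refine ⟨by ext; simp, fun c => ?_⟩
    simp only [Finset.prod_empty, Matrix.of_apply, mul_one, Finsupp.sum, ← Finset.mul_sum,
      ← Finset.sum_mul]
    rw [← star_sum]
    exact star_mul_self_nonneg _
  | insert a s ha ih =>
    have := (posSemidef_gram α fun i => x i a).hadamard ih
    convert! this using 1
    ext i j
    simp [Finset.prod_insert ha]

theorem ext_proj_nonneg (α : HermForm V) (k : ℕ) (X : Tens V) :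
    0 ≤ (α.ext (proj k X) (proj k X)).re := by
  have h : deg k X ∈ Submodule.span ℂ (Set.range (PiTensorProduct.tprod ℂ (s := fun _ : Fin k => V))) := by
    rw [PiTensorProduct.span_tprod_eq_top]; trivial
  obtain ⟨c, hc⟩ := Finsupp.mem_span_range_iff_exists_finsupp.1 h
  have hX : proj k X = c.sum fun x cx => cx • simple x := by
    simp only [proj, LinearMap.comp_apply, ← hc, Finsupp.sum, map_sum, map_smul, simple]
  have hp := (posSemidef_gram_prod α (fun x : Fin k → V => x) Finset.univ).2 c
  have : α.ext (proj k X) (proj k X) = k.factorial * (c.sum fun i ci => c.sum fun j cj =>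
        star ci * (Matrix.of fun x y : Fin k → V => ∏ m, α.form (x m) (y m)) i j * cj) := by
    rw [hX]
    simp only [Finsupp.sum, map_sum, LinearMap.sum_apply, LinearMap.map_smulₛₗ, map_smul,
      LinearMap.smul_apply, smul_eq_mul, Matrix.of_apply, HermForm.ext_simple, Finset.mul_sum]
    rw [Finset.sum_comm]
    refine Finset.sum_congr rfl fun i _ => Finset.sum_congr rfl fun j _ => ?_
    simp
    ring
  rw [this, ← Complex.ofReal_natCast, Complex.re_ofReal_mul]
  exact mul_nonneg (Nat.cast_nonneg _) (Complex.le_def.1 hp).1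

theorem HermForm.ext_nonneg (α : HermForm V) (X : Tens V) : 0 ≤ (α.ext X X).re := by
  obtain ⟨s, hs⟩ := exists_eq_sum_proj X
  have : α.ext X X = ∑ k ∈ s, α.ext (proj k X) (proj k X) := by
    conv_lhs => rw [hs, map_sum]
    refine Finset.sum_congr rfl fun k _ => ?_
    rw [ext_proj, ← hs]
  rw [this, Complex.re_sum]
  exact Finset.sum_nonneg fun k _ => ext_proj_nonneg α k X

/-- The positive Hermitian form on the tensor algebra as an inner product (a proof device). -/
abbrev HermForm.core (α : HermForm V) : PreInnerProductSpace.Core ℂ (Tens V) where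
  inner X Y := α.ext X Y
  conj_inner_symm X Y := α.ext_conj_symm Y X
  re_inner_nonneg := α.ext_nonneg
  add_left X Y Z := by simp
  smul_left X Y r := by simp

theorem cauchy_schwarz (α : HermForm V) (X Y : Tens V) :
    ‖α.ext X Y‖ ≤ √(α.ext X X).re * √(α.ext Y Y).re :=
  @InnerProductSpace.Core.norm_inner_le_norm ℂ (Tens V) _ _ _ α.core X Y

/-- The extension of the Hilbert seminorm of `α` to the tensor algebra. -/
def HermForm.tnorm (α : HermForm V) : Seminorm ℂ (Tens V) :=
  Seminorm.of (fun X => √(α.ext X X).re)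
    (fun X Y => @norm_add_le (Tens V)
      (@InnerProductSpace.Core.toSeminormedAddCommGroup ℂ _ _ _ _ α.core).toSeminormedAddGroup X Y)
    (fun c X => by
      have : α.ext (c • X) (c • X) = ((‖c‖ ^ 2 : ℝ) : ℂ) * α.ext X X := by
        simp only [LinearMap.map_smulₛₗ, LinearMap.smul_apply, map_smul, smul_eq_mul]
        rw [← mul_assoc, Complex.mul_conj']
        push_cast
        ring
      rw [this, Complex.re_ofReal_mul, Real.sqrt_mul (by positivity), Real.sqrt_sq (norm_nonneg c)])

theorem HermForm.tnorm_apply (α : HermForm V) (X : Tens V) : α.tnorm X = √(α.ext X X).re := rfl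

/-- The topology of the tensor algebra, as a uniform structure: it is defined by the extensions of
all continuous Hilbert seminorms on `V`. -/
instance : UniformSpace (Tens V) :=
  ⨅ α : HermForm V, α.tnorm.toSeminormedAddCommGroup.toUniformSpace

instance : IsUniformAddGroup (Tens V) :=
  isUniformAddGroup_iInf fun α =>
    @SeminormedAddCommGroup.to_isUniformAddGroup (Tens V) α.tnorm.toSeminormedAddCommGroup

theorem withSeminorms_tnorm :
    WithSeminorms (fun α : HermForm V => α.tnorm) :=
  (SeminormFamily.withSeminorms_iff_uniformSpace_eq_iInf (𝕜 := ℂ) (E := Tens V) _).2 rfl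

end Topology

section Continuity

variable {V : Type*} [AddCommGroup V] [Module ℂ V] [TopologicalSpace V]

theorem tnorm_sq (α : HermForm V) (X : Tens V) : α.tnorm X ^ 2 = (α.ext X X).re := by
  rw [α.tnorm_apply, Real.sq_sqrt (α.ext_nonneg X)]

theorem ext_self (α : HermForm V) (X : Tens V) : α.ext X X = ((α.tnorm X ^ 2 : ℝ) : ℂ) := by
  rw [tnorm_sq]
  exact (Complex.conj_eq_iff_re.1 (α.ext_conj_symm X X)).symm

theorem tnorm_le_of_ext_eq (α : HermForm V) {X Y : Tens V} (h : α.ext Y Y = α.ext X Y) :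
    α.tnorm Y ≤ α.tnorm X := by
  by_contra! hlt
  have h1 : α.tnorm Y ^ 2 ≤ α.tnorm X * α.tnorm Y := by
    rw [tnorm_sq, h]
    exact (Complex.re_le_norm _).trans (cauchy_schwarz α X Y)
  have h2 := apply_nonneg α.tnorm X
  nlinarith

theorem tnorm_proj_le (α : HermForm V) (k : ℕ) (X : Tens V) :
    α.tnorm (proj k X) ≤ α.tnorm X :=
  tnorm_le_of_ext_eq α (ext_proj α k X X)

theorem ext_symm (α : HermForm V) (X Y : Tens V) : α.ext (symm X) Y = α.ext X (symm Y) := by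
  induction X using tens_induction with
  | hadd X X' hX hX' => simp only [map_add, LinearMap.add_apply, hX, hX']
  | h0 c k x =>
    induction Y using tens_induction with
    | hadd Y Y' hY hY' => simp only [map_add, hY, hY']
    | h0 d l y =>
      simp only [LinearMap.map_smulₛₗ, LinearMap.smul_apply, map_smul, symm_simple, map_sum,
        LinearMap.sum_apply]
      by_cases h : k = l
      · subst h
        have key : ∑ σ : Equiv.Perm (Fin k), α.ext (simple (x ∘ σ)) (simple y) =
            ∑ σ : Equiv.Perm (Fin k), α.ext (simple x) (simple (y ∘ σ)) := by
          simp only [α.ext_simple]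
          refine Fintype.sum_equiv (Equiv.inv (Equiv.Perm (Fin k))) _ _ fun σ => ?_
          congr 1
          refine Fintype.prod_equiv σ _ _ fun m => ?_
          simp
        simp only [map_inv₀, map_natCast, smul_eq_mul, ← Finset.mul_sum, key]
        ring
      · simp [α.ext_simple_of_ne h]

theorem tnorm_symm_le (α : HermForm V) (X : Tens V) : α.tnorm (symm X) ≤ α.tnorm X :=
  tnorm_le_of_ext_eq α (by rw [ext_symm, symm_symm])

theorem scale_ext_proj (c : ℝ≥0) (α : HermForm V) (k : ℕ) (X Y : Tens V) :
    (α.scale c).ext (proj k X) (proj k Y) = ((c : ℝ) : ℂ) ^ k * α.ext (proj k X) (proj k Y) := by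
  induction X using tens_induction with
  | hadd X X' hX hX' => simp only [map_add, LinearMap.add_apply, hX, hX', mul_add]
  | h0 a l x =>
    induction Y using tens_induction with
    | hadd Y Y' hY hY' => simp only [map_add, hY, hY', mul_add]
    | h0 d m y =>
      simp only [LinearMap.map_smulₛₗ, LinearMap.smul_apply, map_smul, smul_eq_mul]
      by_cases h : k = l
      · subst h
        by_cases h' : k = m
        · subst h'
          simp only [proj_simple, HermForm.ext_simple, HermForm.scale, LinearMap.smul_apply,
            smul_eq_mul, Finset.prod_mul_distrib, Finset.prod_const, Finset.card_univ,
            Fintype.card_fin]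
          ring
        · simp [proj_simple_of_ne h']
      · simp [proj_simple_of_ne h]

theorem scale_tnorm_proj (α : HermForm V) (k : ℕ) (X : Tens V) :
    (α.scale 16).tnorm (proj k X) = 4 ^ k * α.tnorm (proj k X) := by
  rw [HermForm.tnorm_apply, scale_ext_proj, ← Complex.ofReal_pow, Complex.re_ofReal_mul,
    Real.sqrt_mul (by positivity), ← HermForm.tnorm_apply]
  congr 1
  rw [show ((16 : ℝ≥0) : ℝ) = 4 ^ 2 by norm_num, ← pow_mul, mul_comm 2 k, pow_mul,
    Real.sqrt_sq (by positivity)]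

theorem sum_proj_le (α : HermForm V) (s : Finset ℕ) (X : Tens V) :
    ∑ k ∈ s, 2 ^ k * α.tnorm (proj k X) ≤ 2 * (α.scale 16).tnorm X := by
  have h (k : ℕ) : 2 ^ k * α.tnorm (proj k X) ≤ (1 / 2) ^ k * (α.scale 16).tnorm X := by
    have h1 := tnorm_proj_le (α.scale 16) k X
    rw [scale_tnorm_proj] at h1
    calc 2 ^ k * α.tnorm (proj k X) = (1 / 2) ^ k * (4 ^ k * α.tnorm (proj k X)) := by
          rw [← mul_assoc, ← mul_pow]; norm_num
      _ ≤ _ := by gcongr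
  refine (Finset.sum_le_sum fun k _ => h k).trans ?_
  rw [← Finset.sum_mul]
  refine mul_le_mul_of_nonneg_right ?_ (apply_nonneg _ _)
  have := summable_geometric_two.sum_le_tsum s (fun k _ => by positivity)
  rwa [tsum_geometric_two] at this

theorem ext_mul_proj (α : HermForm V) (k l : ℕ) (X Y X' Y' : Tens V) :
    α.ext (proj k X * proj l Y) (proj k X' * proj l Y') =
      (k + l).choose l * (α.ext (proj k X) (proj k X') * α.ext (proj l Y) (proj l Y')) := by
  induction X using tens_induction with
  | hadd _ _ h h' => simp only [map_add, add_mul, LinearMap.add_apply, h, h', mul_add]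
  | h0 a k₁ x =>
  induction X' using tens_induction with
  | hadd _ _ h h' => simp only [map_add, add_mul, h, h', mul_add]
  | h0 b k₂ x' =>
  induction Y using tens_induction with
  | hadd _ _ h h' => simp only [map_add, mul_add, LinearMap.add_apply, h, h']
  | h0 c l₁ y =>
  induction Y' using tens_induction with
  | hadd _ _ h h' => simp only [map_add, mul_add, h, h']
  | h0 d l₂ y' =>
  by_cases h₁ : k = k₁
  swap
  · simp [proj_simple_of_ne h₁]
  by_cases h₂ : k = k₂
  swap
  · simp [proj_simple_of_ne h₂]
  by_cases h₃ : l = l₁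
  swap
  · simp [proj_simple_of_ne h₃]
  by_cases h₄ : l = l₂
  swap
  · simp [proj_simple_of_ne h₄]
  subst h₁ h₂ h₃ h₄
  simp only [map_smul, smul_mul_assoc, mul_smul_comm, LinearMap.map_smulₛₗ, LinearMap.smul_apply,
    smul_eq_mul, proj_simple, simple_mul, α.ext_simple, Fin.prod_univ_add, Fin.append_left,
    Fin.append_right]
  rw [← Nat.add_choose_mul_factorial_mul_factorial k l]
  push_cast
  ring

theorem tnorm_mul_proj_le (α : HermForm V) (k l : ℕ) (X Y : Tens V) :
    α.tnorm (proj k X * proj l Y) ≤ 2 ^ k * α.tnorm (proj k X) * (2 ^ l * α.tnorm (proj l Y)) := by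
  have h : α.tnorm (proj k X * proj l Y) ^ 2 =
      (k + l).choose l * (α.tnorm (proj k X) ^ 2 * α.tnorm (proj l Y) ^ 2) := by
    rw [tnorm_sq, ext_mul_proj, ext_self, ext_self]
    norm_cast
  have hc : ((k + l).choose l : ℝ) ≤ (2 ^ k * 2 ^ l) ^ 2 := by
    have h1 : ((k + l).choose l : ℝ) ≤ 2 ^ (k + l) := by exact_mod_cast Nat.choose_le_two_pow _ _
    have h2 : (1 : ℝ) ≤ 2 ^ (k + l) := one_le_pow₀ (by norm_num)
    rw [← pow_add]
    nlinarith
  refine (sq_le_sq₀ (apply_nonneg _ _) (by positivity)).1 ?_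
  rw [h]
  calc _ ≤ (2 ^ k * 2 ^ l : ℝ) ^ 2 * (α.tnorm (proj k X) ^ 2 * α.tnorm (proj l Y) ^ 2) := by
        gcongr
    _ = _ := by ring

theorem tnorm_sum_le {ι : Type*} (α : HermForm V) (s : Finset ι) (u : ι → Tens V) :
    α.tnorm (∑ i ∈ s, u i) ≤ ∑ i ∈ s, α.tnorm (u i) :=
  Finset.le_sum_of_subadditive _ (map_zero α.tnorm).le (map_add_le_add _) s u

theorem tnorm_mul_le (α : HermForm V) (X Y : Tens V) :
    α.tnorm (X * Y) ≤ 4 * (α.scale 16).tnorm X * (α.scale 16).tnorm Y := by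
  obtain ⟨s, hs⟩ := exists_eq_sum_proj X
  obtain ⟨t, ht⟩ := exists_eq_sum_proj Y
  calc α.tnorm (X * Y) = α.tnorm (∑ k ∈ s, ∑ l ∈ t, proj k X * proj l Y) := by
        rw [← Finset.sum_mul_sum, ← hs, ← ht]
    _ ≤ ∑ k ∈ s, ∑ l ∈ t, 2 ^ k * α.tnorm (proj k X) * (2 ^ l * α.tnorm (proj l Y)) := by
        refine (tnorm_sum_le _ _ _).trans (Finset.sum_le_sum fun k _ => ?_)
        refine (tnorm_sum_le _ _ _).trans (Finset.sum_le_sum fun l _ => ?_)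
        exact tnorm_mul_proj_le α k l X Y
    _ = (∑ k ∈ s, 2 ^ k * α.tnorm (proj k X)) * ∑ l ∈ t, 2 ^ l * α.tnorm (proj l Y) := by
        rw [Finset.sum_mul_sum]
    _ ≤ (2 * (α.scale 16).tnorm X) * (2 * (α.scale 16).tnorm Y) :=
        mul_le_mul (sum_proj_le α s X) (sum_proj_le α t Y)
          (Finset.sum_nonneg fun _ _ => by positivity) (by positivity)
    _ = _ := by ring

theorem continuous_tnorm (α : HermForm V) : Continuous α.tnorm :=
  withSeminorms_tnorm.continuous_seminorm α

theorem tendsto_zero_of_tnorm_le {ι : Type*} {l : Filter ι} {u : ι → Tens V}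
    (h : ∀ α : HermForm V, ∃ b : ι → ℝ, (∀ i, α.tnorm (u i) ≤ b i) ∧
      Filter.Tendsto b l (nhds 0)) : Filter.Tendsto u l (nhds 0) := by
  rw [withSeminorms_tnorm.tendsto_nhds]
  intro α ε hε
  obtain ⟨b, hb, hb'⟩ := h α
  filter_upwards [hb'.eventually (gt_mem_nhds hε)] with i hi
  rw [sub_zero]
  exact (hb i).trans_lt hi

instance : IsTopologicalRing (Tens V) := by
  refine IsTopologicalRing.of_addGroup_of_nhds_zero ?_ (fun X => ?_) (fun X => ?_)
  · refine tendsto_zero_of_tnorm_le fun α =>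
      ⟨fun p => 4 * (α.scale 16).tnorm p.1 * (α.scale 16).tnorm p.2,
        fun p => tnorm_mul_le α _ _, ?_⟩
    have h := continuous_tnorm (α.scale 16)
    rw [← nhds_prod_eq]
    exact (((continuous_const.mul (h.comp continuous_fst)).mul (h.comp continuous_snd)).tendsto'
      (0 : Tens V × Tens V) 0 (by simp))
  · refine tendsto_zero_of_tnorm_le fun α => ⟨_, fun Y => tnorm_mul_le α X Y, ?_⟩
    exact (continuous_const.mul (continuous_tnorm (α.scale 16))).tendsto' 0 0 (by simp)
  · refine tendsto_zero_of_tnorm_le fun α => ⟨_, fun Y => tnorm_mul_le α Y X, ?_⟩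
    exact ((continuous_const.mul (continuous_tnorm (α.scale 16))).mul
      continuous_const).tendsto' 0 0 (by simp)

theorem continuous_of_tnorm_le {σ : ℂ →+* ℂ} (f : Tens V →ₛₗ[σ] Tens V)
    (h : ∀ α : HermForm V, ∃ (β : HermForm V) (C : ℝ), ∀ X, α.tnorm (f X) ≤ C * β.tnorm X) :
    UniformContinuous f := by
  refine uniformContinuous_of_tendsto_zero (f := f) (tendsto_zero_of_tnorm_le fun α => ?_)
  obtain ⟨β, C, hβ⟩ := h α
  exact ⟨_, hβ, (continuous_const.mul (continuous_tnorm β)).tendsto' 0 0 (by simp)⟩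

theorem uniformContinuous_symm : UniformContinuous (symm : Tens V → Tens V) :=
  continuous_of_tnorm_le symm fun α => ⟨α, 1, fun X => by simpa using tnorm_symm_le α X⟩

instance : UniformContinuousConstSMul ℂ (Tens V) where
  uniformContinuous_const_smul c :=
    continuous_of_tnorm_le (c • (LinearMap.id : Tens V →ₗ[ℂ] Tens V)) fun α =>
      ⟨α, ‖c‖, fun X => (map_smul_eq_mul α.tnorm c X).le⟩

instance : IsUniformAddGroup (symTens V) :=
  inferInstanceAs (IsUniformAddGroup (symTens V).toAddSubgroup)

instance : UniformContinuousConstSMul ℂ (symTens V) where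
  uniformContinuous_const_smul c :=
    ((uniformContinuous_const_smul c).comp uniformContinuous_subtype_val).subtype_mk _

/-- The symmetric tensor product is continuous. -/
instance : IsTopologicalRing (symTens V) :=
  { (inferInstance : IsTopologicalAddGroup (symTens V)) with
    continuous_mul := by
      refine Continuous.subtype_mk (uniformContinuous_symm.continuous.comp ?_) _
      exact (continuous_subtype_val.comp continuous_fst).mul
        (continuous_subtype_val.comp continuous_snd) }

variable (V) in
/-- The completion of the algebra of symmetric tensors; its product is the continuous extension of
the symmetric tensor product. -/
abbrev SymCpl := UniformSpace.Completion (symTens V)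

end Continuity

/-! ### The involution on the completion -/

section CompletionStar

variable {V : Type*} [AddCommGroup V] [Module ℂ V] [TopologicalSpace V]
  [StarAddMonoid V] [StarModule ℂ V] [ContinuousStar V]

/-- The form `(v, w) ↦ conj ⟨v̄, w̄⟩_α`. -/
def HermForm.starForm (α : HermForm V) : HermForm V where
  form :=
    { toFun := fun v =>
        { toFun := fun w => conj (α.form (star v) (star w))
          map_add' := fun w w' => by simp
          map_smul' := fun c w => by simp }
      map_add' := fun v v' => by ext; simp
      map_smul' := fun c v => by ext; simp }
  conj_symm v w := by simp [α.conj_symm]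
  nonneg v := by simpa using α.nonneg (star v)
  cont := Complex.continuous_conj.comp
    (α.cont.comp (continuous_fst.star.prodMk continuous_snd.star))

theorem ext_starT (α : HermForm V) (X Y : Tens V) :
    α.ext (starT X) (starT Y) = conj (α.starForm.ext X Y) := by
  induction X using tens_induction with
  | hadd X X' hX hX' => simp only [map_add, LinearMap.add_apply, hX, hX']
  | h0 c k x =>
    induction Y using tens_induction with
    | hadd Y Y' hY hY' => simp only [map_add, hY, hY']
    | h0 d l y =>
      simp only [LinearMap.map_smulₛₗ, LinearMap.smul_apply, map_smul, smul_eq_mul, map_mul,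
        starT_simple]
      by_cases h : k = l
      · subst h
        simp only [HermForm.ext_simple, map_mul, map_natCast, map_prod, HermForm.starForm,
          LinearMap.coe_mk, AddHom.coe_mk, Complex.conj_conj]
        congr 3
        exact Fintype.prod_equiv Fin.revPerm _ _ fun m => rfl
      · simp [HermForm.ext_simple_of_ne _ h]

theorem uniformContinuous_starT : UniformContinuous (starT : Tens V → Tens V) :=
  continuous_of_tnorm_le starT fun α => ⟨α.starForm, 1, fun X => by
    rw [HermForm.tnorm_apply, ext_starT, Complex.conj_re, one_mul, HermForm.tnorm_apply]⟩

theorem uniformContinuous_star : UniformContinuous (star : symTens V → symTens V) :=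
  (uniformContinuous_starT.comp uniformContinuous_subtype_val).subtype_mk _

/-- The involution of the completion: the continuous extension of the involution of the symmetric
tensors. -/
instance : Star (SymCpl V) := ⟨UniformSpace.Completion.map star⟩

end CompletionStar

/-! ### Evaluation functionals and the Gel'fand transformation -/

section Evaluation

variable {V : Type*} [AddCommGroup V] [Module ℂ V]

/-- The derivative in direction of a linear functional:
`D_ρ (x₁ ⊗ ⋯ ⊗ x_k) = k ρ(x_k) x₁ ⊗ ⋯ ⊗ x_{k-1}`, and `D_ρ` vanishes on scalars. -/
def derivT (ρ : V →ₗ[ℂ] ℂ) : Tens V →ₗ[ℂ] Tens V :=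
  liftT fun k => match k with
    | 0 => 0
    | k + 1 => ((k + 1 : ℕ) : ℂ) • ofDeg k ∘ₗ PiTensorProduct.lift
        (MultilinearMap.uncurryRight
          ((LinearMap.smulRightₗ ρ).compMultilinearMap (PiTensorProduct.tprod ℂ)))

theorem derivT_simple_succ (ρ : V →ₗ[ℂ] ℂ) {k : ℕ} (x : Fin (k + 1) → V) :
    derivT ρ (simple x) = ((k + 1 : ℕ) : ℂ) • ρ (x (Fin.last k)) • simple (Fin.init x) := by
  rw [derivT, simple, liftT_ofDeg]
  simp [simple]

theorem derivT_simple_zero (ρ : V →ₗ[ℂ] ℂ) (x : Fin 0 → V) : derivT ρ (simple x) = 0 := by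
  rw [derivT, simple, liftT_ofDeg]
  simp

/-- The translation `τ*_ρ = ∑ t, D_ρ ^ t / t!`; on every tensor only finitely many terms of the
sum are nonzero. -/
def translT (ρ : V →ₗ[ℂ] ℂ) (X : Tens V) : Tens V :=
  ∑ᶠ t : ℕ, (t.factorial : ℂ)⁻¹ • (derivT ρ ^ t) X

/-- The scalar part `⟨X⟩₀` of a tensor. -/
def scalarPart : Tens V →ₗ[ℂ] ℂ :=
  (PiTensorProduct.isEmptyEquiv (Fin 0)).toLinearMap ∘ₗ deg 0

/-- The evaluation functional `δ_ρ = ⟨·⟩₀ ∘ τ*_ρ`. -/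
def evalT (ρ : V →ₗ[ℂ] ℂ) (X : Tens V) : ℂ := scalarPart (translT ρ X)

theorem proj_proj_of_ne {k l : ℕ} (h : k ≠ l) (X : Tens V) : proj l (proj k X) = 0 := by
  simp [proj, deg_ofDeg_of_ne h]

/-! The evaluation functional is the algebra morphism extending `ρ`, and it is continuous. -/

/-- The linear functional `x₁ ⊗ ⋯ ⊗ x_k ↦ ρ(x₁) ⋯ ρ(x_k)`. -/
def prodT (ρ : V →ₗ[ℂ] ℂ) : Tens V →ₗ[ℂ] ℂ :=
  liftT fun k => PiTensorProduct.lift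
    ((MultilinearMap.mkPiAlgebra ℂ (Fin k) ℂ).compLinearMap fun _ => ρ)

theorem prodT_simple (ρ : V →ₗ[ℂ] ℂ) {k : ℕ} (x : Fin k → V) :
    prodT ρ (simple x) = ∏ m, ρ (x m) := by
  rw [prodT, simple, liftT_ofDeg]
  simp

theorem scalarPart_simple_zero (x : Fin 0 → V) : scalarPart (simple x) = 1 := by
  simp [scalarPart, simple, deg_ofDeg]

theorem scalarPart_simple_succ {k : ℕ} (x : Fin (k + 1) → V) : scalarPart (simple x) = 0 := by
  simp [scalarPart, simple, deg_ofDeg_of_ne]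

theorem derivT_pow_simple (ρ : V →ₗ[ℂ] ℂ) (k t : ℕ) (x : Fin k → V) (h : k < t) :
    (derivT ρ ^ t) (simple x) = 0 := by
  induction t generalizing k with
  | zero => omega
  | succ t ih =>
    rw [pow_succ, Module.End.mul_apply]
    cases k with
    | zero => rw [derivT_simple_zero, map_zero]
    | succ k => rw [derivT_simple_succ, map_smul, map_smul, ih k _ (by omega)]; simp

theorem scalarPart_derivT_pow (ρ : V →ₗ[ℂ] ℂ) (t : ℕ) (X : Tens V) :
    (t.factorial : ℂ)⁻¹ * scalarPart ((derivT ρ ^ t) X) = prodT ρ (proj t X) := by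
  induction X using tens_induction with
  | hadd X Y hX hY => simp only [map_add, mul_add, hX, hY]
  | h0 c k x =>
    simp only [map_smul, smul_eq_mul]
    rw [mul_left_comm]
    congr 1
    induction t generalizing k with
    | zero =>
      cases k with
      | zero => simp [scalarPart_simple_zero, proj_simple, prodT_simple]
      | succ k => simp [scalarPart_simple_succ, proj_simple_of_ne]
    | succ t ih =>
      rw [pow_succ, Module.End.mul_apply]
      cases k with
      | zero => rw [derivT_simple_zero, map_zero, proj_simple_of_ne (by omega)]; simp
      | succ k =>
        rw [derivT_simple_succ, map_smul, map_smul, map_smul, map_smul, Nat.factorial_succ]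
        have h := ih k (Fin.init x)
        by_cases hk : t = k
        · subst hk
          rw [proj_simple, prodT_simple] at h
          rw [proj_simple, prodT_simple, Fin.prod_univ_castSucc]
          simp only [Fin.init] at h
          rw [← h]
          have h0 : ((t : ℂ) + 1) ≠ 0 := by exact_mod_cast Nat.succ_ne_zero t
          push_cast
          simp only [smul_eq_mul]
          field_simp
        · rw [proj_simple_of_ne hk, map_zero] at h
          rw [proj_simple_of_ne (by omega), map_zero]
          have h0 : (t.factorial : ℂ)⁻¹ ≠ 0 := by
            exact inv_ne_zero (by exact_mod_cast t.factorial_ne_zero)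
          rw [(mul_eq_zero.1 h).resolve_left h0]
          simp

theorem exists_derivT_pow_eq_zero (ρ : V →ₗ[ℂ] ℂ) (X : Tens V) :
    ∃ N : ℕ, ∀ t, N ≤ t → (derivT ρ ^ t) X = 0 := by
  induction X using tens_induction with
  | hadd X Y hX hY =>
    obtain ⟨N, hN⟩ := hX
    obtain ⟨M, hM⟩ := hY
    exact ⟨max N M, fun t ht => by
      rw [map_add, hN t (le_of_max_le_left ht), hM t (le_of_max_le_right ht), add_zero]⟩
  | h0 c k x =>
    exact ⟨k + 1, fun t ht => by rw [map_smul, derivT_pow_simple ρ k t x (by omega), smul_zero]⟩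

theorem evalT_eq_prodT (ρ : V →ₗ[ℂ] ℂ) (X : Tens V) : evalT ρ X = prodT ρ X := by
  obtain ⟨N, hN⟩ := exists_derivT_pow_eq_zero ρ X
  obtain ⟨s, hs⟩ := exists_eq_sum_proj X
  have h1 : ∀ t, N ≤ t → prodT ρ (proj t X) = 0 := fun t ht => by
    rw [← scalarPart_derivT_pow, hN t ht]; simp
  have h2 : translT ρ X = ∑ t ∈ Finset.range N, (t.factorial : ℂ)⁻¹ • (derivT ρ ^ t) X := by
    refine finsum_eq_sum_of_support_subset _ fun t ht => ?_
    by_contra hlt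
    simp only [Finset.coe_range, Set.mem_Iio, not_lt] at hlt
    exact ht (by simp [hN t hlt])
  rw [evalT, h2, map_sum]
  simp only [map_smul, smul_eq_mul, scalarPart_derivT_pow]
  have h3 : ∀ t ∉ s, proj t X = 0 := fun t ht => by
    rw [hs, map_sum]
    exact Finset.sum_eq_zero fun k hk => proj_proj_of_ne (by rintro rfl; exact ht hk) X
  conv_rhs => rw [hs, map_sum]
  rw [Finset.sum_subset (Finset.subset_union_left (s₂ := s)) fun t _ ht => h1 t (by simpa using ht),
    ← Finset.sum_subset (Finset.subset_union_right (s₁ := Finset.range N)) fun t _ ht => by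
      rw [h3 t ht, map_zero]]

/-- The rank one form `(v, w) ↦ conj (ρ v) * ρ w`. -/
def rankOne [TopologicalSpace V] (ρ : V →L[ℂ] ℂ) : HermForm V where
  form :=
    { toFun := fun v => conj (ρ v) • (ρ : V →ₗ[ℂ] ℂ)
      map_add' := fun v v' => by simp [add_smul]
      map_smul' := fun c v => by simp [mul_smul] }
  conj_symm v w := by simp [mul_comm]
  nonneg v := by
    simp only [LinearMap.coe_mk, AddHom.coe_mk, LinearMap.smul_apply, smul_eq_mul,
      ContinuousLinearMap.coe_coe, Complex.conj_mul']
    norm_cast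
    positivity
  cont := (Complex.continuous_conj.comp (ρ.continuous.comp continuous_fst)).mul
    (ρ.continuous.comp continuous_snd)

theorem rankOne_ext_proj [TopologicalSpace V] (ρ : V →L[ℂ] ℂ) (k : ℕ) (X Y : Tens V) :
    (rankOne ρ).ext (proj k X) (proj k Y) =
      k.factorial * (conj (prodT (ρ : V →ₗ[ℂ] ℂ) (proj k X)) *
        prodT (ρ : V →ₗ[ℂ] ℂ) (proj k Y)) := by
  induction X using tens_induction with
  | hadd X X' hX hX' => simp only [map_add, LinearMap.add_apply, hX, hX', add_mul, mul_add]
  | h0 c l x =>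
    induction Y using tens_induction with
    | hadd Y Y' hY hY' => simp only [map_add, hY, hY', mul_add]
    | h0 d m y =>
      by_cases h : k = l
      swap
      · simp [proj_simple_of_ne h]
      by_cases h' : k = m
      swap
      · simp [proj_simple_of_ne h']
      subst h h'
      simp only [LinearMap.map_smulₛₗ, LinearMap.smul_apply, map_smul, smul_eq_mul, map_mul,
        proj_simple, HermForm.ext_simple, prodT_simple, rankOne, LinearMap.coe_mk, AddHom.coe_mk,
        Finset.prod_mul_distrib, map_prod, ContinuousLinearMap.coe_coe]
      ring

theorem norm_prodT_le [TopologicalSpace V] (ρ : V →L[ℂ] ℂ) (X : Tens V) :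
    ‖prodT (ρ : V →ₗ[ℂ] ℂ) X‖ ≤ 2 * ((rankOne ρ).scale 16).tnorm X := by
  have h (k : ℕ) : ‖prodT (ρ : V →ₗ[ℂ] ℂ) (proj k X)‖ ≤ 2 ^ k * (rankOne ρ).tnorm (proj k X) := by
    have h1 : (rankOne ρ).tnorm (proj k X) ^ 2 =
        k.factorial * ‖prodT (ρ : V →ₗ[ℂ] ℂ) (proj k X)‖ ^ 2 := by
      rw [tnorm_sq, rankOne_ext_proj, Complex.conj_mul']
      norm_cast
    have h2 : (1 : ℝ) ≤ k.factorial := by exact_mod_cast k.factorial_pos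
    have h3 : ‖prodT (ρ : V →ₗ[ℂ] ℂ) (proj k X)‖ ≤ (rankOne ρ).tnorm (proj k X) := by
      refine (sq_le_sq₀ (norm_nonneg _) (apply_nonneg _ _)).1 ?_
      rw [h1]
      exact le_mul_of_one_le_left (sq_nonneg _) h2
    exact h3.trans (le_mul_of_one_le_left (apply_nonneg _ _) (one_le_pow₀ (by norm_num)))
  obtain ⟨s, hs⟩ := exists_eq_sum_proj X
  calc ‖prodT (ρ : V →ₗ[ℂ] ℂ) X‖ = ‖∑ k ∈ s, prodT (ρ : V →ₗ[ℂ] ℂ) (proj k X)‖ := by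
        rw [← map_sum, ← hs]
    _ ≤ ∑ k ∈ s, 2 ^ k * (rankOne ρ).tnorm (proj k X) :=
        (norm_sum_le _ _).trans (Finset.sum_le_sum fun k _ => h k)
    _ ≤ _ := sum_proj_le _ s X

theorem uniformContinuous_evalT [TopologicalSpace V] (ρ : V →L[ℂ] ℂ) :
    UniformContinuous (evalT (ρ : V →ₗ[ℂ] ℂ)) := by
  have : evalT (ρ : V →ₗ[ℂ] ℂ) = prodT (ρ : V →ₗ[ℂ] ℂ) := funext (evalT_eq_prodT _)
  rw [this]
  refine uniformContinuous_of_tendsto_zero (f := prodT (ρ : V →ₗ[ℂ] ℂ)) ?_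
  exact squeeze_zero_norm (norm_prodT_le ρ)
    ((continuous_const.mul (continuous_tnorm _)).tendsto' 0 0 (by simp))

end Evaluation



section Gelfand

variable (V : Type*) [AddCommGroup V] [Module ℂ V] [TopologicalSpace V]
  [StarAddMonoid V] [StarModule ℂ V]

/-- The real vector space `V'_h` of Hermitian elements of the topological dual `V'`. -/
def HermDual : Submodule ℝ (V →L[ℂ] ℂ) where
  carrier := {ρ | ∀ v, conj (ρ v) = ρ (star v)}
  add_mem' {ρ σ} h h' v := by simp [h v, h' v]
  zero_mem' v := by simp
  smul_mem' c ρ h v := by simp [h v]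

variable {V}

/-- The Gel'fand transform `X̂(ρ) = δ_ρ(X)`, where `δ_ρ` is extended continuously from the symmetric
tensors to the completion. -/
def gelfand (X : SymCpl V) (ρ : HermDual V) : ℂ :=
  UniformSpace.Completion.extension (fun Y : symTens V => evalT (ρ : V →L[ℂ] ℂ) (Y : Tens V)) X

/-! ### Smooth functions and functions analytic of Hilbert-Schmidt type on `V'_h` -/

/-- The forms in `I_{V,h}`: those compatible with the involution. -/
def HermForm.Compatible (α : HermForm V) : Prop :=
  ∀ v w, conj (α.form v w) = α.form (star v) (star w)

/-- Bounded subsets of `V'_h` for the equicontinuous bornology. -/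
def BoundedSet (B : Set (HermDual V)) : Prop :=
  ∃ α : HermForm V, α.Compatible ∧ ∀ ρ ∈ B, ∀ v, ‖(ρ : V →L[ℂ] ℂ) v‖ ≤ α.nrm v

/-- The iterated directional derivative `D̂_{ρ₁} ⋯ D̂_{ρ_k} f`, where
`(D̂_ρ f)(σ)` is the derivative of `t ↦ f (σ + t ρ)` at `t = 0`. -/
def iterDeriv : (k : ℕ) → (Fin k → HermDual V) → (HermDual V → ℂ) → HermDual V → ℂ
  | 0, _, f => f
  | k + 1, ρ, f => fun σ => lineDeriv ℝ (iterDeriv k (Fin.tail ρ) f) σ (ρ 0)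

/-- Smooth functions on `V'_h`: all iterated directional derivatives exist, and at each point they
form a bounded symmetric multilinear form in the directions. -/
def IsSmooth (f : HermDual V → ℂ) : Prop :=
  (∀ (k : ℕ) (ρ : Fin k → HermDual V) (σ ρ₀ : HermDual V),
    LineDifferentiableAt ℝ (iterDeriv k ρ f) σ ρ₀) ∧
  ∀ (k : ℕ) (σ : HermDual V), ∃ M : MultilinearMap ℝ (fun _ : Fin k => HermDual V) ℂ,
    (∀ ρ, M ρ = iterDeriv k ρ f σ) ∧
    (∀ (ρ : Fin k → HermDual V) (τ : Equiv.Perm (Fin k)), M (ρ ∘ τ) = M ρ) ∧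
    ∀ B : Set (HermDual V), BoundedSet B → ∃ C : ℝ, ∀ ρ, (∀ i, ρ i ∈ B) → ‖M ρ‖ ≤ C

end Gelfand

/-- The real vector space `V_h` of Hermitian elements of `V`, equipped with the inner product of
`α` (which is real there if `α` is compatible with the involution). -/
def HermSpace {V : Type*} [AddCommGroup V] [Module ℂ V] [TopologicalSpace V]
    [StarAddMonoid V] (_α : HermForm V) : Type _ := selfAdjoint V

section HermSpace

variable {V : Type*} [AddCommGroup V] [Module ℂ V] [TopologicalSpace V]
  [StarAddMonoid V] [StarModule ℂ V] (α : HermForm V)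

instance : AddCommGroup (HermSpace α) := inferInstanceAs (AddCommGroup (selfAdjoint V))

instance : Module ℝ (HermSpace α) := inferInstanceAs (Module ℝ (selfAdjoint V))

/-- The inclusion of `V_h` into `V`. -/
def HermSpace.val : HermSpace α →ₗ[ℝ] V := (selfAdjoint.submodule ℝ V).subtype

/-- An element of `V_h` regarded as an element of the inner product space of `α`. -/
def HermSpace.mk : selfAdjoint V →ₗ[ℝ] HermSpace α := LinearMap.id

abbrev HermSpace.core : PreInnerProductSpace.Core ℝ (HermSpace α) where
  inner v w := (α.form (HermSpace.val α v) (HermSpace.val α w)).re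
  conj_inner_symm v w := by
    rw [← α.conj_symm]; simp
  re_inner_nonneg v := α.nonneg _
  add_left u v w := by simp
  smul_left v w r := by
    rw [map_smul, ← Complex.coe_smul r, LinearMap.map_smulₛₗ]
    simp

instance : SeminormedAddCommGroup (HermSpace α) :=
  @InnerProductSpace.Core.toSeminormedAddCommGroup ℝ _ _ _ _ (HermSpace.core α)

instance : InnerProductSpace ℝ (HermSpace α) := InnerProductSpace.ofCore (HermSpace.core α)

/-- The real Hilbert space obtained from `V_h` with the inner product of `α` by dividing out the
kernel of the seminorm and completing. -/
abbrev HermCpl := UniformSpace.Completion (HermSpace α)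

open scoped ComplexStarModule

theorem HermSpace.norm_def (x : HermSpace α) : ‖x‖ = α.nrm (HermSpace.val α x) := rfl

variable [IsTopologicalAddGroup V]

theorem HermSpace.continuous_of_coe {f : V →ₗ[ℝ] selfAdjoint V}
    (hf : Continuous fun w => (f w : V)) : Continuous fun w => HermSpace.mk α (f w) := by
  refine continuous_of_continuousAt_zero (HermSpace.mk α ∘ₗ f) ?_
  rw [ContinuousAt, map_zero, tendsto_zero_iff_norm_tendsto_zero]
  have : Continuous fun w => α.nrm (f w) :=
    Real.continuous_sqrt.comp (Complex.continuous_re.comp (α.cont.comp (hf.prodMk hf)))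
  exact this.tendsto' 0 0 (by simp [HermForm.nrm])

variable [ContinuousStar V] [ContinuousSMul ℂ V]

theorem HermSpace.continuous_realPart : Continuous fun w : V => HermSpace.mk α (ℜ w) := by
  refine HermSpace.continuous_of_coe α ?_
  simp only [realPart_apply_coe, ← Complex.coe_smul]
  exact (continuous_id.add continuous_star).const_smul _

theorem HermSpace.continuous_imaginaryPart : Continuous fun w : V => HermSpace.mk α (ℑ w) := by
  refine HermSpace.continuous_of_coe α ?_
  simp only [imaginaryPart_apply_coe, ← Complex.coe_smul]
  exact ((continuous_id.sub continuous_star).const_smul _).const_smul _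

/-- The functional `v^♭ = ⟨v, ·⟩_α` on `V`, for `v` in the Hilbert space completion of `V_h`. It is
the complex linear extension of the functional `w ↦ ⟨v, w⟩_α` on `V_h`. -/
def flat (v : HermCpl α) : HermDual V where
  val :=
    { toFun := fun w => ((inner ℝ v ((HermSpace.mk α (ℜ w) : HermSpace α) : HermCpl α) : ℝ) : ℂ) +
        Complex.I * ((inner ℝ v ((HermSpace.mk α (ℑ w) : HermSpace α) : HermCpl α) : ℝ) : ℂ)
      map_add' := fun w w' => by
        simp only [map_add, UniformSpace.Completion.coe_add, inner_add_right, Complex.ofReal_add]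
        ring
      map_smul' := fun c w => by
        simp only [realPart_smul, imaginaryPart_smul, map_add, map_sub, map_smul,
          UniformSpace.Completion.coe_add, UniformSpace.Completion.coe_sub,
          UniformSpace.Completion.coe_smul, inner_add_right, inner_sub_right, inner_smul_right,
          RingHom.id_apply, smul_eq_mul]
        apply Complex.ext <;> simp
      cont := by
        have h₁ := (UniformSpace.Completion.continuous_coe (HermSpace α)).comp
          (HermSpace.continuous_realPart α)
        have h₂ := (UniformSpace.Completion.continuous_coe (HermSpace α)).comp
          (HermSpace.continuous_imaginaryPart α)
        exact (Complex.continuous_ofReal.comp (continuous_const.inner h₁)).add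
          (continuous_const.mul (Complex.continuous_ofReal.comp (continuous_const.inner h₂))) }
  property := fun w => by
    have h₁ : ℜ (star w) = ℜ w := Subtype.ext <| by simp [realPart_apply_coe, add_comm]
    have h₂ : ℑ (star w) = -ℑ w := Subtype.ext <| by
      simp only [imaginaryPart_apply_coe, star_star, NegMemClass.coe_neg]
      rw [← smul_neg, ← smul_neg, neg_sub]
    change conj (_ + Complex.I * _) = _ + Complex.I * _
    rw [h₁, h₂, map_neg, UniformSpace.Completion.coe_neg, inner_neg_right]
    simp

/-- Functions on `V'_h` that are analytic of Hilbert-Schmidt type: smooth functions such that for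
all `σ, σ'` and all compatible forms `α` the sum of the weighted squares of the derivatives in the
directions of a Hilbert basis is bounded on the line segment from `σ` to `σ'`. -/
def IsAnalyticHS (f : HermDual V → ℂ) : Prop :=
  IsSmooth f ∧ ∀ (σ σ' : HermDual V) (α : HermForm V), α.Compatible →
    ∃ (C : ℝ≥0) (I : Set (HermCpl α)) (e : HilbertBasis I ℝ (HermCpl α)),
      ∀ ξ ∈ segment ℝ σ σ',
        ∑' k : ℕ, ((k.factorial : ℝ≥0∞)⁻¹ *
          ∑' i : Fin k → I, ‖iterDeriv k (fun j => flat α (e (i j))) f ξ‖ₑ ^ 2) ≤ C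

end HermSpace

end HilbertTensor

end

/-
The iterated derivatives of `X̂` at `ξ` are the scalar products of the translate `τ*_ξ X` with
simple tensors, so its Hilbert-Schmidt sum is controlled by the Fock norm of the translate, and the
translations `τ*_ξ` are bounded uniformly on segments. Conversely, the Taylor coefficients of an
analytic function of Hilbert-Schmidt type at `0` are the coefficients of a vector in each Fock
space; these vectors are symmetric and compatible under restriction, and the completed symmetric
tensor algebra is the projective limit of the symmetric Fock spaces, so they come from some `X`.
The functions `X̂` and `f` then have the same derivatives at `0` and agree, since the
Hilbert-Schmidt bound along a segment forces the `k`-th derivatives to grow no faster than `√(k!)`.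
-/

noncomputable section

namespace HilbertTensor

open scoped ComplexOrder ComplexStarModule

section SchurProducts

variable {𝕜 ι κ : Type*} [RCLike 𝕜]

theorem posSemidef_finsetProd {A : κ → Matrix ι ι 𝕜} (hA : ∀ m, (A m).PosSemidef)
    (s : Finset κ) : (Matrix.of fun i j => ∏ m ∈ s, A m i j).PosSemidef := by
  classical
  induction s using Finset.induction_on with
  | empty =>
    refine ⟨by ext; simp, fun c => ?_⟩
    simp only [Finset.prod_empty, Matrix.of_apply, mul_one, Finsupp.sum, ← Finset.mul_sum,
      ← Finset.sum_mul]
    rw [← star_sum]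
    exact star_mul_self_nonneg _
  | insert a s ha ih =>
    convert! (hA a).hadamard ih using 1
    ext i j
    simp [Finset.prod_insert ha]

theorem posSemidef_finsetProd_sub {A B : κ → Matrix ι ι 𝕜} (hA : ∀ m, (A m).PosSemidef)
    (hAB : ∀ m, (B m - A m).PosSemidef) (s : Finset κ) :
    (Matrix.of fun i j => ∏ m ∈ s, B m i j - ∏ m ∈ s, A m i j).PosSemidef := by
  classical
  induction s using Finset.induction_on with
  | empty =>
    convert! (Matrix.PosSemidef.zero : (0 : Matrix ι ι 𝕜).PosSemidef) using 1
    ext i j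
    simp
  | insert a s ha ih =>
    have hB : (B a).PosSemidef := by simpa using (hA a).add (hAB a)
    convert! (hB.hadamard ih).add ((hAB a).hadamard (posSemidef_finsetProd hA s)) using 1
    ext i j
    simp only [Finset.prod_insert ha, Matrix.of_apply, Matrix.add_apply, Matrix.sub_apply,
      Matrix.hadamard_apply]
    ring

end SchurProducts

section SquareSummable

theorem exists_inner_eq_of_orthonormal {𝕜 H ι : Type*} [RCLike 𝕜] [NormedAddCommGroup H]
    [InnerProductSpace 𝕜 H] [CompleteSpace H] {b : ι → H} (hb : Orthonormal 𝕜 b) (a : ι → 𝕜)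
    {C : ℝ} (h : ∀ s : Finset ι, ∑ i ∈ s, ‖a i‖ ^ 2 ≤ C) :
    ∃ x : H, ‖x‖ ^ 2 ≤ C ∧ ∀ i, inner 𝕜 (b i) x = a i := by
  classical
  have hC : 0 ≤ C := by simpa using h ∅
  have ha : Memℓp a 2 := memℓp_gen <| by
    simp only [ENNReal.toReal_ofNat, Real.rpow_ofNat]
    exact summable_of_sum_le (fun _ => by positivity) h
  let f : lp (fun _ : ι => 𝕜) 2 := ⟨a, ha⟩
  have hf : ‖f‖ ≤ √C := by
    refine lp.norm_le_of_forall_sum_le (by simp) (Real.sqrt_nonneg _) fun s => ?_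
    simpa only [ENNReal.toReal_ofNat, Real.rpow_ofNat, Real.sq_sqrt hC] using h s
  refine ⟨hb.orthogonalFamily.linearIsometry f, ?_, fun i => ?_⟩
  · rw [LinearIsometry.norm_map]
    exact (Real.le_sqrt (norm_nonneg _) hC).1 hf
  · have hbi : b i = hb.orthogonalFamily.linearIsometry (lp.single 2 i (1 : 𝕜)) := by
      rw [hb.orthogonalFamily.linearIsometry_apply_single]
      simp
    rw [hbi, LinearIsometry.inner_map_map, lp.inner_single_left]
    simp [f]

theorem tsum_factorial_enorm_sq_le_iff {I E : Type*} [SeminormedAddGroup E]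
    (a : ∀ k, (Fin k → I) → E) (C : ℝ≥0) :
    (∑' k : ℕ, ((k.factorial : ℝ≥0∞)⁻¹ * ∑' i : Fin k → I, ‖a k i‖ₑ ^ 2)) ≤ C ↔
      ∀ s : Finset (Σ k, Fin k → I),
        ∑ p ∈ s, (p.1.factorial : ℝ)⁻¹ * ‖a p.1 p.2‖ ^ 2 ≤ C := by
  have h (k : ℕ) (i : Fin k → I) : (k.factorial : ℝ≥0∞)⁻¹ * ‖a k i‖ₑ ^ 2 =
      (((k.factorial : ℝ≥0)⁻¹ * ‖a k i‖₊ ^ 2 : ℝ≥0) : ℝ≥0∞) := by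
    rw [ENNReal.coe_mul, ENNReal.coe_inv (by exact_mod_cast k.factorial_ne_zero)]
    push_cast
    rfl
  simp only [← ENNReal.tsum_mul_left, h]
  rw [← ENNReal.tsum_sigma' (f := fun p : Σ k, Fin k → I =>
    (((p.1.factorial : ℝ≥0)⁻¹ * ‖a p.1 p.2‖₊ ^ 2 : ℝ≥0) : ℝ≥0∞)), ENNReal.tsum_eq_iSup_sum,
    iSup_le_iff]
  refine forall_congr' fun s => ?_
  rw [← ENNReal.ofNNReal_finsetSum, ENNReal.coe_le_coe, ← NNReal.coe_le_coe]
  push_cast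
  rfl

end SquareSummable

section Multilinear

theorem continuousMultilinearMap_ext_of_dense_span {𝕜 ι E F : Type*} [NormedField 𝕜] [Finite ι]
    [AddCommGroup E] [Module 𝕜 E] [TopologicalSpace E] [AddCommGroup F] [Module 𝕜 F]
    [TopologicalSpace F] [T2Space F] {κ : Type*} {e : κ → E}
    (he : Dense (Submodule.span 𝕜 (Set.range e) : Set E))
    {f g : ContinuousMultilinearMap 𝕜 (fun _ : ι => E) F}
    (h : ∀ j : ι → κ, f (fun i => e (j i)) = g fun i => e (j i)) : f = g := by
  let W := Submodule.span 𝕜 (Set.range e)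
  let e' : κ → W := fun j => ⟨e j, Submodule.subset_span ⟨j, rfl⟩⟩
  have he' : Submodule.span 𝕜 (Set.range e') = ⊤ := by
    convert! Submodule.span_span_coe_preimage (R := 𝕜) (s := Set.range e) using 2
    ext x
    simp [e', Subtype.ext_iff]
  have hW : f.toMultilinearMap.compLinearMap (fun _ => W.subtype) =
      g.toMultilinearMap.compLinearMap fun _ => W.subtype :=
    MultilinearMap.ext_of_span_eq_top (g := fun _ => e') (fun _ => he') fun j => h j
  have hd : DenseRange (Pi.map fun _ : ι => ((↑) : W → E)) :=
    DenseRange.piMap fun _ => he.denseRange_val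
  exact DFunLike.coe_injective (hd.equalizer f.cont g.cont (funext fun v =>
    DFunLike.congr_fun hW v))

/-- Inclusion–exclusion over the tuples of indices that miss a given set: only the surjective
tuples survive, and these are the permutations. -/
theorem multilinearMap_polarization {R ι M N : Type*} [Semiring R] [Fintype ι] [DecidableEq ι]
    [AddCommMonoid M] [Module R M] [AddCommGroup N] [Module R N]
    (f : MultilinearMap R (fun _ : ι => M) N) (x : ι → M) :
    ∑ T : Finset ι, (-1 : ℤ) ^ T.card • f (fun _ => ∑ i ∈ Tᶜ, x i) =
      ∑ σ : Equiv.Perm ι, f (x ∘ σ) := by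
  let miss (i : ι) : Finset (ι → ι) := {r | ∀ j, r j ≠ i}
  have hmiss (T : Finset ι) : T.inf miss = Fintype.piFinset fun _ => Tᶜ := by
    ext r
    simp only [miss, Finset.mem_inf, Finset.mem_filter_univ, Fintype.mem_piFinset,
      Finset.mem_compl]
    exact ⟨fun h j hj => h _ hj j rfl, fun h i hi j hj => h j (hj ▸ hi)⟩
  have hsurj : Finset.univ.inf (fun i => (miss i)ᶜ) =
      Finset.univ.image ((⇑) : Equiv.Perm ι → ι → ι) := by
    ext r
    simp only [miss, Finset.mem_inf, Finset.mem_univ, Finset.mem_compl, Finset.mem_filter_univ,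
      not_forall, not_not, true_implies, Finset.mem_image, true_and]
    refine ⟨fun h => ?_, ?_⟩
    · exact ⟨Equiv.ofBijective r (Finite.surjective_iff_bijective.1 h), rfl⟩
    · rintro ⟨σ, rfl⟩ i
      exact σ.surjective i
  have h := Finset.inclusion_exclusion_sum_inf_compl Finset.univ miss fun r => f (x ∘ r)
  rw [hsurj, Finset.sum_image DFunLike.coe_injective.injOn, Finset.powerset_univ] at h
  rw [h]
  refine Finset.sum_congr rfl fun T _ => ?_
  rw [hmiss, MultilinearMap.map_sum_finset]
  rfl

end Multilinear

section SuccessiveDerivatives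

variable {E : Type*} [NormedAddCommGroup E] [NormedSpace ℝ E] {h : ℕ → ℝ → E}

theorem norm_le_of_hasDerivAt_succ {M : ℕ → ℝ} (hd : ∀ k t, HasDerivAt (h k) (h (k + 1) t) t)
    (h0 : ∀ k, h k 0 = 0) (hM : ∀ k, ∀ t ∈ Set.Icc (0 : ℝ) 1, ‖h k t‖ ≤ M k) (n j : ℕ) :
    ∀ t ∈ Set.Icc (0 : ℝ) 1, ‖h j t‖ ≤ M (j + n) * (t ^ n / n.factorial) := by
  induction n generalizing j with
  | zero => simpa using hM j
  | succ n ih =>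
    refine image_norm_le_of_norm_deriv_right_le_deriv_boundary
      (f' := h (j + 1)) (B' := fun t => M (j + 1 + n) * (t ^ n / n.factorial))
      (fun t _ => (hd j t).continuousAt.continuousWithinAt)
      (fun t _ => (hd j t).hasDerivWithinAt) (by simp [h0]) (fun t => ?_)
      (fun t ht => ih (j + 1) t (Set.Ico_subset_Icc_self ht))
    rw [show j + (n + 1) = j + 1 + n by ring]
    refine (((hasDerivAt_pow (n + 1) t).div_const _).const_mul _).congr_deriv ?_
    have : (n.factorial : ℝ) ≠ 0 := by exact_mod_cast n.factorial_ne_zero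
    rw [Nat.factorial_succ]
    push_cast
    field_simp

theorem eq_zero_of_hasDerivAt_succ_of_norm_le {K : ℝ}
    (hd : ∀ k t, HasDerivAt (h k) (h (k + 1) t) t) (h0 : ∀ k, h k 0 = 0)
    (hK : ∀ k, ∀ t ∈ Set.Icc (0 : ℝ) 1, ‖h k t‖ ≤ K * √(k.factorial : ℝ)) : h 0 1 = 0 := by
  have hle (n : ℕ) : ‖h 0 1‖ ≤ K * √(1 ^ n / n.factorial : ℝ) := by
    refine (norm_le_of_hasDerivAt_succ hd h0 hK n 0 1 (by simp)).trans_eq ?_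
    rw [zero_add, one_pow, mul_assoc, one_div, Real.sqrt_inv, ← div_eq_mul_inv, Real.sqrt_div_self]
  have hlim : Filter.Tendsto (fun n : ℕ => K * √(1 ^ n / n.factorial : ℝ)) Filter.atTop
      (nhds 0) := by
    have := (Real.continuous_sqrt.tendsto' 0 0 (by simp)).comp
      (FloorSemiring.tendsto_pow_div_factorial_atTop (1 : ℝ))
    simpa using this.const_mul K
  exact norm_le_zero_iff.1 (ge_of_tendsto' hlim hle)

end SuccessiveDerivatives

section Degree

variable {V : Type*} [AddCommGroup V] [Module ℂ V]

theorem exists_proj_eq_sum_simple (k : ℕ) (X : Tens V) :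
    ∃ c : (Fin k → V) →₀ ℂ, proj k X = c.sum fun x a => a • simple x := by
  have h : deg k X ∈ Submodule.span ℂ
      (Set.range (PiTensorProduct.tprod ℂ (s := fun _ : Fin k => V))) := by
    rw [PiTensorProduct.span_tprod_eq_top]
    trivial
  obtain ⟨c, hc⟩ := Finsupp.mem_span_range_iff_exists_finsupp.1 h
  refine ⟨c, ?_⟩
  simp only [proj, LinearMap.comp_apply, ← hc, Finsupp.sum, map_sum, map_smul, simple]

theorem scalarPart_smul_one (X : Tens V) : scalarPart X • (1 : Tens V) = proj 0 X := by
  induction X using tens_induction with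
  | hadd X Y hX hY => simp only [map_add, add_smul, hX, hY]
  | h0 c k x =>
    rw [map_smul, map_smul, smul_assoc]
    congr 1
    cases k with
    | zero => rw [scalarPart_simple_zero, proj_simple, one_smul, simple_elim0]
    | succ k => rw [scalarPart_simple_succ, proj_simple_of_ne (by omega), zero_smul]

theorem derivT_proj_zero (ρ : V →ₗ[ℂ] ℂ) (X : Tens V) : derivT ρ (proj 0 X) = 0 := by
  rw [← scalarPart_smul_one, map_smul, ← simple_elim0 (Fin.elim0 : Fin 0 → V), derivT_simple_zero,
    smul_zero]

theorem derivT_proj_succ (ρ : V →ₗ[ℂ] ℂ) (k : ℕ) (X : Tens V) :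
    derivT ρ (proj (k + 1) X) = proj k (derivT ρ X) := by
  induction X using tens_induction with
  | hadd X Y hX hY => simp only [map_add, hX, hY]
  | h0 c l x =>
    simp only [map_smul]
    congr 1
    cases l with
    | zero => rw [proj_simple_of_ne (by omega), derivT_simple_zero, map_zero, map_zero]
    | succ l =>
      rw [derivT_simple_succ, map_smul, map_smul]
      by_cases h : k = l
      · subst h
        rw [proj_simple, proj_simple, derivT_simple_succ]
      · rw [proj_simple_of_ne h, proj_simple_of_ne (by omega), map_zero, smul_zero, smul_zero]

theorem exists_translT_eq_sum (ρ : V →ₗ[ℂ] ℂ) (X : Tens V) : ∃ N : ℕ, ∀ M, N ≤ M →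
    translT ρ X = ∑ t ∈ Finset.range M, (t.factorial : ℂ)⁻¹ • (derivT ρ ^ t) X := by
  obtain ⟨N, hN⟩ := exists_derivT_pow_eq_zero ρ X
  refine ⟨N, fun M hM => finsum_eq_sum_of_support_subset _ fun t ht => ?_⟩
  by_contra hlt
  simp only [Finset.coe_range, Set.mem_Iio, not_lt] at hlt
  exact ht (by simp [hN t (hM.trans hlt)])

end Degree

section FormOrder

variable {V : Type*} [AddCommGroup V] [Module ℂ V] [TopologicalSpace V]

theorem HermForm.nrm_sq (α : HermForm V) (v : V) : α.nrm v ^ 2 = (α.form v v).re :=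
  Real.sq_sqrt (α.nonneg v)

theorem HermForm.nrm_nonneg (α : HermForm V) (v : V) : 0 ≤ α.nrm v := Real.sqrt_nonneg _

/-- The sum of two forms: an upper bound of both, which makes the set of forms directed. -/
def HermForm.add (α β : HermForm V) : HermForm V where
  form := α.form + β.form
  conj_symm v w := by simp [α.conj_symm, β.conj_symm]
  nonneg v := by simpa using add_nonneg (α.nonneg v) (β.nonneg v)
  cont := α.cont.add β.cont

theorem HermForm.nrm_le_add_left (α β : HermForm V) (v : V) : α.nrm v ≤ (α.add β).nrm v := by
  refine Real.sqrt_le_sqrt ?_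
  simpa [HermForm.add] using β.nonneg v

theorem HermForm.nrm_le_add_right (α β : HermForm V) (v : V) : β.nrm v ≤ (α.add β).nrm v := by
  refine Real.sqrt_le_sqrt ?_
  simpa [HermForm.add] using α.nonneg v

/-- The difference of two forms, the second of which is dominated by the first. -/
def HermForm.sub (β α : HermForm V) (h : ∀ v, α.nrm v ≤ β.nrm v) : HermForm V where
  form := β.form - α.form
  conj_symm v w := by simp [α.conj_symm, β.conj_symm]
  nonneg v := by
    have := pow_le_pow_left₀ (α.nrm_nonneg v) (h v) 2
    rw [α.nrm_sq, β.nrm_sq] at this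
    simpa using this
  cont := β.cont.sub α.cont

theorem HermForm.nrm_scale (c : ℝ≥0) (α : HermForm V) (v : V) :
    (α.scale (c ^ 2)).nrm v = c * α.nrm v := by
  simp only [HermForm.nrm, HermForm.scale, LinearMap.smul_apply, smul_eq_mul,
    Complex.re_ofReal_mul]
  rw [Real.sqrt_mul (by positivity), NNReal.coe_pow, Real.sqrt_sq c.coe_nonneg]

theorem HermForm.nrm_scale_mono {α β : HermForm V} (h : ∀ v, α.nrm v ≤ β.nrm v) (c : ℝ≥0)
    (v : V) : (α.scale c).nrm v ≤ (β.scale c).nrm v := by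
  rw [← NNReal.sq_sqrt c, α.nrm_scale, β.nrm_scale]
  exact mul_le_mul_of_nonneg_left (h v) (NNReal.coe_nonneg _)

theorem nrm_rankOne (ρ : V →L[ℂ] ℂ) (v : V) : (rankOne ρ).nrm v = ‖ρ v‖ := by
  simp only [HermForm.nrm, rankOne, LinearMap.coe_mk, AddHom.coe_mk, LinearMap.smul_apply,
    smul_eq_mul, ContinuousLinearMap.coe_coe, Complex.conj_mul']
  rw [← Complex.ofReal_pow, Complex.ofReal_re, Real.sqrt_sq (norm_nonneg _)]

theorem norm_apply_le_nrm_rankOne_add (ρ : V →L[ℂ] ℂ) (α : HermForm V) (v : V) :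
    ‖ρ v‖ ≤ ((rankOne ρ).add α).nrm v :=
  (nrm_rankOne ρ v).symm.trans_le ((rankOne ρ).nrm_le_add_left α v)

theorem norm_apply_le_nrm_add_rankOne (ρ : V →L[ℂ] ℂ) (α : HermForm V) (v : V) :
    ‖ρ v‖ ≤ (α.add (rankOne ρ)).nrm v :=
  (nrm_rankOne ρ v).symm.trans_le (α.nrm_le_add_right (rankOne ρ) v)

end FormOrder

section TensorNorm

variable {V : Type*} [AddCommGroup V] [Module ℂ V] [TopologicalSpace V] {k : ℕ}

/-- The squared norm of the tensor `∑ x, c x • x₁ ⊗ ⋯ ⊗ x_k` for the tensor product of the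
forms `α₁, …, α_k`, computed from the coefficients `c`. Letting the forms vary from slot to slot
is what allows them to be compared one at a time. -/
def tensorSq (α : Fin k → HermForm V) (c : (Fin k → V) →₀ ℂ) : ℝ :=
  (c.sum fun x a => c.sum fun y b => star a * (∏ m, (α m).form (x m) (y m)) * b).re

theorem tensorSq_mono {α β : Fin k → HermForm V} (h : ∀ m v, (α m).nrm v ≤ (β m).nrm v)
    (c : (Fin k → V) →₀ ℂ) : tensorSq α c ≤ tensorSq β c := by
  have hpos := (posSemidef_finsetProd_sub
    (fun m => posSemidef_gram (α m) fun x : Fin k → V => x m)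
    (fun m => by
      convert! posSemidef_gram ((β m).sub (α m) (h m)) fun x : Fin k → V => x m using 1)
    Finset.univ).2 c
  rw [← sub_nonneg, tensorSq, tensorSq, ← Complex.sub_re]
  refine (Complex.le_def.1 hpos).1.trans_eq (congrArg Complex.re ?_)
  simp only [Finsupp.sum, Matrix.of_apply, mul_sub, sub_mul, Finset.sum_sub_distrib]

theorem tnorm_sum_simple_sq {ι : Type*} (α : HermForm V) (s : Finset ι) (a : ι → ℂ)
    (x : ι → Fin k → V) :
    α.tnorm (∑ i ∈ s, a i • simple (x i)) ^ 2 = k.factorial *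
      (∑ i ∈ s, ∑ j ∈ s, star (a i) * (∏ m, α.form (x i m) (x j m)) * a j).re := by
  rw [tnorm_sq, ← Complex.re_ofReal_mul]
  congr 1
  simp only [map_sum, LinearMap.sum_apply, LinearMap.map_smulₛₗ, map_smul, LinearMap.smul_apply,
    smul_eq_mul, HermForm.ext_simple, Finset.mul_sum]
  rw [Finset.sum_comm]
  refine Finset.sum_congr rfl fun i _ => Finset.sum_congr rfl fun j _ => ?_
  simp only [Complex.ofReal_natCast, starRingEnd_apply]
  ring

theorem tnorm_sq_eq_tensorSq (α : HermForm V) (c : (Fin k → V) →₀ ℂ) :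
    α.tnorm (c.sum fun x a => a • simple x) ^ 2 = k.factorial * tensorSq (fun _ => α) c :=
  tnorm_sum_simple_sq α c.support c fun x => x

theorem tnorm_proj_mono {α β : HermForm V} (h : ∀ v, α.nrm v ≤ β.nrm v) (k : ℕ) (X : Tens V) :
    α.tnorm (proj k X) ≤ β.tnorm (proj k X) := by
  obtain ⟨c, hc⟩ := exists_proj_eq_sum_simple k X
  refine (sq_le_sq₀ (apply_nonneg _ _) (apply_nonneg _ _)).1 ?_
  rw [hc, tnorm_sq_eq_tensorSq, tnorm_sq_eq_tensorSq]
  exact mul_le_mul_of_nonneg_left (tensorSq_mono (fun _ => h) c) (Nat.cast_nonneg _)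

theorem tnorm_sq_eq_sum_proj (α : HermForm V) {X : Tens V} {s : Finset ℕ}
    (hs : X = ∑ k ∈ s, proj k X) : α.tnorm X ^ 2 = ∑ k ∈ s, α.tnorm (proj k X) ^ 2 := by
  have h : α.ext X X = ∑ k ∈ s, α.ext (proj k X) (proj k X) := by
    conv_lhs => rw [hs, map_sum]
    refine Finset.sum_congr rfl fun k _ => ?_
    rw [ext_proj, ← hs]
  rw [tnorm_sq, h, Complex.re_sum]
  exact Finset.sum_congr rfl fun k _ => (tnorm_sq α _).symm

theorem tnorm_mono {α β : HermForm V} (h : ∀ v, α.nrm v ≤ β.nrm v) (X : Tens V) :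
    α.tnorm X ≤ β.tnorm X := by
  obtain ⟨s, hs⟩ := exists_eq_sum_proj X
  refine (sq_le_sq₀ (apply_nonneg _ _) (apply_nonneg _ _)).1 ?_
  rw [tnorm_sq_eq_sum_proj α hs, tnorm_sq_eq_sum_proj β hs]
  gcongr with k
  exact tnorm_proj_mono h k X

theorem tnorm_one (α : HermForm V) : α.tnorm (1 : Tens V) = 1 := by
  rw [← simple_elim0 (Fin.elim0 : Fin 0 → V), HermForm.tnorm_apply, α.ext_simple]
  simp

theorem norm_prodT_le_of_le {α : HermForm V} {ρ : V →L[ℂ] ℂ} (h : ∀ v, ‖ρ v‖ ≤ α.nrm v)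
    (X : Tens V) : ‖prodT (ρ : V →ₗ[ℂ] ℂ) X‖ ≤ 2 * (α.scale 16).tnorm X := by
  simp only [← nrm_rankOne] at h
  exact (norm_prodT_le ρ X).trans
    (mul_le_mul_of_nonneg_left (tnorm_mono (HermForm.nrm_scale_mono h _) X) zero_le_two)

theorem tensorSq_snoc_scale (c : ℝ≥0) (α : HermForm V) (d : (Fin (k + 1) → V) →₀ ℂ) :
    tensorSq (Fin.snoc (α := fun _ => HermForm V) (fun _ => α) (α.scale c)) d =
      c * tensorSq (fun _ => α) d := by
  rw [tensorSq, tensorSq, ← Complex.re_ofReal_mul]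
  congr 1
  simp only [Finsupp.sum, Finset.mul_sum, Fin.prod_univ_castSucc, Fin.snoc_castSucc,
    Fin.snoc_last, HermForm.scale, LinearMap.smul_apply, smul_eq_mul]
  refine Finset.sum_congr rfl fun x _ => Finset.sum_congr rfl fun y _ => ?_
  ring

theorem tnorm_derivT_sum_simple_sq (α : HermForm V) (ρ : V →L[ℂ] ℂ)
    (d : (Fin (k + 1) → V) →₀ ℂ) :
    α.tnorm (derivT (ρ : V →ₗ[ℂ] ℂ) (d.sum fun x a => a • simple x)) ^ 2 =
      (k + 1) * ((k + 1).factorial *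
        tensorSq (Fin.snoc (α := fun _ => HermForm V) (fun _ => α) (rankOne ρ)) d) := by
  have hD : derivT (ρ : V →ₗ[ℂ] ℂ) (d.sum fun x a => a • simple x) = ((k + 1 : ℕ) : ℂ) •
      ∑ x ∈ d.support, (d x * ρ (x (Fin.last k))) • simple (Fin.init x) := by
    simp only [Finsupp.sum, map_sum, map_smul, derivT_simple_succ, Finset.smul_sum, smul_smul,
      ContinuousLinearMap.coe_coe, mul_left_comm]
  have hsum : (∑ x ∈ d.support, ∑ y ∈ d.support, star (d x * ρ (x (Fin.last k))) *
      (∏ m, α.form (Fin.init x m) (Fin.init y m)) * (d y * ρ (y (Fin.last k)))).re =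
      tensorSq (Fin.snoc (α := fun _ => HermForm V) (fun _ => α) (rankOne ρ)) d := by
    rw [tensorSq]
    congr 1
    refine Finset.sum_congr rfl fun x _ => Finset.sum_congr rfl fun y _ => ?_
    simp only [Fin.prod_univ_castSucc, Fin.snoc_castSucc, Fin.snoc_last, rankOne, Fin.init,
      LinearMap.coe_mk, AddHom.coe_mk, LinearMap.smul_apply, smul_eq_mul,
      ContinuousLinearMap.coe_coe, star_mul', starRingEnd_apply]
    ring
  rw [hD, map_smul_eq_mul, mul_pow, tnorm_sum_simple_sq, hsum, Complex.norm_natCast,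
    Nat.factorial_succ]
  push_cast
  ring

theorem tnorm_derivT_proj_succ_le {α : HermForm V} {ρ : V →L[ℂ] ℂ} {c : ℝ≥0}
    (h : ∀ v, ‖ρ v‖ ≤ c * α.nrm v) (k : ℕ) (X : Tens V) :
    α.tnorm (derivT (ρ : V →ₗ[ℂ] ℂ) (proj (k + 1) X)) ≤
      (k + 1) * c * α.tnorm (proj (k + 1) X) := by
  obtain ⟨d, hd⟩ := exists_proj_eq_sum_simple (k + 1) X
  have hmono : tensorSq (Fin.snoc (α := fun _ => HermForm V) (fun _ : Fin k => α) (rankOne ρ)) d ≤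
      tensorSq (Fin.snoc (α := fun _ => HermForm V) (fun _ => α) (α.scale (c ^ 2))) d := by
    refine tensorSq_mono (Fin.lastCases (fun v => ?_) fun i v => ?_) d
    · rw [Fin.snoc_last, Fin.snoc_last, nrm_rankOne, α.nrm_scale]
      exact h v
    · rw [Fin.snoc_castSucc, Fin.snoc_castSucc]
  refine (sq_le_sq₀ (apply_nonneg _ _) (by positivity)).1 ?_
  have hk : (1 : ℝ) ≤ k + 1 := by linarith [(Nat.cast_nonneg k : (0 : ℝ) ≤ k)]
  calc α.tnorm (derivT (ρ : V →ₗ[ℂ] ℂ) (proj (k + 1) X)) ^ 2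
      ≤ (k + 1) * ((k + 1).factorial * (c ^ 2 * tensorSq (fun _ => α) d)) := by
        rw [hd, tnorm_derivT_sum_simple_sq, ← NNReal.coe_pow, ← tensorSq_snoc_scale]
        gcongr
    _ = (k + 1) * (c * α.tnorm (proj (k + 1) X)) ^ 2 := by
        rw [mul_pow, hd, tnorm_sq_eq_tensorSq]
        ring
    _ ≤ (k + 1) ^ 2 * (c * α.tnorm (proj (k + 1) X)) ^ 2 := by
        gcongr
        exact le_self_pow₀ hk two_ne_zero
    _ = _ := by ring

theorem tnorm_derivT_pow_proj_le {α : HermForm V} {ρ : V →L[ℂ] ℂ}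
    (h : ∀ v, ‖ρ v‖ ≤ α.nrm v) (n k : ℕ) (X : Tens V) :
    α.tnorm ((derivT (ρ : V →ₗ[ℂ] ℂ) ^ n) (proj k X)) ≤
      k.descFactorial n * α.tnorm (proj k X) := by
  induction n generalizing k X with
  | zero => simp
  | succ n ih =>
    rw [pow_succ, Module.End.mul_apply]
    cases k with
    | zero => rw [derivT_proj_zero]; simp
    | succ k =>
      have hstep : α.tnorm (derivT (ρ : V →ₗ[ℂ] ℂ) (proj (k + 1) X)) ≤
          (k + 1) * α.tnorm (proj (k + 1) X) := by
        simpa using tnorm_derivT_proj_succ_le (c := 1) (by simpa using h) k X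
      rw [derivT_proj_succ] at hstep ⊢
      refine (ih k _).trans ?_
      rw [Nat.succ_descFactorial_succ, Nat.cast_mul, Nat.cast_succ, mul_comm ((k : ℝ) + 1),
        mul_assoc]
      exact mul_le_mul_of_nonneg_left hstep (Nat.cast_nonneg _)

theorem tnorm_derivT_le {α : HermForm V} {ρ : V →L[ℂ] ℂ} (h : ∀ v, ‖ρ v‖ ≤ α.nrm v)
    (X : Tens V) : α.tnorm (derivT (ρ : V →ₗ[ℂ] ℂ) X) ≤ 2 * (α.scale 16).tnorm X := by
  obtain ⟨s, hs⟩ := exists_eq_sum_proj X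
  calc α.tnorm (derivT (ρ : V →ₗ[ℂ] ℂ) X)
      = α.tnorm (∑ k ∈ s, derivT (ρ : V →ₗ[ℂ] ℂ) (proj k X)) := by rw [← map_sum, ← hs]
    _ ≤ ∑ k ∈ s, 2 ^ k * α.tnorm (proj k X) := by
        refine (tnorm_sum_le _ _ _).trans (Finset.sum_le_sum fun k _ => ?_)
        have hk : (k : ℝ) ≤ 2 ^ k := by exact_mod_cast (Nat.lt_two_pow_self (n := k)).le
        refine le_trans ?_ (mul_le_mul_of_nonneg_right hk (apply_nonneg _ _))
        simpa using tnorm_derivT_pow_proj_le h 1 k X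
    _ ≤ _ := sum_proj_le α s X

theorem tnorm_inv_factorial_smul_derivT_pow_le {α : HermForm V} {ρ : V →L[ℂ] ℂ}
    (h : ∀ v, ‖ρ v‖ ≤ α.nrm v) (n k : ℕ) (X : Tens V) :
    α.tnorm ((n.factorial : ℂ)⁻¹ • (derivT (ρ : V →ₗ[ℂ] ℂ) ^ n) (proj k X)) ≤
      k.choose n * α.tnorm (proj k X) := by
  rw [map_smul_eq_mul, norm_inv, Complex.norm_natCast,
    inv_mul_le_iff₀ (by exact_mod_cast n.factorial_pos), ← mul_assoc]
  refine (tnorm_derivT_pow_proj_le h n k X).trans_eq ?_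
  rw [Nat.descFactorial_eq_factorial_mul_choose, Nat.cast_mul]

theorem sum_range_choose_le (N k : ℕ) : ∑ n ∈ Finset.range N, k.choose n ≤ 2 ^ k := by
  rw [← Nat.sum_range_choose]
  refine Finset.sum_le_sum_of_ne_zero fun n _ hn => ?_
  by_contra hmem
  exact hn (Nat.choose_eq_zero_of_lt (by simpa using hmem))

theorem tnorm_translT_le {α : HermForm V} {ρ : V →L[ℂ] ℂ} (h : ∀ v, ‖ρ v‖ ≤ α.nrm v)
    (X : Tens V) : α.tnorm (translT (ρ : V →ₗ[ℂ] ℂ) X) ≤ 2 * (α.scale 16).tnorm X := by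
  obtain ⟨N, hN⟩ := exists_translT_eq_sum (ρ : V →ₗ[ℂ] ℂ) X
  obtain ⟨s, hs⟩ := exists_eq_sum_proj X
  calc α.tnorm (translT (ρ : V →ₗ[ℂ] ℂ) X)
      = α.tnorm (∑ k ∈ s, ∑ n ∈ Finset.range N,
          (n.factorial : ℂ)⁻¹ • (derivT (ρ : V →ₗ[ℂ] ℂ) ^ n) (proj k X)) := by
        rw [hN N le_rfl, Finset.sum_comm]
        simp only [← Finset.smul_sum, ← map_sum, ← hs]
    _ ≤ ∑ k ∈ s, ∑ n ∈ Finset.range N, k.choose n * α.tnorm (proj k X) :=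
        (tnorm_sum_le _ _ _).trans (Finset.sum_le_sum fun k _ => (tnorm_sum_le _ _ _).trans
          (Finset.sum_le_sum fun n _ => tnorm_inv_factorial_smul_derivT_pow_le h n k X))
    _ ≤ ∑ k ∈ s, 2 ^ k * α.tnorm (proj k X) := by
        refine Finset.sum_le_sum fun k _ => ?_
        rw [← Finset.sum_mul]
        exact mul_le_mul_of_nonneg_right (by exact_mod_cast sum_range_choose_le N k)
          (apply_nonneg _ _)
    _ ≤ _ := sum_proj_le α s X

theorem uniformContinuous_derivT (ρ : V →L[ℂ] ℂ) :
    UniformContinuous (derivT (ρ : V →ₗ[ℂ] ℂ)) :=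
  continuous_of_tnorm_le _ fun α => ⟨(α.add (rankOne ρ)).scale 16, 2, fun X =>
    (tnorm_mono (α.nrm_le_add_left (rankOne ρ)) _).trans <| tnorm_derivT_le
      (norm_apply_le_nrm_add_rankOne ρ α) X⟩

end TensorNorm

section SymmetricTensors

variable {V : Type*} [AddCommGroup V] [Module ℂ V]

/-- The power `v ⊗ ⋯ ⊗ v` of degree `k`. The symmetric tensors are spanned by these powers, so
identities between linear maps on symmetric tensors are checked on them. -/
def vpow (k : ℕ) (v : V) : Tens V := simple fun _ : Fin k => v

theorem vpow_mem_symTens (k : ℕ) (v : V) : vpow k v ∈ symTens V := by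
  refine ⟨vpow k v, ?_⟩
  rw [vpow, symm_simple]
  exact avg_const (vpow k v)

theorem sum_perm_simple {k : ℕ} (x : Fin k → V) :
    ∑ σ : Equiv.Perm (Fin k), simple (x ∘ σ) =
      ∑ T : Finset (Fin k), (-1 : ℤ) ^ T.card • vpow k (∑ i ∈ Tᶜ, x i) :=
  (multilinearMap_polarization
    ((ofDeg k).compMultilinearMap (PiTensorProduct.tprod ℂ (s := fun _ : Fin k => V))) x).symm

theorem symTens_le_span_vpow :
    symTens V ≤ Submodule.span ℂ (Set.range fun p : ℕ × V => vpow p.1 p.2) := by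
  rintro _ ⟨X, rfl⟩
  induction X using tens_induction with
  | hadd X Y hX hY =>
    rw [map_add]
    exact add_mem hX hY
  | h0 c k x =>
    rw [map_smul, symm_simple, sum_perm_simple]
    exact Submodule.smul_mem _ _ (Submodule.smul_mem _ _ (sum_mem fun T _ =>
      zsmul_mem (Submodule.subset_span (Set.mem_range_self (k, _))) _))

theorem symTens_induction {p : ∀ X : Tens V, X ∈ symTens V → Prop}
    (pow : ∀ k v, p (vpow k v) (vpow_mem_symTens k v)) (zero : p 0 (zero_mem _))
    (add : ∀ X Y hX hY, p X hX → p Y hY → p (X + Y) (add_mem hX hY))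
    (smul : ∀ (c : ℂ) X hX, p X hX → p (c • X) (Submodule.smul_mem _ c hX))
    {X : Tens V} (hX : X ∈ symTens V) : p X hX := by
  suffices h : ∃ h : X ∈ symTens V, p X h from h.2
  have hspan := symTens_le_span_vpow hX
  clear hX
  induction hspan using Submodule.span_induction with
  | mem X h =>
    obtain ⟨⟨k, v⟩, rfl⟩ := h
    exact ⟨_, pow k v⟩
  | zero => exact ⟨_, zero⟩
  | add X Y _ _ ihX ihY =>
    obtain ⟨hX, ihX⟩ := ihX
    obtain ⟨hY, ihY⟩ := ihY
    exact ⟨_, add X Y hX hY ihX ihY⟩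
  | smul c X _ ih =>
    obtain ⟨hX, ih⟩ := ih
    exact ⟨_, smul c X hX ih⟩

theorem derivT_vpow (ρ : V →ₗ[ℂ] ℂ) (k : ℕ) (v : V) :
    derivT ρ (vpow k v) = ((k : ℂ) * ρ v) • vpow (k - 1) v := by
  cases k with
  | zero => rw [vpow, derivT_simple_zero]; simp
  | succ k => rw [vpow, derivT_simple_succ, smul_smul]; rfl

theorem prodT_vpow (ρ : V →ₗ[ℂ] ℂ) (k : ℕ) (v : V) : prodT ρ (vpow k v) = ρ v ^ k := by
  rw [vpow, prodT_simple]; simp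

theorem derivT_mem_symTens (ρ : V →ₗ[ℂ] ℂ) {X : Tens V} (hX : X ∈ symTens V) :
    derivT ρ X ∈ symTens V := by
  induction hX using symTens_induction with
  | pow k v => rw [derivT_vpow]; exact Submodule.smul_mem _ _ (vpow_mem_symTens _ _)
  | zero => simp
  | add X Y _ _ hX hY => rw [map_add]; exact add_mem hX hY
  | smul c X _ hX => rw [map_smul]; exact Submodule.smul_mem _ _ hX

theorem hasDerivAt_prodT (σ ρ : V →ₗ[ℂ] ℂ) {X : Tens V} (hX : X ∈ symTens V) (t : ℝ) :
    HasDerivAt (fun t : ℝ => prodT (σ + (t : ℂ) • ρ) X)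
      (prodT (σ + (t : ℂ) • ρ) (derivT ρ X)) t := by
  induction hX using symTens_induction with
  | pow k v =>
    simp only [derivT_vpow, prodT_vpow, map_smul, LinearMap.add_apply, LinearMap.smul_apply,
      smul_eq_mul]
    have h : HasDerivAt (fun t : ℝ => σ v + (t : ℂ) * ρ v) (ρ v) t := by
      simpa using ((Complex.ofRealCLM.hasDerivAt (x := t)).mul_const (ρ v)).const_add (σ v)
    refine (h.fun_pow k).congr_deriv ?_
    ring
  | zero => simpa using hasDerivAt_const t (0 : ℂ)
  | add X Y _ _ hX hY => simpa only [map_add] using hX.fun_add hY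
  | smul c X _ hX => simpa only [map_smul, smul_eq_mul] using hX.const_mul c

theorem prodT_mul (ρ : V →ₗ[ℂ] ℂ) (X Y : Tens V) : prodT ρ (X * Y) = prodT ρ X * prodT ρ Y := by
  induction X using tens_induction with
  | hadd X X' hX hX' => simp only [map_add, add_mul, hX, hX']
  | h0 c k x =>
    induction Y using tens_induction with
    | hadd Y Y' hY hY' => simp only [map_add, mul_add, hY, hY']
    | h0 d l y =>
      simp only [smul_mul_assoc, mul_smul_comm, map_smul, smul_eq_mul, simple_mul, prodT_simple,
        Fin.prod_univ_add, Fin.append_left, Fin.append_right]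
      ring

theorem prodT_one (ρ : V →ₗ[ℂ] ℂ) : prodT ρ 1 = 1 := by
  rw [← simple_elim0 (Fin.elim0 : Fin 0 → V), prodT_simple]; simp

theorem prodT_symm (ρ : V →ₗ[ℂ] ℂ) (X : Tens V) : prodT ρ (symm X) = prodT ρ X := by
  induction X using tens_induction with
  | hadd X Y hX hY => simp only [map_add, hX, hY]
  | h0 c k x =>
    rw [map_smul, map_smul, map_smul, symm_simple, map_smul, map_sum]
    congr 1
    have (τ : Equiv.Perm (Fin k)) : prodT ρ (simple (x ∘ τ)) = prodT ρ (simple x) := by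
      rw [prodT_simple, prodT_simple]
      exact Fintype.prod_equiv τ _ _ fun _ => rfl
    simp only [this]
    exact avg_const _

theorem prodT_starT [StarAddMonoid V] [StarModule ℂ V] (ρ : V →ₗ[ℂ] ℂ)
    (hρ : ∀ v, conj (ρ v) = ρ (star v)) (X : Tens V) : prodT ρ (starT X) = conj (prodT ρ X) := by
  induction X using tens_induction with
  | hadd X Y hX hY => simp only [map_add, hX, hY]
  | h0 c k x =>
    rw [LinearMap.map_smulₛₗ, map_smul, map_smul, smul_eq_mul, smul_eq_mul, map_mul, starT_simple,
      prodT_simple, prodT_simple, map_prod]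
    congr 1
    simp only [hρ]
    exact Fintype.prod_equiv Fin.revPerm _ _ fun _ => rfl

end SymmetricTensors

section IteratedDerivatives

variable {V : Type*} [AddCommGroup V] [Module ℂ V]

/-- The derivation `D_ρ` of the tensor algebra as a linear function of `ρ`. -/
def derivTₗ : (V →ₗ[ℂ] ℂ) →ₗ[ℂ] Module.End ℂ (Tens V) where
  toFun := derivT
  map_add' ρ σ := by
    ext X
    induction X using tens_induction with
    | hadd X Y hX hY => simp only [map_add, hX, hY]
    | h0 c k x =>
      cases k with
      | zero => simp [derivT_simple_zero]
      | succ k =>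
        simp only [map_smul, LinearMap.add_apply, derivT_simple_succ, add_smul, smul_add]
  map_smul' c ρ := by
    ext X
    induction X using tens_induction with
    | hadd X Y hX hY => simp only [map_add, hX, hY]
    | h0 d k x =>
      cases k with
      | zero => simp [derivT_simple_zero]
      | succ k =>
        simp only [map_smul, LinearMap.smul_apply, derivT_simple_succ, RingHom.id_apply]
        simp only [smul_smul, smul_eq_mul]
        ring_nf

theorem translT_zero (X : Tens V) : translT 0 X = X := by
  obtain ⟨N, hN⟩ := exists_translT_eq_sum (0 : V →ₗ[ℂ] ℂ) X
  have hderiv : derivT (0 : V →ₗ[ℂ] ℂ) = 0 := map_zero (derivTₗ (V := V))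
  rw [hN (N + 1) (Nat.le_succ N), Finset.sum_range_succ', hderiv]
  simp

/-- The iterated derivation `D_{ρ₁} ⋯ D_{ρ_k}` of the tensor algebra. -/
def iterDerivT (k : ℕ) : MultilinearMap ℂ (fun _ : Fin k => V →ₗ[ℂ] ℂ) (Module.End ℂ (Tens V)) :=
  (MultilinearMap.mkPiAlgebraFin ℂ k (Module.End ℂ (Tens V))).compLinearMap fun _ => derivTₗ

theorem iterDerivT_zero (ρ : Fin 0 → V →ₗ[ℂ] ℂ) (X : Tens V) : iterDerivT 0 ρ X = X := by
  simp [iterDerivT]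

theorem iterDerivT_succ {k : ℕ} (ρ : Fin (k + 1) → V →ₗ[ℂ] ℂ) (X : Tens V) :
    iterDerivT (k + 1) ρ X = derivT (ρ 0) (iterDerivT k (Fin.tail ρ) X) := by
  simp [iterDerivT, MultilinearMap.mkPiAlgebraFin_apply, List.ofFn_succ, derivTₗ, Fin.tail]

theorem iterDerivT_succ_last {k : ℕ} (ρ : Fin (k + 1) → V →ₗ[ℂ] ℂ) (X : Tens V) :
    iterDerivT (k + 1) ρ X = iterDerivT k (Fin.init ρ) (derivT (ρ (Fin.last k)) X) := by
  simp only [iterDerivT, MultilinearMap.compLinearMap_apply, MultilinearMap.mkPiAlgebraFin_apply]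
  rw [List.ofFn_succ', List.concat_eq_append, List.prod_append, List.prod_singleton,
    Module.End.mul_apply]
  rfl

theorem iterDerivT_vpow {k : ℕ} (ρ : Fin k → V →ₗ[ℂ] ℂ) (n : ℕ) (v : V) :
    iterDerivT k ρ (vpow n v) = ((n.descFactorial k : ℂ) * ∏ i, ρ i v) • vpow (n - k) v := by
  induction k with
  | zero => simp [iterDerivT_zero]
  | succ k ih =>
    rw [iterDerivT_succ, ih, map_smul, derivT_vpow, smul_smul, Nat.descFactorial_succ,
      Fin.prod_univ_succ, Nat.sub_sub]
    congr 1
    push_cast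
    simp only [Fin.tail]
    ring

theorem iterDerivT_mem_symTens {k : ℕ} (ρ : Fin k → V →ₗ[ℂ] ℂ) {X : Tens V} (hX : X ∈ symTens V) :
    iterDerivT k ρ X ∈ symTens V := by
  induction k with
  | zero => rwa [iterDerivT_zero]
  | succ k ih => rw [iterDerivT_succ]; exact derivT_mem_symTens _ (ih _)

theorem iterDerivT_comp_perm {k : ℕ} (ρ : Fin k → V →ₗ[ℂ] ℂ) (τ : Equiv.Perm (Fin k)) {X : Tens V}
    (hX : X ∈ symTens V) : iterDerivT k (ρ ∘ τ) X = iterDerivT k ρ X := by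
  induction hX using symTens_induction with
  | pow n v =>
    rw [iterDerivT_vpow, iterDerivT_vpow]
    congr 2
    exact Fintype.prod_equiv τ _ _ fun _ => rfl
  | zero => simp
  | add X Y _ _ hX hY => rw [map_add, map_add, hX, hY]
  | smul c X _ hX => rw [map_smul, map_smul, hX]

theorem derivT_iterDerivT {k : ℕ} (ρ : Fin k → V →ₗ[ℂ] ℂ) (ξ : V →ₗ[ℂ] ℂ) {X : Tens V}
    (hX : X ∈ symTens V) : derivT ξ (iterDerivT k ρ X) = iterDerivT k ρ (derivT ξ X) := by
  induction hX using symTens_induction with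
  | pow n v =>
    rw [iterDerivT_vpow, map_smul, derivT_vpow, derivT_vpow, map_smul, iterDerivT_vpow, smul_smul,
      smul_smul, Nat.sub_right_comm]
    congr 1
    have h : n.descFactorial k * (n - k) = n * (n - 1).descFactorial k := by
      cases n with
      | zero => simp
      | succ n => rw [mul_comm, ← Nat.descFactorial_succ, Nat.succ_descFactorial_succ]; simp
    have h' : (n.descFactorial k : ℂ) * ((n - k : ℕ) : ℂ) = n * ((n - 1).descFactorial k : ℂ) := by
      exact_mod_cast h
    linear_combination (∏ i, ρ i v) * ξ v * h'
  | zero => simp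
  | add X Y _ _ hX hY => simp only [map_add, hX, hY]
  | smul c X _ hX => simp only [map_smul, hX]

theorem derivT_pow_iterDerivT {k : ℕ} (ρ : Fin k → V →ₗ[ℂ] ℂ) (ξ : V →ₗ[ℂ] ℂ) (n : ℕ) {X : Tens V}
    (hX : X ∈ symTens V) :
    (derivT ξ ^ n) (iterDerivT k ρ X) = iterDerivT k ρ ((derivT ξ ^ n) X) := by
  induction n generalizing X with
  | zero => simp
  | succ n ih =>
    rw [pow_succ, Module.End.mul_apply, Module.End.mul_apply, derivT_iterDerivT ρ ξ hX,
      ih (derivT_mem_symTens ξ hX)]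

theorem translT_iterDerivT {k : ℕ} (ρ : Fin k → V →ₗ[ℂ] ℂ) (ξ : V →ₗ[ℂ] ℂ) {X : Tens V}
    (hX : X ∈ symTens V) : translT ξ (iterDerivT k ρ X) = iterDerivT k ρ (translT ξ X) := by
  obtain ⟨N, hN⟩ := exists_translT_eq_sum ξ X
  obtain ⟨M, hM⟩ := exists_translT_eq_sum ξ (iterDerivT k ρ X)
  rw [hN (max N M) (le_max_left _ _), hM (max N M) (le_max_right _ _), map_sum]
  simp only [derivT_pow_iterDerivT ρ ξ _ hX, map_smul]

/-- The pairing `x₁ ⊗ ⋯ ⊗ x_k ↦ k! ρ₁(x₁) ⋯ ρ_k(x_k)` of tensors with functionals; tensors of degree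
other than `k` are mapped to zero. -/
def pairT (k : ℕ) : MultilinearMap ℂ (fun _ : Fin k => V →ₗ[ℂ] ℂ) (Tens V →ₗ[ℂ] ℂ) :=
  (LinearMap.llcomp ℂ (Tens V) (Tens V) ℂ scalarPart).compMultilinearMap (iterDerivT k)

theorem pairT_apply {k : ℕ} (ρ : Fin k → V →ₗ[ℂ] ℂ) (X : Tens V) :
    pairT k ρ X = scalarPart (iterDerivT k ρ X) := rfl

theorem evalT_iterDerivT {k : ℕ} (ρ : Fin k → V →ₗ[ℂ] ℂ) (ξ : V →ₗ[ℂ] ℂ) {X : Tens V}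
    (hX : X ∈ symTens V) : evalT ξ (iterDerivT k ρ X) = pairT k ρ (translT ξ X) := by
  rw [evalT, translT_iterDerivT ρ ξ hX, pairT_apply]

theorem pairT_simple {k : ℕ} (ρ : Fin k → V →ₗ[ℂ] ℂ) (x : Fin k → V) :
    pairT k ρ (simple x) = k.factorial * ∏ i, ρ i (x i) := by
  induction k with
  | zero => simp [pairT_apply, iterDerivT_zero, scalarPart_simple_zero]
  | succ k ih =>
    rw [pairT_apply, iterDerivT_succ_last, derivT_simple_succ, map_smul, map_smul, map_smul,
      map_smul, ← pairT_apply, ih, Fin.prod_univ_castSucc, Nat.factorial_succ]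
    push_cast
    simp only [Fin.init, smul_eq_mul]
    ring

theorem pairT_simple_of_ne {k l : ℕ} (h : k ≠ l) (ρ : Fin k → V →ₗ[ℂ] ℂ) (x : Fin l → V) :
    pairT k ρ (simple x) = 0 := by
  induction k generalizing l with
  | zero =>
    cases l with
    | zero => exact absurd rfl h
    | succ l => rw [pairT_apply, iterDerivT_zero, scalarPart_simple_succ]
  | succ k ih =>
    rw [pairT_apply, iterDerivT_succ_last]
    cases l with
    | zero => rw [derivT_simple_zero, map_zero, map_zero]
    | succ l =>
      rw [derivT_simple_succ, map_smul, map_smul, map_smul, map_smul, ← pairT_apply,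
        ih (by omega), smul_zero, smul_zero]

variable [TopologicalSpace V]

theorem norm_pairT_le (α : HermForm V) {k : ℕ} (ρ : Fin k → V →L[ℂ] ℂ) (c : Fin k → ℝ≥0)
    (h : ∀ i v, ‖ρ i v‖ ≤ c i * α.nrm v) (X : Tens V) :
    ‖pairT k (fun i => (ρ i : V →ₗ[ℂ] ℂ)) X‖ ≤
      k.factorial * (∏ i, (c i : ℝ)) * α.tnorm (proj k X) := by
  induction k generalizing X with
  | zero =>
    rw [pairT_apply, iterDerivT_zero, ← scalarPart_smul_one, map_smul_eq_mul, tnorm_one]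
    simp
  | succ k ih =>
    rw [pairT_apply, iterDerivT_succ_last, ← pairT_apply]
    refine (ih (fun i => ρ i.castSucc) (fun i => c i.castSucc) (fun i => h i.castSucc) _).trans ?_
    rw [← derivT_proj_succ, Nat.factorial_succ, Fin.prod_univ_castSucc]
    refine (mul_le_mul_of_nonneg_left
      (tnorm_derivT_proj_succ_le (h (Fin.last k)) k X) (by positivity)).trans (le_of_eq ?_)
    push_cast
    ring

end IteratedDerivatives
section Flat

variable {V : Type*} [AddCommGroup V] [Module ℂ V] [TopologicalSpace V]
  [StarAddMonoid V] [StarModule ℂ V] {α β : HermForm V}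

theorem HermSpace.inner_def (x y : HermSpace α) :
    inner ℝ x y = (α.form (HermSpace.val α x) (HermSpace.val α y)).re := rfl

theorem HermSpace.star_val (x : HermSpace α) : star (HermSpace.val α x) = HermSpace.val α x :=
  (x : selfAdjoint V).2

theorem HermSpace.val_re_add_val_im (w : V) :
    HermSpace.val α (HermSpace.mk α (ℜ w)) +
      Complex.I • HermSpace.val α (HermSpace.mk α (ℑ w)) = w :=
  realPart_add_I_smul_imaginaryPart w

theorem HermForm.Compatible.ofReal_inner (hα : α.Compatible) (x y : HermSpace α) :
    ((inner ℝ x y : ℝ) : ℂ) = α.form (HermSpace.val α x) (HermSpace.val α y) := by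
  rw [HermSpace.inner_def]
  refine Complex.conj_eq_iff_re.1 ?_
  rw [hα, HermSpace.star_val, HermSpace.star_val]

theorem HermForm.Compatible.nrm_sq_eq (hα : α.Compatible) (w : V) :
    α.nrm w ^ 2 = ‖HermSpace.mk α (ℜ w)‖ ^ 2 + ‖HermSpace.mk α (ℑ w)‖ ^ 2 := by
  have hw := HermSpace.val_re_add_val_im (α := α) w
  set a := HermSpace.mk α (ℜ w)
  set b := HermSpace.mk α (ℑ w)
  rw [α.nrm_sq, ← real_inner_self_eq_norm_sq, ← real_inner_self_eq_norm_sq]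
  have h : α.form w w = ((inner ℝ a a + inner ℝ b b : ℝ) : ℂ) := by
    rw [← hw]
    simp only [map_add, LinearMap.add_apply, LinearMap.map_smulₛₗ, LinearMap.smul_apply, map_smul,
      ← hα.ofReal_inner, real_inner_comm a b, Complex.conj_I, smul_eq_mul, Complex.ofReal_add]
    linear_combination -((inner ℝ b b : ℝ) : ℂ) * Complex.I_sq
  rw [h, Complex.ofReal_re]

theorem HermDual.ext_selfAdjoint {ρ σ : HermDual V}
    (h : ∀ y : selfAdjoint V, (ρ : V →L[ℂ] ℂ) y = (σ : V →L[ℂ] ℂ) y) : ρ = σ := by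
  refine Subtype.ext (ContinuousLinearMap.ext fun w => ?_)
  conv_lhs => rw [← realPart_add_I_smul_imaginaryPart w]
  conv_rhs => rw [← realPart_add_I_smul_imaginaryPart w]
  rw [map_add, map_add, map_smul, map_smul, h, h]

theorem HermDual.ofReal_re_val (ρ : HermDual V) (y : HermSpace α) :
    (((ρ : V →L[ℂ] ℂ) (HermSpace.val α y)).re : ℂ) = (ρ : V →L[ℂ] ℂ) (HermSpace.val α y) := by
  refine Complex.conj_eq_iff_re.1 ?_
  rw [ρ.2, HermSpace.star_val]

theorem denseRange_coe_pi (k : ℕ) :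
    DenseRange fun (y : Fin k → HermSpace α) (i : Fin k) => (y i : HermCpl α) :=
  DenseRange.piMap fun _ => UniformSpace.Completion.denseRange_coe

variable [IsTopologicalAddGroup V] [ContinuousStar V] [ContinuousSMul ℂ V]

theorem flat_apply (v : HermCpl α) (w : V) :
    (flat α v : V →L[ℂ] ℂ) w =
      ((inner ℝ v ((HermSpace.mk α (ℜ w) : HermSpace α) : HermCpl α) : ℝ) : ℂ) +
        Complex.I * ((inner ℝ v ((HermSpace.mk α (ℑ w) : HermSpace α) : HermCpl α) : ℝ) : ℂ) :=
  rfl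

theorem flat_val (v : HermCpl α) (y : HermSpace α) :
    (flat α v : V →L[ℂ] ℂ) (HermSpace.val α y) = ((inner ℝ v (y : HermCpl α) : ℝ) : ℂ) := by
  have h : star (HermSpace.val α y) = HermSpace.val α y := HermSpace.star_val y
  have h₁ : HermSpace.mk α (ℜ (HermSpace.val α y)) = y := Subtype.ext <| by
    change ((ℜ (HermSpace.val α y) : selfAdjoint V) : V) = HermSpace.val α y
    rw [realPart_apply_coe, h, ← two_smul ℝ, smul_smul]
    norm_num
  have h₂ : HermSpace.mk α (ℑ (HermSpace.val α y)) = 0 := Subtype.ext <| by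
    change ((ℑ (HermSpace.val α y) : selfAdjoint V) : V) = 0
    rw [imaginaryPart_apply_coe, h, sub_self, smul_zero, smul_zero]
  rw [flat_apply, h₁, h₂, UniformSpace.Completion.coe_zero, inner_zero_right]
  simp

theorem flat_coe (hα : α.Compatible) (y : HermSpace α) (w : V) :
    (flat α (y : HermCpl α) : V →L[ℂ] ℂ) w = α.form (HermSpace.val α y) w := by
  conv_rhs => rw [← HermSpace.val_re_add_val_im (α := α) w]
  rw [flat_apply, map_add, map_smul, ← hα.ofReal_inner, ← hα.ofReal_inner,
    UniformSpace.Completion.inner_coe, UniformSpace.Completion.inner_coe, smul_eq_mul]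

theorem norm_flat_apply_le (hα : α.Compatible) (v : HermCpl α) (w : V) :
    ‖(flat α v : V →L[ℂ] ℂ) w‖ ≤ ‖v‖ * α.nrm w := by
  refine (sq_le_sq₀ (norm_nonneg _) (mul_nonneg (norm_nonneg _) (α.nrm_nonneg _))).1 ?_
  rw [mul_pow, hα.nrm_sq_eq, flat_apply, mul_comm Complex.I, ← Complex.normSq_eq_norm_sq,
    Complex.normSq_add_mul_I, mul_add]
  have h (y : HermSpace α) : (inner ℝ v (y : HermCpl α)) ^ 2 ≤ ‖v‖ ^ 2 * ‖y‖ ^ 2 := by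
    rw [← mul_pow, ← UniformSpace.Completion.norm_coe y]
    exact sq_le_sq' (by linarith [neg_le_of_abs_le (abs_real_inner_le_norm v (y : HermCpl α))])
      (real_inner_le_norm _ _)
  exact add_le_add (h _) (h _)

theorem exists_flat_eq (ρ : HermDual V) {c : ℝ} (hc : 0 ≤ c)
    (h : ∀ v, ‖(ρ : V →L[ℂ] ℂ) v‖ ≤ c * α.nrm v) :
    ∃ u : HermCpl α, ‖u‖ ≤ c ∧ flat α u = ρ := by
  let f : HermSpace α →ₗ[ℝ] ℝ :=
    Complex.reLm ∘ₗ ((ρ : V →L[ℂ] ℂ) : V →ₗ[ℂ] ℂ).restrictScalars ℝ ∘ₗ HermSpace.val α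
  have hf (y : HermSpace α) : f y = ((ρ : V →L[ℂ] ℂ) (HermSpace.val α y)).re := rfl
  let g : HermSpace α →L[ℝ] ℝ := f.mkContinuous c fun y =>
    (Complex.abs_re_le_norm _).trans (h _)
  have hg (y : HermSpace α) : g.fromCompletion (y : HermCpl α) = f y :=
    g.fromCompletion_apply_coe y
  let u := (InnerProductSpace.toDual ℝ (HermCpl α)).symm g.fromCompletion
  have hu (x : HermCpl α) : inner ℝ u x = g.fromCompletion x :=
    InnerProductSpace.toDual_symm_apply
  refine ⟨u, ?_, ?_⟩
  · rw [LinearIsometryEquiv.norm_map]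
    refine ContinuousLinearMap.opNorm_le_bound _ hc fun x => ?_
    induction x using UniformSpace.Completion.induction_on with
    | hp => exact isClosed_le (by fun_prop) (by fun_prop)
    | ih y =>
      rw [hg, UniformSpace.Completion.norm_coe]
      exact (Complex.abs_re_le_norm _).trans (h _)
  · refine HermDual.ext_selfAdjoint fun y => ?_
    have := flat_val u (HermSpace.mk α y)
    rw [hu, hg, hf, HermDual.ofReal_re_val] at this
    exact this

variable (α) in
/-- The map `v ↦ v^♭` as a real-linear map into the algebraic dual, where multilinear maps such as
`pairT` can be precomposed with it. -/
def flatₗ : HermCpl α →ₗ[ℝ] V →ₗ[ℂ] ℂ where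
  toFun v := (flat α v : V →L[ℂ] ℂ)
  map_add' v w := by
    ext x
    simp only [ContinuousLinearMap.coe_coe, LinearMap.add_apply, flat_apply, inner_add_left,
      Complex.ofReal_add]
    ring
  map_smul' c v := by
    ext x
    simp only [ContinuousLinearMap.coe_coe, LinearMap.smul_apply, flat_apply, inner_smul_left,
      RingHom.id_apply, conj_trivial, Complex.ofReal_mul, Complex.real_smul]
    ring

theorem flatₗ_apply (v : HermCpl α) : flatₗ α v = ((flat α v : V →L[ℂ] ℂ) : V →ₗ[ℂ] ℂ) := rfl

theorem flat_add (v w : HermCpl α) : flat α (v + w) = flat α v + flat α w :=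
  Subtype.ext <| ContinuousLinearMap.coe_injective (map_add (flatₗ α) v w)

theorem flat_smul (c : ℝ) (v : HermCpl α) : flat α (c • v) = c • flat α v :=
  Subtype.ext <| ContinuousLinearMap.coe_injective (map_smul (flatₗ α) c v)

end Flat

section Fock

variable {V : Type*} [AddCommGroup V] [Module ℂ V] [TopologicalSpace V]

/-- The tensor algebra with the semi-inner product `⟨·,·⟩_α` induced by `α`; a type synonym, so that
different forms give different norms. -/
def Fock (_α : HermForm V) : Type _ := Tens V

variable (α : HermForm V)

instance : AddCommGroup (Fock α) := inferInstanceAs (AddCommGroup (Tens V))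

instance : Module ℂ (Fock α) := inferInstanceAs (Module ℂ (Tens V))

/-- The semi-inner product of `α` on the tensor algebra. -/
abbrev Fock.core : PreInnerProductSpace.Core ℂ (Fock α) := α.core

instance : SeminormedAddCommGroup (Fock α) :=
  @InnerProductSpace.Core.toSeminormedAddCommGroup ℂ _ _ _ _ (Fock.core α)

instance : InnerProductSpace ℂ (Fock α) := InnerProductSpace.ofCore (Fock.core α)

/-- The Fock space: the completion of the tensor algebra with the inner product of `α`. -/
abbrev FockCpl := UniformSpace.Completion (Fock α)

/-- A tensor as an element of the Fock space. -/
def toFock : Tens V →ₗ[ℂ] FockCpl α :=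
  (UniformSpace.Completion.toComplₗᵢ (𝕜 := ℂ) (E := Fock α)).toLinearMap ∘ₗ
    (LinearMap.id : Tens V →ₗ[ℂ] Tens V)

theorem norm_toFock (X : Tens V) : ‖toFock α X‖ = α.tnorm X :=
  UniformSpace.Completion.norm_coe (E := Fock α) X

theorem inner_toFock (X Y : Tens V) : inner ℂ (toFock α X) (toFock α Y) = α.ext X Y :=
  UniformSpace.Completion.inner_coe (E := Fock α) X Y

theorem denseRange_toFock : DenseRange (toFock α) :=
  UniformSpace.Completion.denseRange_coe (α := Fock α)

variable {α}

theorem FockCpl.ext {x y : FockCpl α}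
    (h : ∀ X, inner ℂ x (toFock α X) = inner ℂ y (toFock α X)) : x = y := by
  refine Dense.eq_of_inner_left (𝕜 := ℂ) (denseRange_toFock α) ?_
  rintro _ ⟨X, rfl⟩
  exact h X

/-- The canonical map from the Fock space of `β` to that of `α` for `α ≤ β`, extending the identity
of the tensor algebra (a junk value if `‖·‖_α` is not bounded by a multiple of `‖·‖_β`). -/
def fockRestrict (α β : HermForm V) : FockCpl β →L[ℂ] FockCpl α :=
  (toFock α).extendOfNorm (toFock β)

theorem fockRestrict_toFock {α β : HermForm V} (h : ∀ v, α.nrm v ≤ β.nrm v) (X : Tens V) :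
    fockRestrict α β (toFock β X) = toFock α X :=
  LinearMap.extendOfNorm_eq (denseRange_toFock β)
    ⟨1, fun X => by rw [norm_toFock, norm_toFock, one_mul]; exact tnorm_mono h X⟩ X

variable (α) in
/-- The canonical map from the completed symmetric tensor algebra to the Fock space. -/
def symFock : SymCpl V →L[ℂ] FockCpl α :=
  ContinuousLinearMap.fromCompletion
    { toLinearMap := toFock α ∘ₗ (symTens V).subtype
      cont := by
        refine Continuous.comp (g := toFock α) ?_ continuous_subtype_val
        refine continuous_of_continuousAt_zero (toFock α) ?_
        rw [ContinuousAt, map_zero, tendsto_zero_iff_norm_tendsto_zero]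
        simp only [norm_toFock]
        exact (continuous_tnorm α).tendsto' 0 0 (by simp) }

theorem symFock_coe (Y : symTens V) : symFock α (Y : SymCpl V) = toFock α (Y : Tens V) :=
  ContinuousLinearMap.fromCompletion_apply_coe _ Y

theorem pairT_form {k : ℕ} (x : Fin k → V) (X : Tens V) :
    pairT k (fun i => α.form (x i)) X = α.ext (simple x) X := by
  induction X using tens_induction with
  | hadd X Y hX hY => simp only [map_add, hX, hY]
  | h0 c l y =>
    rw [map_smul, map_smul]
    congr 1
    by_cases h : k = l
    · subst h; rw [pairT_simple, α.ext_simple]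
    · rw [pairT_simple_of_ne h, α.ext_simple_of_ne h]

variable [StarAddMonoid V] [StarModule ℂ V] [IsTopologicalAddGroup V] [ContinuousStar V]
  [ContinuousSMul ℂ V]

theorem norm_pairT_flat_le (hα : α.Compatible) {k : ℕ} (v : Fin k → HermCpl α) (X : Tens V) :
    ‖pairT k (fun i => flatₗ α (v i)) X‖ ≤ k.factorial * (∏ i, ‖v i‖) * ‖toFock α X‖ := by
  rw [norm_toFock]
  refine (norm_pairT_le α (fun i => (flat α (v i) : V →L[ℂ] ℂ)) (fun i => ‖v i‖₊)
    (fun i w => norm_flat_apply_le hα (v i) w) X).trans ?_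
  exact mul_le_mul_of_nonneg_left (tnorm_proj_le α k X) (by positivity)

/-- The tensor `v₁ ⊗ ⋯ ⊗ v_k` of vectors of the Hilbert space completion, as the vector of the Fock
space that represents the functional `X ↦ pairT k (v₁^♭, …, v_k^♭) X`. -/
def fockTensorFun {k : ℕ} (v : Fin k → HermCpl α) : FockCpl α :=
  (InnerProductSpace.toDual ℂ (FockCpl α)).symm
    ((pairT k fun i => flatₗ α (v i)).extendOfNorm (toFock α))

theorem inner_fockTensorFun (hα : α.Compatible) {k : ℕ} (v : Fin k → HermCpl α) (X : Tens V) :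
    inner ℂ (fockTensorFun v) (toFock α X) = pairT k (fun i => flatₗ α (v i)) X := by
  rw [fockTensorFun, InnerProductSpace.toDual_symm_apply]
  exact LinearMap.extendOfNorm_eq (denseRange_toFock α) ⟨_, norm_pairT_flat_le hα v⟩ X

/-- The tensor `v₁ ⊗ ⋯ ⊗ v_k` in the Fock space as a continuous multilinear function of the
vectors. -/
def fockTensor (hα : α.Compatible) (k : ℕ) :
    ContinuousMultilinearMap ℝ (fun _ : Fin k => HermCpl α) (FockCpl α) :=
  MultilinearMap.mkContinuous
    { toFun := fockTensorFun
      map_update_add' := fun {_} v i x y => FockCpl.ext fun X => by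
        rw [inner_add_left]
        simp only [inner_fockTensorFun hα]
        rw [← LinearMap.add_apply]
        congr 1
        exact (((pairT k).restrictScalars ℝ).compLinearMap fun _ => flatₗ α).map_update_add v i x y
      map_update_smul' := fun {_} v i c x => FockCpl.ext fun X => by
        rw [← Complex.coe_smul c, inner_smul_left]
        simp only [inner_fockTensorFun hα]
        rw [Complex.conj_ofReal, ← smul_eq_mul, ← LinearMap.smul_apply]
        congr 1
        exact (((pairT k).restrictScalars ℝ).compLinearMap fun _ => flatₗ α).map_update_smul
          v i c x }
    k.factorial fun v => by
      change ‖fockTensorFun v‖ ≤ _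
      rw [fockTensorFun, LinearIsometryEquiv.norm_map]
      exact LinearMap.opNorm_extendOfNorm_le (denseRange_toFock α) (by positivity)
        (norm_pairT_flat_le hα v)

theorem inner_fockTensor (hα : α.Compatible) {k : ℕ} (v : Fin k → HermCpl α) (X : Tens V) :
    inner ℂ (fockTensor hα k v) (toFock α X) = pairT k (fun i => flatₗ α (v i)) X :=
  inner_fockTensorFun hα v X

theorem fockTensor_coe (hα : α.Compatible) {k : ℕ} (y : Fin k → HermSpace α) :
    fockTensor hα k (fun i => (y i : HermCpl α)) =
      toFock α (simple fun i => HermSpace.val α (y i)) := by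
  refine FockCpl.ext fun X => ?_
  rw [inner_fockTensor, inner_toFock, ← pairT_form]
  congr 2
  funext i
  ext w
  exact flat_coe hα (y i) w

theorem inner_fockTensor_fockTensor (hα : α.Compatible) {k : ℕ} (v w : Fin k → HermCpl α) :
    inner ℂ (fockTensor hα k v) (fockTensor hα k w) =
      k.factorial * ∏ i, ((inner ℝ (v i) (w i) : ℝ) : ℂ) := by
  refine (denseRange_coe_pi k).induction_on (p := fun w => inner ℂ (fockTensor hα k v)
    (fockTensor hα k w) = k.factorial * ∏ i, ((inner ℝ (v i) (w i) : ℝ) : ℂ)) w ?_ fun y => ?_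
  · refine isClosed_eq (by fun_prop) (continuous_const.mul (continuous_finsetProd _ fun i _ => ?_))
    exact Complex.continuous_ofReal.comp (continuous_const.inner (continuous_apply i))
  · rw [fockTensor_coe, inner_fockTensor, pairT_simple]
    simp only [flatₗ_apply, ContinuousLinearMap.coe_coe, flat_val]

theorem norm_fockTensor_sq (hα : α.Compatible) {k : ℕ} (v : Fin k → HermCpl α) :
    ‖fockTensor hα k v‖ ^ 2 = k.factorial * ∏ i, ‖v i‖ ^ 2 := by
  have h := inner_fockTensor_fockTensor hα v v
  simp only [real_inner_self_eq_norm_sq] at h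
  rw [inner_self_eq_norm_sq_to_K] at h
  refine Complex.ofReal_injective ?_
  push_cast at h ⊢
  exact h

theorem inner_fockTensor_of_ne (hα : α.Compatible) {k l : ℕ} (h : k ≠ l) (v : Fin k → HermCpl α)
    (w : Fin l → HermCpl α) : inner ℂ (fockTensor hα k v) (fockTensor hα l w) = 0 := by
  refine (denseRange_coe_pi l).induction_on (p := fun w => inner ℂ (fockTensor hα k v)
    (fockTensor hα l w) = 0) w ?_ fun y => ?_
  · exact isClosed_eq (by fun_prop) continuous_const
  · rw [fockTensor_coe, inner_fockTensor, pairT_simple_of_ne h]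

end Fock

section CompletedDerivatives

variable {V : Type*} [AddCommGroup V] [Module ℂ V] [TopologicalSpace V]

/-- The derivation `D_ρ` on the completed symmetric tensor algebra. -/
def derivSym (ρ : V →L[ℂ] ℂ) : SymCpl V →L[ℂ] SymCpl V :=
  ContinuousLinearMap.completion
    { toLinearMap := (derivT (ρ : V →ₗ[ℂ] ℂ)).restrict fun _ => derivT_mem_symTens _
      cont := ((uniformContinuous_derivT ρ).continuous.comp continuous_subtype_val).subtype_mk _ }

theorem derivSym_coe (ρ : V →L[ℂ] ℂ) (Y : symTens V) :
    derivSym ρ (Y : SymCpl V) =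
      ((⟨derivT (ρ : V →ₗ[ℂ] ℂ) Y, derivT_mem_symTens _ Y.2⟩ : symTens V) : SymCpl V) :=
  ContinuousLinearMap.completion_apply_coe _ Y

/-- The iterated derivation `D_{ρ₁} ⋯ D_{ρ_k}` on the completed symmetric tensor algebra. -/
def iterDerivSym : (k : ℕ) → (Fin k → V →L[ℂ] ℂ) → SymCpl V →L[ℂ] SymCpl V
  | 0, _ => ContinuousLinearMap.id ℂ _
  | k + 1, ρ => derivSym (ρ 0) ∘L iterDerivSym k (Fin.tail ρ)

theorem iterDerivSym_coe {k : ℕ} (ρ : Fin k → V →L[ℂ] ℂ) (Y : symTens V) :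
    iterDerivSym k ρ (Y : SymCpl V) =
      ((⟨iterDerivT k (fun i => (ρ i : V →ₗ[ℂ] ℂ)) Y, iterDerivT_mem_symTens _ Y.2⟩ : symTens V) :
        SymCpl V) := by
  induction k with
  | zero =>
    simp only [iterDerivT_zero]
    rfl
  | succ k ih =>
    rw [iterDerivSym, ContinuousLinearMap.comp_apply, ih, derivSym_coe]
    simp only [iterDerivT_succ]
    rfl

end CompletedDerivatives
section Gelfand

variable {V : Type*} [AddCommGroup V] [Module ℂ V] [TopologicalSpace V]
  [StarAddMonoid V]

theorem norm_add_smul_apply_le (σ ρ : HermDual V) {t : ℝ} (ht : ‖t‖ ≤ 1) (v : V) :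
    ‖((σ + t • ρ : HermDual V) : V →L[ℂ] ℂ) v‖ ≤
      (((rankOne (σ : V →L[ℂ] ℂ)).add (rankOne (ρ : V →L[ℂ] ℂ))).scale (2 ^ 2)).nrm v := by
  have hσ := norm_apply_le_nrm_rankOne_add (σ : V →L[ℂ] ℂ) (rankOne (ρ : V →L[ℂ] ℂ)) v
  have hρ := norm_apply_le_nrm_add_rankOne (ρ : V →L[ℂ] ℂ) (rankOne (σ : V →L[ℂ] ℂ)) v
  rw [HermForm.nrm_scale, NNReal.coe_ofNat]
  calc ‖(σ : V →L[ℂ] ℂ) v + t • (ρ : V →L[ℂ] ℂ) v‖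
      ≤ ‖(σ : V →L[ℂ] ℂ) v‖ + 1 * ‖(ρ : V →L[ℂ] ℂ) v‖ := by
        refine (norm_add_le _ _).trans ?_
        rw [norm_smul]
        gcongr
    _ ≤ _ := by linarith

theorem norm_apply_le_of_mem_segment {σ σ' ξ : HermDual V} (hξ : ξ ∈ segment ℝ σ σ') (v : V) :
    ‖(ξ : V →L[ℂ] ℂ) v‖ ≤
      ((rankOne (σ : V →L[ℂ] ℂ)).add (rankOne (σ' : V →L[ℂ] ℂ))).nrm v := by
  obtain ⟨a, b, ha, hb, hab, rfl⟩ := hξ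
  set γ := (rankOne (σ : V →L[ℂ] ℂ)).add (rankOne (σ' : V →L[ℂ] ℂ))
  have hσ : ‖(σ : V →L[ℂ] ℂ) v‖ ≤ γ.nrm v := norm_apply_le_nrm_rankOne_add _ _ v
  have hσ' : ‖(σ' : V →L[ℂ] ℂ) v‖ ≤ γ.nrm v := norm_apply_le_nrm_add_rankOne _ _ v
  calc ‖a • (σ : V →L[ℂ] ℂ) v + b • (σ' : V →L[ℂ] ℂ) v‖
      ≤ a * ‖(σ : V →L[ℂ] ℂ) v‖ + b * ‖(σ' : V →L[ℂ] ℂ) v‖ := by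
        refine (norm_add_le _ _).trans (le_of_eq ?_)
        rw [norm_smul, norm_smul, Real.norm_of_nonneg ha, Real.norm_of_nonneg hb]
    _ ≤ a * γ.nrm v + b * γ.nrm v := by gcongr
    _ = γ.nrm v := by rw [← add_mul, hab, one_mul]

theorem gelfand_coe (Y : symTens V) (ρ : HermDual V) :
    gelfand (Y : SymCpl V) ρ = prodT ((ρ : V →L[ℂ] ℂ) : V →ₗ[ℂ] ℂ) Y :=
  (UniformSpace.Completion.extension_coe ((uniformContinuous_evalT (ρ : V →L[ℂ] ℂ)).comp
    uniformContinuous_subtype_val) Y).trans (evalT_eq_prodT _ _)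

theorem continuous_gelfand (ρ : HermDual V) : Continuous fun X : SymCpl V => gelfand X ρ :=
  UniformSpace.Completion.continuous_extension

theorem gelfand_add (X Y : SymCpl V) (ρ : HermDual V) :
    gelfand (X + Y) ρ = gelfand X ρ + gelfand Y ρ := by
  have h := continuous_gelfand ρ
  induction X, Y using UniformSpace.Completion.induction_on₂ with
  | hp => exact isClosed_eq (by fun_prop) (by fun_prop)
  | ih X Y =>
    rw [← UniformSpace.Completion.coe_add, gelfand_coe, gelfand_coe, gelfand_coe]
    exact map_add _ _ _

theorem gelfand_smul (c : ℂ) (X : SymCpl V) (ρ : HermDual V) :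
    gelfand (c • X) ρ = c * gelfand X ρ := by
  have h := continuous_gelfand ρ
  induction X using UniformSpace.Completion.induction_on with
  | hp => exact isClosed_eq (h.comp (continuous_const_smul c)) (continuous_const.mul h)
  | ih X =>
    rw [← UniformSpace.Completion.coe_smul, gelfand_coe, gelfand_coe]
    exact map_smul _ _ _

theorem gelfand_mul (X Y : SymCpl V) (ρ : HermDual V) :
    gelfand (X * Y) ρ = gelfand X ρ * gelfand Y ρ := by
  have h := continuous_gelfand ρ
  induction X, Y using UniformSpace.Completion.induction_on₂ with
  | hp => exact isClosed_eq (by fun_prop) (by fun_prop)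
  | ih X Y =>
    rw [← UniformSpace.Completion.coe_mul, gelfand_coe, gelfand_coe, gelfand_coe, coe_vee,
      prodT_symm, prodT_mul]

theorem gelfand_one (ρ : HermDual V) : gelfand (1 : SymCpl V) ρ = 1 := by
  rw [← UniformSpace.Completion.coe_one, gelfand_coe, coe_one, prodT_one]

/-- The Gel'fand transformation as a homomorphism of unital algebras. -/
def gelfandAlgHom : SymCpl V →ₐ[ℂ] (HermDual V → ℂ) :=
  AlgHom.ofLinearMap
    { toFun := gelfand
      map_add' := fun X Y => funext (gelfand_add X Y)
      map_smul' := fun c X => funext (gelfand_smul c X) }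
    (funext gelfand_one) fun X Y => funext (gelfand_mul X Y)

theorem gelfand_sub (X Y : SymCpl V) : gelfand (X - Y) = gelfand X - gelfand Y :=
  map_sub gelfandAlgHom X Y

theorem gelfand_star [StarModule ℂ V] [ContinuousStar V] (X : SymCpl V) (ρ : HermDual V) :
    gelfand (star X) ρ = conj (gelfand X ρ) := by
  have h := continuous_gelfand ρ
  have hs : Continuous (star : SymCpl V → SymCpl V) := UniformSpace.Completion.continuous_map
  induction X using UniformSpace.Completion.induction_on with
  | hp => exact isClosed_eq (h.comp hs) (Complex.continuous_conj.comp h)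
  | ih X =>
    have : star (X : SymCpl V) = ((star X : symTens V) : SymCpl V) :=
      UniformSpace.Completion.map_coe uniformContinuous_star X
    rw [this, gelfand_coe, gelfand_coe, coe_star, prodT_starT _ ρ.2]

theorem norm_gelfand_le {α : HermForm V} {ρ : HermDual V}
    (h : ∀ v, ‖(ρ : V →L[ℂ] ℂ) v‖ ≤ α.nrm v) (X : SymCpl V) :
    ‖gelfand X ρ‖ ≤ 2 * ‖symFock (α.scale 16) X‖ := by
  have hg := continuous_gelfand ρ
  induction X using UniformSpace.Completion.induction_on with
  | hp => exact isClosed_le (by fun_prop) (by fun_prop)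
  | ih X =>
    rw [gelfand_coe, symFock_coe, norm_toFock]
    exact norm_prodT_le_of_le h X

theorem tendstoUniformlyOn_gelfand {α : HermForm V} {B : Set (HermDual V)}
    (hB : ∀ ρ ∈ B, ∀ v, ‖(ρ : V →L[ℂ] ℂ) v‖ ≤ α.nrm v) (X : SymCpl V) :
    TendstoUniformlyOn (fun Y => gelfand Y) (gelfand X) (nhds X) B := by
  rw [Metric.tendstoUniformlyOn_iff]
  intro ε hε
  have hc : Continuous fun Y : SymCpl V => 2 * ‖symFock (α.scale 16) (X - Y)‖ := by fun_prop
  filter_upwards [(hc.tendsto' X 0 (by simp)).eventually (gt_mem_nhds hε)] with Y hY ρ hρ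
  rw [dist_eq_norm, ← Pi.sub_apply, ← gelfand_sub]
  exact (norm_gelfand_le (hB ρ hρ) _).trans_lt hY

theorem hasDerivAt_gelfand_coe (Y : symTens V) (σ ρ : HermDual V) (t : ℝ) :
    HasDerivAt (fun t : ℝ => gelfand (Y : SymCpl V) (σ + t • ρ))
      (gelfand (derivSym (ρ : V →L[ℂ] ℂ) Y) (σ + t • ρ)) t := by
  have hline (t : ℝ) : (((σ + t • ρ : HermDual V) : V →L[ℂ] ℂ) : V →ₗ[ℂ] ℂ) =
      ((σ : V →L[ℂ] ℂ) : V →ₗ[ℂ] ℂ) + (t : ℂ) • ((ρ : V →L[ℂ] ℂ) : V →ₗ[ℂ] ℂ) := by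
    ext v
    simp
  simp only [gelfand_coe, derivSym_coe, hline]
  exact hasDerivAt_prodT _ _ Y.2 t

theorem hasLineDerivAt_gelfand (X : SymCpl V) (σ ρ : HermDual V) :
    HasLineDerivAt ℝ (gelfand X) (gelfand (derivSym (ρ : V →L[ℂ] ℂ) X) σ) σ ρ := by
  let l : Filter (symTens V) := Filter.comap (↑) (nhds X)
  have hl : l.NeBot := UniformSpace.Completion.isDenseInducing_coe.comap_nhds_neBot X
  have hX : Filter.Tendsto (fun Y : symTens V => (Y : SymCpl V)) l (nhds X) :=
    Filter.tendsto_comap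
  have hunif : TendstoUniformlyOn
      (fun (Y : symTens V) (t : ℝ) =>
        gelfand (derivSym (ρ : V →L[ℂ] ℂ) (Y : SymCpl V)) (σ + t • ρ))
      (fun t => gelfand (derivSym (ρ : V →L[ℂ] ℂ) X) (σ + t • ρ)) l (Metric.ball 0 1) :=
    fun u hu => by
      have hB : ∀ τ ∈ (fun t : ℝ => σ + t • ρ) '' Metric.ball 0 1, ∀ v,
          ‖(τ : V →L[ℂ] ℂ) v‖ ≤
            (((rankOne (σ : V →L[ℂ] ℂ)).add (rankOne (ρ : V →L[ℂ] ℂ))).scale (2 ^ 2)).nrm v := by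
        rintro _ ⟨t, ht, rfl⟩
        exact norm_add_smul_apply_le σ ρ (mem_ball_zero_iff.1 ht).le
      have hu' := tendstoUniformlyOn_gelfand hB (derivSym (ρ : V →L[ℂ] ℂ) X) u hu
      filter_upwards [(((derivSym (ρ : V →L[ℂ] ℂ)).continuous.tendsto X).comp hX).eventually hu']
        with Y hY t ht
      exact hY _ (Set.mem_image_of_mem _ ht)
  have := hasDerivAt_of_tendstoUniformlyOn Metric.isOpen_ball hunif
    (Filter.Eventually.of_forall fun Y t _ => hasDerivAt_gelfand_coe Y σ ρ t)
    (fun t _ => ((continuous_gelfand (σ + t • ρ)).tendsto X).comp hX)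
    (Metric.mem_ball_self one_pos)
  simpa only [HasLineDerivAt, zero_smul, add_zero] using this

theorem iterDeriv_gelfand {k : ℕ} (ρ : Fin k → HermDual V) (X : SymCpl V) :
    iterDeriv k ρ (gelfand X) = gelfand (iterDerivSym k (fun i => (ρ i : V →L[ℂ] ℂ)) X) := by
  induction k with
  | zero => rfl
  | succ k ih =>
    funext σ
    rw [iterDeriv, ih]
    exact (hasLineDerivAt_gelfand _ σ (ρ 0)).lineDeriv

theorem gelfand_iterDerivSym_coe {k : ℕ} (ρ : Fin k → HermDual V) (Y : symTens V)
    (σ : HermDual V) :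
    gelfand (iterDerivSym k (fun i => (ρ i : V →L[ℂ] ℂ)) Y) σ =
      pairT k (fun i => ((ρ i : V →L[ℂ] ℂ) : V →ₗ[ℂ] ℂ))
        (translT ((σ : V →L[ℂ] ℂ) : V →ₗ[ℂ] ℂ) Y) := by
  rw [iterDerivSym_coe, gelfand_coe, ← evalT_eq_prodT, evalT_iterDerivT _ _ Y.2]

theorem continuous_gelfand_iterDerivSym {k : ℕ} (ρ : Fin k → HermDual V) (σ : HermDual V) :
    Continuous fun X => gelfand (iterDerivSym k (fun i => (ρ i : V →L[ℂ] ℂ)) X) σ :=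
  (continuous_gelfand σ).comp (iterDerivSym k _).continuous

/-- The coercion of `HermDual V` into the algebraic dual. -/
def HermDual.toLin : HermDual V →ₗ[ℝ] V →ₗ[ℂ] ℂ where
  toFun ρ := (ρ : V →L[ℂ] ℂ)
  map_add' _ _ := rfl
  map_smul' _ _ := rfl

/-- The derivatives of a Gel'fand transform at a point as a multilinear form. -/
def gelfandDeriv (X : SymCpl V) (σ : HermDual V) (k : ℕ) :
    MultilinearMap ℝ (fun _ : Fin k => HermDual V) ℂ where
  toFun ρ := gelfand (iterDerivSym k (fun i => (ρ i : V →L[ℂ] ℂ)) X) σ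
  map_update_add' := fun {_} ρ i x y => by
    induction X using UniformSpace.Completion.induction_on with
    | hp =>
      exact isClosed_eq (continuous_gelfand_iterDerivSym _ σ)
        ((continuous_gelfand_iterDerivSym _ σ).add (continuous_gelfand_iterDerivSym _ σ))
    | ih Y =>
      simp only [gelfand_iterDerivSym_coe]
      rw [← LinearMap.add_apply]
      congr 1
      exact (((pairT k).restrictScalars ℝ).compLinearMap
        fun _ => HermDual.toLin).map_update_add ρ i x y
  map_update_smul' := fun {_} ρ i c x => by
    induction X using UniformSpace.Completion.induction_on with
    | hp =>
      exact isClosed_eq (continuous_gelfand_iterDerivSym _ σ)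
        ((continuous_gelfand_iterDerivSym _ σ).const_smul c)
    | ih Y =>
      simp only [gelfand_iterDerivSym_coe]
      rw [← LinearMap.smul_apply]
      congr 1
      exact (((pairT k).restrictScalars ℝ).compLinearMap
        fun _ => HermDual.toLin).map_update_smul ρ i c x

theorem gelfandDeriv_apply (X : SymCpl V) (σ : HermDual V) {k : ℕ} (ρ : Fin k → HermDual V) :
    gelfandDeriv X σ k ρ = iterDeriv k ρ (gelfand X) σ := by
  rw [iterDeriv_gelfand]; rfl

theorem gelfandDeriv_comp_perm (X : SymCpl V) (σ : HermDual V) {k : ℕ}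
    (ρ : Fin k → HermDual V) (τ : Equiv.Perm (Fin k)) :
    gelfandDeriv X σ k (ρ ∘ τ) = gelfandDeriv X σ k ρ := by
  induction X using UniformSpace.Completion.induction_on with
  | hp =>
    exact isClosed_eq (continuous_gelfand_iterDerivSym _ σ) (continuous_gelfand_iterDerivSym _ σ)
  | ih Y =>
    refine (gelfand_iterDerivSym_coe _ Y σ).trans
      (Eq.trans ?_ (gelfand_iterDerivSym_coe _ Y σ).symm)
    rw [← evalT_iterDerivT _ _ Y.2, ← evalT_iterDerivT _ _ Y.2]
    exact congrArg (evalT _)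
      (iterDerivT_comp_perm (fun i => ((ρ i : V →L[ℂ] ℂ) : V →ₗ[ℂ] ℂ)) τ Y.2)

theorem norm_gelfandDeriv_le {α : HermForm V} {σ : HermDual V}
    (hσ : ∀ v, ‖(σ : V →L[ℂ] ℂ) v‖ ≤ α.nrm v) {k : ℕ} {ρ : Fin k → HermDual V}
    (hρ : ∀ i v, ‖(ρ i : V →L[ℂ] ℂ) v‖ ≤ α.nrm v) (X : SymCpl V) :
    ‖gelfandDeriv X σ k ρ‖ ≤ k.factorial * (2 * ‖symFock (α.scale 16) X‖) := by
  induction X using UniformSpace.Completion.induction_on with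
  | hp => exact isClosed_le (continuous_gelfand_iterDerivSym _ σ).norm (by fun_prop)
  | ih Y =>
    refine (congrArg norm (gelfand_iterDerivSym_coe ρ Y σ)).trans_le ?_
    refine (norm_pairT_le α (fun i => (ρ i : V →L[ℂ] ℂ)) (fun _ => 1)
      (by simpa using hρ) _).trans ?_
    rw [symFock_coe, norm_toFock]
    simp only [NNReal.coe_one, Finset.prod_const_one, mul_one]
    refine mul_le_mul_of_nonneg_left ?_ (Nat.cast_nonneg _)
    exact (tnorm_proj_le α k _).trans (tnorm_translT_le hσ _)

theorem isSmooth_gelfand (X : SymCpl V) : IsSmooth (gelfand X) := by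
  refine ⟨fun k ρ σ ρ₀ => ?_, fun k σ => ⟨gelfandDeriv X σ k, fun ρ => gelfandDeriv_apply X σ ρ,
    fun ρ τ => gelfandDeriv_comp_perm X σ ρ τ, ?_⟩⟩
  · rw [iterDeriv_gelfand]
    exact (hasLineDerivAt_gelfand _ σ ρ₀).lineDifferentiableAt
  · rintro B ⟨α, -, hB⟩
    let β := α.add (rankOne (σ : V →L[ℂ] ℂ))
    refine ⟨_, fun ρ hρ => norm_gelfandDeriv_le (α := β) (fun v => ?_) (fun i v => ?_) X⟩
    · exact norm_apply_le_nrm_add_rankOne _ α v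
    · exact (hB _ (hρ i) v).trans (α.nrm_le_add_left _ v)

variable {α : HermForm V} [StarModule ℂ V] [IsTopologicalAddGroup V]
  [ContinuousStar V] [ContinuousSMul ℂ V]

theorem orthonormal_fockTensor (hα : α.Compatible) {I : Type*} {e : I → HermCpl α}
    (he : Orthonormal ℝ e) :
    Orthonormal ℂ fun p : Σ k, Fin k → I =>
      ((√(p.1.factorial : ℝ) : ℝ) : ℂ)⁻¹ • fockTensor hα p.1 fun j => e (p.2 j) := by
  classical
  rw [orthonormal_iff_ite]
  rintro ⟨k, i⟩ ⟨l, j⟩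
  rw [inner_smul_left, inner_smul_right]
  by_cases hkl : k = l
  swap
  · rw [inner_fockTensor_of_ne hα hkl, if_neg (fun h => hkl (congrArg Sigma.fst h))]
    simp
  subst hkl
  have hk : ((√(k.factorial : ℝ) : ℝ) : ℂ) ^ 2 = k.factorial := by
    rw [← Complex.ofReal_pow, Real.sq_sqrt (Nat.cast_nonneg _), Complex.ofReal_natCast]
  have hk0 : ((√(k.factorial : ℝ) : ℝ) : ℂ) ≠ 0 := by
    simp [Nat.factorial_ne_zero]
  rw [inner_fockTensor_fockTensor]
  simp only [orthonormal_iff_ite.1 he]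
  by_cases hij : i = j
  · subst hij
    simp only [if_true, Complex.ofReal_one, Finset.prod_const_one, mul_one, map_inv₀,
      Complex.conj_ofReal]
    rw [← hk]
    field_simp
  · obtain ⟨m, hm⟩ := Function.ne_iff.1 hij
    rw [Finset.prod_eq_zero (Finset.mem_univ m) (by simp [hm]), if_neg (by simpa using hij)]
    simp

theorem sum_norm_gelfandDeriv_le {β : HermForm V} (hα : α.Compatible)
    (hαβ : ∀ v, α.nrm v ≤ β.nrm v) {ξ : HermDual V}
    (hξ : ∀ v, ‖(ξ : V →L[ℂ] ℂ) v‖ ≤ β.nrm v) {I : Type*} {e : I → HermCpl α}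
    (he : Orthonormal ℝ e) (s : Finset (Σ k, Fin k → I)) (X : SymCpl V) :
    ∑ p ∈ s, (p.1.factorial : ℝ)⁻¹ * ‖gelfandDeriv X ξ p.1 fun j => flat α (e (p.2 j))‖ ^ 2 ≤
      (2 * ‖symFock (β.scale 16) X‖) ^ 2 := by
  induction X using UniformSpace.Completion.induction_on with
  | hp =>
    refine isClosed_le (continuous_finsetSum _ fun p _ => continuous_const.mul ?_) (by fun_prop)
    exact (continuous_gelfand_iterDerivSym _ ξ).norm.pow 2
  | ih Y =>
    let Z := translT ((ξ : V →L[ℂ] ℂ) : V →ₗ[ℂ] ℂ) (Y : Tens V)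
    have h (p : Σ k, Fin k → I) : (p.1.factorial : ℝ)⁻¹ *
        ‖gelfandDeriv (Y : SymCpl V) ξ p.1 fun j => flat α (e (p.2 j))‖ ^ 2 =
        ‖(inner ℂ (((√(p.1.factorial : ℝ) : ℝ) : ℂ)⁻¹ • fockTensor hα p.1 fun j => e (p.2 j))
          (toFock α Z) : ℂ)‖ ^ 2 := by
      rw [inner_smul_left, inner_fockTensor, norm_mul, mul_pow]
      congr 1
      · simp
      · exact congrArg (‖·‖ ^ 2) (gelfand_iterDerivSym_coe _ Y ξ)
    simp only [h]
    refine ((orthonormal_fockTensor hα he).sum_inner_products_le _).trans ?_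
    rw [norm_toFock, symFock_coe, norm_toFock]
    exact pow_le_pow_left₀ (apply_nonneg _ _)
      ((tnorm_mono hαβ Z).trans (tnorm_translT_le hξ Y)) 2

theorem isAnalyticHS_gelfand (X : SymCpl V) : IsAnalyticHS (gelfand X) := by
  refine ⟨isSmooth_gelfand X, fun σ σ' α hα => ?_⟩
  let γ := (rankOne (σ : V →L[ℂ] ℂ)).add (rankOne (σ' : V →L[ℂ] ℂ))
  obtain ⟨I, e, -⟩ := exists_hilbertBasis ℝ (HermCpl α)
  refine ⟨(2 * ‖symFock ((α.add γ).scale 16) X‖₊) ^ 2, I, e, fun ξ hξ => ?_⟩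
  rw [tsum_factorial_enorm_sq_le_iff]
  intro s
  simp only [← gelfandDeriv_apply]
  push_cast
  exact sum_norm_gelfandDeriv_le hα (α.nrm_le_add_left γ)
    (fun v => (norm_apply_le_of_mem_segment hξ v).trans (α.nrm_le_add_right γ v))
    e.orthonormal s X

end Gelfand

section Compatible

variable {V : Type*} [AddCommGroup V] [Module ℂ V] [TopologicalSpace V] [StarAddMonoid V]

theorem HermForm.Compatible.add {α β : HermForm V} (hα : α.Compatible) (hβ : β.Compatible) :
    (α.add β).Compatible := fun v w => by
  simp only [HermForm.add, LinearMap.add_apply, map_add, hα v w, hβ v w]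

theorem compatible_rankOne (ρ : HermDual V) : (rankOne (ρ : V →L[ℂ] ℂ)).Compatible := by
  intro v w
  simp only [rankOne, LinearMap.coe_mk, AddHom.coe_mk, LinearMap.smul_apply, smul_eq_mul,
    ContinuousLinearMap.coe_coe, map_mul, ← ρ.2 v, ← ρ.2 w]

theorem exists_flat_rankOne_eq [StarModule ℂ V] [IsTopologicalAddGroup V] [ContinuousStar V]
    [ContinuousSMul ℂ V] (ρ : HermDual V) :
    ∃ u : HermCpl (rankOne (ρ : V →L[ℂ] ℂ)), ‖u‖ ≤ 1 ∧ flat (rankOne (ρ : V →L[ℂ] ℂ)) u = ρ :=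
  exists_flat_eq ρ zero_le_one fun v => by rw [nrm_rankOne, one_mul]

variable [StarModule ℂ V] [ContinuousStar V]

theorem compatible_add_starForm (α : HermForm V) : (α.add α.starForm).Compatible := fun v w => by
  simp only [HermForm.add, HermForm.starForm, LinearMap.add_apply, LinearMap.coe_mk, AddHom.coe_mk,
    map_add, Complex.conj_conj, star_star]
  exact add_comm _ _

theorem tendsto_zero_of_tendsto_toFock {ι : Type*} {l : Filter ι} {Y : ι → symTens V}
    (h : ∀ α : HermForm V, α.Compatible →
      Filter.Tendsto (fun i => toFock α (Y i : Tens V)) l (nhds 0)) :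
    Filter.Tendsto Y l (nhds 0) := by
  refine tendsto_subtype_rng.2 (tendsto_zero_of_tnorm_le fun α =>
    ⟨fun i => ‖toFock (α.add α.starForm) (Y i)‖, fun i => ?_, ?_⟩)
  · beta_reduce
    rw [norm_toFock]
    exact tnorm_mono (α.nrm_le_add_left _) _
  · simpa using (h _ (compatible_add_starForm α)).norm

theorem symCpl_ext {X Y : SymCpl V}
    (h : ∀ α : HermForm V, α.Compatible → symFock α X = symFock α Y) : X = Y := by
  rw [← sub_eq_zero]
  let l : Filter (symTens V) := Filter.comap (↑) (nhds (X - Y))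
  have hl : l.NeBot := UniformSpace.Completion.isDenseInducing_coe.comap_nhds_neBot _
  have hlim : Filter.Tendsto (fun Z : symTens V => (Z : SymCpl V)) l (nhds (X - Y)) :=
    Filter.tendsto_comap
  have hzero : Filter.Tendsto (fun Z => Z) l (nhds 0) := by
    refine tendsto_zero_of_tendsto_toFock fun α hα => ?_
    have hα0 := ((symFock α).continuous.tendsto _).comp hlim
    simpa only [map_sub, h α hα, sub_self, Function.comp_def, symFock_coe] using hα0
  have hcoe := ((UniformSpace.Completion.continuous_coe (symTens V)).tendsto 0).comp hzero
  exact tendsto_nhds_unique hlim hcoe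

end Compatible

section SelfAdjointTensors

variable {V : Type*} [AddCommGroup V] [Module ℂ V] [StarAddMonoid V] [StarModule ℂ V]

theorem tens_ext_selfAdjoint {W : Type*} [AddCommGroup W] [Module ℂ W] {φ ψ : Tens V →ₗ[ℂ] W}
    (h : ∀ (k : ℕ) (y : Fin k → selfAdjoint V),
      φ (simple fun i => (y i : V)) = ψ (simple fun i => (y i : V))) : φ = ψ := by
  have hspan : Submodule.span ℂ (Set.range ((↑) : selfAdjoint V → V)) = ⊤ := by
    rw [Subtype.range_coe]
    exact span_selfAdjoint
  have hsimple (k : ℕ) : (φ ∘ₗ ofDeg k).compMultilinearMap (PiTensorProduct.tprod ℂ) =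
      (ψ ∘ₗ ofDeg k).compMultilinearMap (PiTensorProduct.tprod ℂ) :=
    MultilinearMap.ext_of_span_eq_top (fun _ => hspan) (h k)
  ext X
  induction X using tens_induction with
  | hadd X Y hX hY => rw [map_add, map_add, hX, hY]
  | h0 c k x =>
    rw [map_smul, map_smul]
    exact congrArg (c • ·) (DFunLike.congr_fun (hsimple k) x)

end SelfAdjointTensors

section Representation

variable {V : Type*} [AddCommGroup V] [Module ℂ V] [TopologicalSpace V]
  [StarAddMonoid V] [StarModule ℂ V]

/-- A multilinear form on `V'_h` is bounded if it is bounded on bounded sets. -/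
def BoundedForm {k : ℕ} (M : MultilinearMap ℝ (fun _ : Fin k => HermDual V) ℂ) : Prop :=
  ∀ B : Set (HermDual V), BoundedSet B → ∃ C : ℝ, ∀ ρ, (∀ i, ρ i ∈ B) → ‖M ρ‖ ≤ C

variable [IsTopologicalAddGroup V] [ContinuousStar V] [ContinuousSMul ℂ V] {α : HermForm V}

variable (α) in
/-- The map `v ↦ v^♭` as a real-linear map into `V'_h`. -/
def flatLin : HermCpl α →ₗ[ℝ] HermDual V where
  toFun := flat α
  map_add' := flat_add
  map_smul' := flat_smul

theorem exists_continuousMultilinearMap_flat (hα : α.Compatible) {k : ℕ}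
    {M : MultilinearMap ℝ (fun _ : Fin k => HermDual V) ℂ} (hM : BoundedForm M) :
    ∃ N : ContinuousMultilinearMap ℝ (fun _ : Fin k => HermCpl α) ℂ,
      ∀ v, N v = M fun i => flat α (v i) := by
  obtain ⟨C, hC⟩ := hM {ρ | ∃ u : HermCpl α, ‖u‖ ≤ 1 ∧ flat α u = ρ} ⟨α, hα, by
    rintro _ ⟨u, hu, rfl⟩ v
    exact (norm_flat_apply_le hα u v).trans (mul_le_of_le_one_left (α.nrm_nonneg v) hu)⟩
  refine ⟨(M.compLinearMap fun _ => flatLin α).mkContinuous C fun v => ?_, fun v => rfl⟩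
  have hv : v = fun i => ‖v i‖ • (‖v i‖⁻¹ • v i) := by
    funext i
    by_cases h : v i = 0
    · simp [h]
    · rw [smul_smul, mul_inv_cancel₀ (norm_ne_zero_iff.2 h), one_smul]
  conv_lhs => rw [hv, MultilinearMap.map_smul_univ, norm_smul, norm_prod]
  simp only [norm_norm]
  rw [mul_comm]
  refine mul_le_mul_of_nonneg_right (hC _ fun i => ⟨_, ?_, rfl⟩) (by positivity)
  rw [norm_smul, norm_inv, norm_norm]
  exact inv_mul_le_one

/-- The vector `x` of the Fock space of `α` has the multilinear forms `M k` on `V'_h` as its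
coefficients. -/
def HasCoeffs (hα : α.Compatible) (x : FockCpl α)
    (M : ∀ k, MultilinearMap ℝ (fun _ : Fin k => HermDual V) ℂ) : Prop :=
  ∀ k (v : Fin k → HermCpl α), inner ℂ (fockTensor hα k v) x = M k fun i => flat α (v i)

theorem exists_hasCoeffs (hα : α.Compatible)
    {M : ∀ k, MultilinearMap ℝ (fun _ : Fin k => HermDual V) ℂ} (hM : ∀ k, BoundedForm (M k))
    {I : Type*} (e : HilbertBasis I ℝ (HermCpl α)) {C : ℝ}
    (h : ∀ s : Finset (Σ k, Fin k → I),
      ∑ p ∈ s, (p.1.factorial : ℝ)⁻¹ * ‖M p.1 fun j => flat α (e (p.2 j))‖ ^ 2 ≤ C) :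
    ∃ x : FockCpl α, ‖x‖ ^ 2 ≤ C ∧ HasCoeffs hα x M := by
  obtain ⟨x, hx, hxa⟩ := exists_inner_eq_of_orthonormal (orthonormal_fockTensor hα e.orthonormal)
    (fun p => ((√(p.1.factorial : ℝ) : ℝ) : ℂ)⁻¹ * M p.1 fun j => flat α (e (p.2 j)))
    (fun s => (Finset.sum_congr rfl fun p _ => by rw [norm_mul, mul_pow]; simp).trans_le (h s))
  refine ⟨x, hx, fun k v => ?_⟩
  obtain ⟨N, hN⟩ := exists_continuousMultilinearMap_flat hα (hM k)
  have hbasis (j : Fin k → I) :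
      inner ℂ (fockTensor hα k fun i => e (j i)) x = N fun i => e (j i) := by
    have hj := hxa ⟨k, j⟩
    rw [inner_smul_left, map_inv₀, Complex.conj_ofReal] at hj
    rw [hN]
    exact mul_left_cancel₀ (by simp [Nat.factorial_ne_zero]) hj
  have hdense : Dense (Submodule.span ℝ (Set.range e) : Set (HermCpl α)) :=
    Submodule.dense_iff_topologicalClosure_eq_top.2 e.dense_span
  have hconj : ((innerSL ℂ x).restrictScalars ℝ).compContinuousMultilinearMap (fockTensor hα k) =
      (Complex.conjCLE : ℂ →L[ℝ] ℂ).compContinuousMultilinearMap N := by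
    refine continuousMultilinearMap_ext_of_dense_span hdense fun j => ?_
    change inner ℂ x (fockTensor hα k _) = conj (N _)
    rw [← hbasis, inner_conj_symm]
  rw [← hN, ← inner_conj_symm]
  exact (congrArg conj (DFunLike.congr_fun hconj v)).trans (Complex.conj_conj _)

theorem FockCpl.ext_fockTensor (hα : α.Compatible) {x y : FockCpl α}
    (h : ∀ k (v : Fin k → HermCpl α),
      inner ℂ (fockTensor hα k v) x = inner ℂ (fockTensor hα k v) y) : x = y := by
  refine FockCpl.ext fun X => ?_
  refine LinearMap.congr_fun (f := (innerSL ℂ x).toLinearMap ∘ₗ toFock α)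
    (g := (innerSL ℂ y).toLinearMap ∘ₗ toFock α) (tens_ext_selfAdjoint fun k v => ?_) X
  have hv := congrArg conj (h k fun i => ((HermSpace.mk α (v i) : HermSpace α) : HermCpl α))
  rw [fockTensor_coe, inner_conj_symm, inner_conj_symm] at hv
  exact hv

theorem HasCoeffs.unique {hα : α.Compatible} {x y : FockCpl α}
    {M : ∀ k, MultilinearMap ℝ (fun _ : Fin k => HermDual V) ℂ} (hx : HasCoeffs hα x M)
    (hy : HasCoeffs hα y M) : x = y :=
  FockCpl.ext_fockTensor hα fun k v => (hx k v).trans (hy k v).symm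

theorem hasCoeffs_symFock (hα : α.Compatible) (X : SymCpl V) :
    HasCoeffs hα (symFock α X) (gelfandDeriv X 0) := fun k v => by
  induction X using UniformSpace.Completion.induction_on with
  | hp =>
    exact isClosed_eq (continuous_const.inner (symFock α).continuous)
      (continuous_gelfand_iterDerivSym _ _)
  | ih Y =>
    refine Eq.trans ?_ (gelfand_iterDerivSym_coe _ Y 0).symm
    have hzero : (((0 : HermDual V) : V →L[ℂ] ℂ) : V →ₗ[ℂ] ℂ) = 0 := rfl
    rw [hzero, translT_zero, symFock_coe, inner_fockTensor]
    rfl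

theorem gelfand_injective : Function.Injective (gelfand : SymCpl V → HermDual V → ℂ) := by
  intro X Y h
  have hderiv : gelfandDeriv X 0 = gelfandDeriv Y 0 := by
    ext k ρ
    rw [gelfandDeriv_apply, gelfandDeriv_apply, h]
  exact symCpl_ext fun α hα =>
    (hasCoeffs_symFock hα X).unique (hderiv ▸ hasCoeffs_symFock hα Y)

end Representation

section Uniqueness

variable {V : Type*} [AddCommGroup V] [Module ℂ V] [TopologicalSpace V]
  [StarAddMonoid V]

theorem IsSmooth.hasDerivAt_line {f : HermDual V → ℂ} (hf : IsSmooth f) (ρ : HermDual V) (k : ℕ)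
    (t : ℝ) :
    HasDerivAt (fun t : ℝ => iterDeriv k (fun _ => ρ) f (t • ρ))
      (iterDeriv (k + 1) (fun _ => ρ) f (t • ρ)) t := by
  have h : HasDerivAt (fun s : ℝ => iterDeriv k (fun _ => ρ) f (t • ρ + s • ρ))
      (iterDeriv (k + 1) (fun _ => ρ) f (t • ρ)) (t - t) := by
    rw [sub_self]
    exact (hf.1 k (fun _ => ρ) (t • ρ) ρ).hasLineDerivAt
  simpa only [← add_smul, add_sub_cancel] using h.comp_sub_const t t

variable [StarModule ℂ V] [IsTopologicalAddGroup V] [ContinuousStar V] [ContinuousSMul ℂ V]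

theorem IsAnalyticHS.exists_hasCoeffs {f : HermDual V → ℂ} (hf : IsAnalyticHS f)
    (σ σ' : HermDual V) {α : HermForm V} (hα : α.Compatible) :
    ∃ C : ℝ≥0, ∀ ξ ∈ segment ℝ σ σ', ∀ M : ∀ k, MultilinearMap ℝ (fun _ : Fin k => HermDual V) ℂ,
      (∀ k ρ, M k ρ = iterDeriv k ρ f ξ) → (∀ k, BoundedForm (M k)) →
        ∃ x : FockCpl α, ‖x‖ ^ 2 ≤ C ∧ HasCoeffs hα x M := by
  obtain ⟨C, I, e, hC⟩ := hf.2 σ σ' α hα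
  refine ⟨C, fun ξ hξ M hM hMb => HilbertTensor.exists_hasCoeffs hα hMb e ?_⟩
  simp only [hM]
  exact (tsum_factorial_enorm_sq_le_iff _ C).1 (hC ξ hξ)

theorem IsAnalyticHS.norm_iterDeriv_line_le {f : HermDual V → ℂ} (hf : IsAnalyticHS f)
    (ρ : HermDual V) : ∃ K : ℝ, ∀ k, ∀ t ∈ Set.Icc (0 : ℝ) 1,
      ‖iterDeriv k (fun _ => ρ) f (t • ρ)‖ ≤ K * √(k.factorial : ℝ) := by
  have hα := compatible_rankOne ρ
  obtain ⟨C, hC⟩ := hf.exists_hasCoeffs 0 ρ hα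
  obtain ⟨u, hu, hρ⟩ := exists_flat_rankOne_eq ρ
  refine ⟨√C, fun k t ht => ?_⟩
  choose M hM _ hMb using fun k => hf.1.2 k (t • ρ)
  obtain ⟨x, hx, hxM⟩ := hC (t • ρ) ⟨1 - t, t, sub_nonneg.2 ht.2, ht.1, sub_add_cancel 1 t,
    by simp⟩ M hM hMb
  have hcoeff : inner ℂ (fockTensor hα k fun _ => u) x = iterDeriv k (fun _ => ρ) f (t • ρ) := by
    rw [hxM, hM, hρ]
  have hnorm : ‖fockTensor hα k fun _ => u‖ ^ 2 ≤ k.factorial := by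
    rw [norm_fockTensor_sq]
    exact mul_le_of_le_one_right (Nat.cast_nonneg _) (Finset.prod_le_one
      (fun _ _ => sq_nonneg _) fun _ _ => pow_le_one₀ (norm_nonneg _) hu)
  calc ‖iterDeriv k (fun _ => ρ) f (t • ρ)‖
      ≤ ‖fockTensor hα k fun _ => u‖ * ‖x‖ := hcoeff ▸ norm_inner_le_norm _ _
    _ ≤ √(k.factorial : ℝ) * √C := by
      gcongr
      · exact Real.le_sqrt_of_sq_le hnorm
      · exact Real.le_sqrt_of_sq_le hx
    _ = √C * √(k.factorial : ℝ) := mul_comm _ _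

theorem IsAnalyticHS.ext {f g : HermDual V → ℂ} (hf : IsAnalyticHS f) (hg : IsAnalyticHS g)
    (h : ∀ (k : ℕ) (ρ : HermDual V),
      iterDeriv k (fun _ => ρ) f 0 = iterDeriv k (fun _ => ρ) g 0) : f = g := by
  funext ρ
  obtain ⟨K, hK⟩ := hf.norm_iterDeriv_line_le ρ
  obtain ⟨L, hL⟩ := hg.norm_iterDeriv_line_le ρ
  have hone := eq_zero_of_hasDerivAt_succ_of_norm_le (K := K + L)
    (h := fun k t => iterDeriv k (fun _ => ρ) f (t • ρ) - iterDeriv k (fun _ => ρ) g (t • ρ))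
    (fun k t => (hf.1.hasDerivAt_line ρ k t).fun_sub (hg.1.hasDerivAt_line ρ k t))
    (fun k => by rw [zero_smul, h, sub_self])
    (fun k t ht => by
      rw [add_mul]
      exact (norm_sub_le _ _).trans (add_le_add (hK k t ht) (hL k t ht)))
  simpa [iterDeriv, sub_eq_zero] using hone

end Uniqueness

section Completeness

variable {V : Type*} [AddCommGroup V] [Module ℂ V] [TopologicalSpace V]

/-- Symmetrisation on the Fock space. -/
def fockSymm (α : HermForm V) : FockCpl α →L[ℂ] FockCpl α :=
  (toFock α ∘ₗ symm).extendOfNorm (toFock α)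

theorem norm_toFock_symm_le (α : HermForm V) (X : Tens V) :
    ‖(toFock α ∘ₗ symm) X‖ ≤ 1 * ‖toFock α X‖ := by
  rw [LinearMap.comp_apply, norm_toFock, norm_toFock, one_mul]
  exact tnorm_symm_le α X

theorem fockSymm_toFock (α : HermForm V) (X : Tens V) :
    fockSymm α (toFock α X) = toFock α (symm X) :=
  LinearMap.extendOfNorm_eq (denseRange_toFock α) ⟨1, norm_toFock_symm_le α⟩ X

theorem inner_fockSymm (α : HermForm V) (x : FockCpl α) (X : Tens V) :
    inner ℂ (fockSymm α x) (toFock α X) = inner ℂ x (toFock α (symm X)) := by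
  refine (denseRange_toFock α).induction_on (p := fun x =>
    inner ℂ (fockSymm α x) (toFock α X) = inner ℂ x (toFock α (symm X))) x ?_ fun Z => ?_
  · exact isClosed_eq (by fun_prop) (by fun_prop)
  · rw [fockSymm_toFock, inner_toFock, inner_toFock, ext_symm]

theorem mem_closure_range_of_fockSymm_eq {α : HermForm V} {x : FockCpl α}
    (hx : fockSymm α x = x) :
    x ∈ closure (Set.range fun Y : symTens V => toFock α (Y : Tens V)) := by
  rw [← hx]
  refine (denseRange_toFock α).induction_on (p := fun x => fockSymm α x ∈ closure _) x ?_
    fun X => ?_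
  · exact isClosed_closure.preimage (fockSymm α).continuous
  · exact subset_closure ⟨⟨symm X, symm_mem X⟩, (fockSymm_toFock α X).symm⟩

variable [StarAddMonoid V]

theorem exists_tendsto_toFock (x : ∀ α : HermForm V, α.Compatible → FockCpl α)
    (hsymm : ∀ α hα, fockSymm α (x α hα) = x α hα)
    (hres : ∀ α β hα hβ, (∀ v, α.nrm v ≤ β.nrm v) → fockRestrict α β (x β hβ) = x α hα) :
    ∃ l : Filter (symTens V), l.NeBot ∧
      ∀ α hα, Filter.Tendsto (fun Y : symTens V => toFock α (Y : Tens V)) l (nhds (x α hα)) := by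
  let F (α : {α : HermForm V // α.Compatible}) : Filter (symTens V) :=
    Filter.comap (fun Y : symTens V => toFock α.1 (Y : Tens V)) (nhds (x α.1 α.2))
  have hanti (α β : {α : HermForm V // α.Compatible}) (h : ∀ v, α.1.nrm v ≤ β.1.nrm v) :
      F β ≤ F α := by
    have hα : (fun Y : symTens V => toFock α.1 (Y : Tens V)) =
        fockRestrict α.1 β.1 ∘ fun Y : symTens V => toFock β.1 (Y : Tens V) :=
      funext fun Y => (fockRestrict_toFock h _).symm
    simp only [F]
    rw [hα, ← hres α.1 β.1 α.2 β.2 h, ← Filter.comap_comap]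
    exact Filter.comap_mono ((fockRestrict α.1 β.1).continuous.tendsto _).le_comap
  have hdir : Directed (· ≥ ·) F := fun α β =>
    ⟨⟨α.1.add β.1, α.2.add β.2⟩, hanti _ _ (α.1.nrm_le_add_left β.1),
      hanti _ _ (α.1.nrm_le_add_right β.1)⟩
  refine ⟨⨅ α, F α, Filter.iInf_neBot_of_directed hdir fun α => ?_, fun α hα => ?_⟩
  · exact Filter.comap_neBot_iff_frequently.2 (mem_closure_iff_frequently.1
      (mem_closure_range_of_fockSymm_eq (hsymm α.1 α.2)))
  · exact Filter.tendsto_iff_comap.2 (iInf_le F ⟨α, hα⟩)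

variable [StarModule ℂ V] [ContinuousStar V]

theorem cauchy_of_tendsto_toFock {l : Filter (symTens V)} [l.NeBot]
    {x : ∀ α : HermForm V, α.Compatible → FockCpl α}
    (h : ∀ α hα, Filter.Tendsto (fun Y : symTens V => toFock α (Y : Tens V)) l
      (nhds (x α hα))) : Cauchy l := by
  refine ⟨inferInstance, ?_⟩
  rw [uniformity_eq_comap_nhds_zero (symTens V), ← Filter.tendsto_iff_comap]
  refine tendsto_zero_of_tendsto_toFock fun α hα => ?_
  have hdiff := ((h α hα).comp (Filter.tendsto_snd (f := l) (g := l))).sub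
    ((h α hα).comp Filter.tendsto_fst)
  simpa only [sub_self, Function.comp_def, ← map_sub, ← Submodule.coe_sub] using hdiff

/-- The completed symmetric tensor algebra is the projective limit of the symmetric parts of the
Fock spaces. -/
theorem exists_symFock_eq (x : ∀ α : HermForm V, α.Compatible → FockCpl α)
    (hsymm : ∀ α hα, fockSymm α (x α hα) = x α hα)
    (hres : ∀ α β hα hβ, (∀ v, α.nrm v ≤ β.nrm v) → fockRestrict α β (x β hβ) = x α hα) :
    ∃ X : SymCpl V, ∀ α hα, symFock α X = x α hα := by
  obtain ⟨l, hl, hlim⟩ := exists_tendsto_toFock x hsymm hres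
  obtain ⟨X, hX⟩ := CompleteSpace.complete ((cauchy_of_tendsto_toFock hlim).map
    (UniformSpace.Completion.uniformContinuous_coe (symTens V)))
  refine ⟨X, fun α hα => ?_⟩
  have hXα := ((symFock α).continuous.tendsto X).comp
    (Filter.tendsto_map'_iff.1 (Filter.tendsto_id'.2 hX))
  exact tendsto_nhds_unique hXα ((hlim α hα).congr fun Y => (symFock_coe Y).symm)

end Completeness

section Surjectivity

variable {V : Type*} [AddCommGroup V] [Module ℂ V] [TopologicalSpace V]
  [IsTopologicalAddGroup V] [ContinuousSMul ℂ V]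
  [StarAddMonoid V] [StarModule ℂ V] [ContinuousStar V]
  {M : ∀ k, MultilinearMap ℝ (fun _ : Fin k => HermDual V) ℂ} {α β : HermForm V}

theorem HasCoeffs.inner_toFock_simple {hα : α.Compatible} {x : FockCpl α}
    (hx : HasCoeffs hα x M) {k : ℕ} (y : Fin k → selfAdjoint V) :
    inner ℂ x (toFock α (simple fun i => (y i : V))) =
      conj (M k fun i => flat α ((HermSpace.mk α (y i) : HermSpace α) : HermCpl α)) := by
  rw [← hx k, fockTensor_coe, inner_conj_symm]
  rfl

theorem HasCoeffs.fockSymm_eq {hα : α.Compatible} {x : FockCpl α} (hx : HasCoeffs hα x M)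
    (hM : ∀ k (ρ : Fin k → HermDual V) (τ : Equiv.Perm (Fin k)), M k (ρ ∘ τ) = M k ρ) :
    fockSymm α x = x := by
  refine FockCpl.ext fun X => ?_
  rw [inner_fockSymm]
  refine LinearMap.congr_fun (f := (innerSL ℂ x).toLinearMap ∘ₗ toFock α ∘ₗ symm)
    (g := (innerSL ℂ x).toLinearMap ∘ₗ toFock α) (tens_ext_selfAdjoint fun k v => ?_) X
  change inner ℂ x (toFock α (symm (simple fun i => (v i : V)))) =
    inner ℂ x (toFock α (simple fun i => (v i : V)))
  have hperm (τ : Equiv.Perm (Fin k)) :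
      inner ℂ x (toFock α (simple ((fun i => (v i : V)) ∘ τ))) =
        inner ℂ x (toFock α (simple fun i => (v i : V))) := by
    refine (hx.inner_toFock_simple (v ∘ τ)).trans (Eq.trans ?_ (hx.inner_toFock_simple v).symm)
    exact congrArg conj
      (hM k (fun i => flat α ((HermSpace.mk α (v i) : HermSpace α) : HermCpl α)) τ)
  rw [symm_simple, map_smul, map_sum, inner_smul_right, inner_sum]
  simp only [hperm]
  exact avg_const _

theorem HasCoeffs.fockRestrict_eq {hα : α.Compatible} {hβ : β.Compatible} {x : FockCpl α}
    {y : FockCpl β} (hx : HasCoeffs hα x M) (hy : HasCoeffs hβ y M)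
    (hαβ : ∀ v, α.nrm v ≤ β.nrm v) : fockRestrict α β y = x := by
  refine FockCpl.ext_fockTensor hα fun k v => ?_
  have hflat (i : Fin k) := exists_flat_eq (α := β) (flat α (v i)) (norm_nonneg (v i)) fun w =>
    (norm_flat_apply_le hα (v i) w).trans (mul_le_mul_of_nonneg_left (hαβ w) (norm_nonneg _))
  choose u _ hu using hflat
  rw [hx]
  simp only [← hu]
  rw [← hy]
  refine (denseRange_toFock β).induction_on (p := fun y =>
    inner ℂ (fockTensor hα k v) (fockRestrict α β y) = inner ℂ (fockTensor hβ k u) y) y ?_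
    fun Z => ?_
  · exact isClosed_eq (by fun_prop) (by fun_prop)
  · rw [fockRestrict_toFock hαβ, inner_fockTensor, inner_fockTensor]
    simp only [flatₗ_apply, hu]

theorem exists_gelfand_eq {f : HermDual V → ℂ} (hf : IsAnalyticHS f) :
    ∃ X : SymCpl V, gelfand X = f := by
  choose M hM hMs hMb using fun k => hf.1.2 k 0
  have hex (α : HermForm V) (hα : α.Compatible) : ∃ x : FockCpl α, HasCoeffs hα x M := by
    obtain ⟨C, hC⟩ := hf.exists_hasCoeffs 0 0 hα
    exact (hC 0 (left_mem_segment ℝ 0 0) M hM hMb).imp fun _ => And.right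
  choose x hx using hex
  obtain ⟨X, hX⟩ := exists_symFock_eq x (fun α hα => (hx α hα).fockSymm_eq hMs)
    (fun α β hα hβ => (hx α hα).fockRestrict_eq (hx β hβ))
  refine ⟨X, (isAnalyticHS_gelfand X).ext hf fun k ρ => ?_⟩
  have hα := compatible_rankOne ρ
  obtain ⟨u, -, hρ⟩ := exists_flat_rankOne_eq ρ
  have hXu := hasCoeffs_symFock hα X k fun _ => u
  rw [hX _ hα, hx, gelfandDeriv_apply, hM, hρ] at hXu
  exact hXu.symm

theorem coe_range_gelfandAlgHom :
    ((gelfandAlgHom (V := V)).range : Set (HermDual V → ℂ)) = {f | IsAnalyticHS f} := by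
  ext f
  constructor
  · rintro ⟨X, rfl⟩
    exact isAnalyticHS_gelfand X
  · exact exists_gelfand_eq

variable (V) in
/-- The unital *-algebra `𝒞^{ω_HS}(V'_h)` of functions that are analytic of Hilbert-Schmidt
type. -/
def analyticHS : StarSubalgebra ℂ (HermDual V → ℂ) where
  toSubalgebra := gelfandAlgHom.range.copy {f | IsAnalyticHS f} coe_range_gelfandAlgHom.symm
  star_mem' {f} hf := by
    obtain ⟨X, rfl⟩ := exists_gelfand_eq hf
    have hstar : star (gelfand X) = gelfand (star X) := funext fun ρ => (gelfand_star X ρ).symm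
    exact hstar ▸ isAnalyticHS_gelfand (star X)

/-- The Gel'fand transformation as an isomorphism of unital *-algebras. -/
def gelfandEquiv : SymCpl V ≃⋆ₐ[ℂ] analyticHS V :=
  { AlgEquiv.ofBijective
      (gelfandAlgHom.codRestrict (analyticHS V).toSubalgebra isAnalyticHS_gelfand)
      ⟨fun _ _ h => gelfand_injective (congrArg Subtype.val h), fun f =>
        (exists_gelfand_eq f.2).imp fun _ h => Subtype.ext h⟩ with
    map_star' := fun X => Subtype.ext (funext (gelfand_star X))
    map_smul' := fun c X => Subtype.ext (funext (gelfand_smul c X)) }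

end Surjectivity

end HilbertTensor

end

theorem theorem3p21_general {V : Type*} [AddCommGroup V] [Module ℂ V] [TopologicalSpace V]
    [IsTopologicalAddGroup V] [ContinuousSMul ℂ V]
    [StarAddMonoid V] [StarModule ℂ V] [ContinuousStar V] :
    ∃ A : StarSubalgebra ℂ (HilbertTensor.HermDual V → ℂ),
      (A : Set (HilbertTensor.HermDual V → ℂ)) = {f | HilbertTensor.IsAnalyticHS f} ∧
      ∃ Φ : HilbertTensor.SymCpl V ≃⋆ₐ[ℂ] A,
        ∀ (X : HilbertTensor.SymCpl V) (ρ : HilbertTensor.HermDual V),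
          (Φ X : HilbertTensor.HermDual V → ℂ) ρ = HilbertTensor.gelfand X ρ :=
  ⟨HilbertTensor.analyticHS V, rfl, HilbertTensor.gelfandEquiv, fun _ _ => rfl⟩

/-- Let `V` be a Hausdorff hilbertisable locally convex space with a continuous antilinear
involution. The functions on `V'_h` that are analytic of Hilbert-Schmidt type form a unital
*-subalgebra of the algebra of all complex functions on `V'_h`, and the Gel'fand transformation is
an isomorphism of unital *-algebras from the completed symmetric tensor algebra onto it. -/
theorem theorem3p21 {V : Type*} [AddCommGroup V] [Module ℂ V] [TopologicalSpace V]
    [IsTopologicalAddGroup V] [ContinuousSMul ℂ V] [T2Space V]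
    (hV : HilbertTensor.Hilbertisable V)
    [StarAddMonoid V] [StarModule ℂ V] [ContinuousStar V] :
    ∃ A : StarSubalgebra ℂ (HilbertTensor.HermDual V → ℂ),
      (A : Set (HilbertTensor.HermDual V → ℂ)) = {f | HilbertTensor.IsAnalyticHS f} ∧
      ∃ Φ : HilbertTensor.SymCpl V ≃⋆ₐ[ℂ] A,
        ∀ (X : HilbertTensor.SymCpl V) (ρ : HilbertTensor.HermDual V),
          (Φ X : HilbertTensor.HermDual V → ℂ) ρ = HilbertTensor.gelfand X ρ :=
  theorem3p21_general
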